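/- **Setting.** Let $y=\sum_{i\ge1}x_i\beta_i+u$, where $u$ is centered with variance $\sigma^2>0$, the $x_i$ are centered, every finite subfamily of $x=(x_i)_{i\ge1}$ has a positive definite covariance matrix, $u$ and $x$ are independent, the series converges in mean square, and $(y,x)$ is jointly Gaussian. Let $(y^{(0)},x^{(0)}),\dots,(y^{(n)},x^{(n)})$ be i.i.d. copies of $(y,x)$; the copies $1,\dots,n$ form the training sample $(Y,X)$, with $Y\in\mathbb R^n$ and $X$ having rows $x^{(1)},\dots,x^{(n)}$. A candidate model $m$ is a pair of disjoint finite index sets $m_1,m_2$ with $|m_1|\ge3$, $|m_2|\ge3$ and $|m|=|m_1|+|m_2|<n$. Let $X_1,X_2$ be the matrices of the columns of $X$ with index in $m_1$ and $m_2$, $X(m)=(X_1,X_2)$, $M_1=I_n-X_1(X_1'X_1)^{-1}X_1'$ and $X_2^*=M_1X_2$ (Moore–Penrose inverses are used where an inverse does not exist). Let $\hat\theta_1^*=(X_1'X_1)^{-1}X_1'Y$, $\hat\theta_2=(X_2'M_1X_2)^{-1}X_2'M_1Y$, and $\hat\sigma^2(m)=\|Y-X(m)\hat\theta\|^2/(n-|m|)$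 with $\hat\theta=(X(m)'X(m))^{-1}X(m)'Y$. For fixed tuning parameters $c_1,c_2\ge0$ put $$a_1=\min\Big\{1,\,c_1\hat\sigma^2(m)\frac{|m_1|}{\hat\theta_1^{*\prime}X_1'X_1\hat\theta_1^*}\Big\},\qquad a_2=\min\Big\{1,\,c_2\hat\sigma^2(m)\frac{|m_2|}{\hat\theta_2'X_2^{*\prime}X_2^*\hat\theta_2}\Big\},$$ $\hat\theta_2^{JS}=(1-a_2)\hat\theta_2$ and $\hat\theta_1^{JS}=(1-a_1)\hat\theta_1^*-(X_1'X_1)^{-1}X_1'X_2\hat\theta_2^{JS}$. Let $\hat\beta(m)$ be the sequence with entries $\hat\theta_1^{JS}$ on $m_1$, $\hat\theta_2^{JS}$ on $m_2$ and $0$ elsewhere. Define $$\rho^2(m)=\mathbb E\Big[\Big(\sum_{i}x_i^{(0)}\hat\beta_i(m)-y^{(0)}\Big)^2\,\Big\|\,X,Y\Big],$$ the expectation being over $(y^{(0)},x^{(0)})$ with the training sample held fixed, and $$\hat\rho^2(m)=w_1\hat\sigma^2(m)+w_2\frac{Y'(I_n-M_1)Y}{n}+w_3\frac{Y'M_1Y}{n-|m_1|},$$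 where, with $q=|m_1|/(n-|m_1|+1)$, $$w_1=(1-a_2)^2\frac{|m|}{n-|m|+1}+1-a_2^2-(a_1-a_2)^2q+(a_2-a_1)(2-a_1-a_2)q,$$ $$w_2=a_1^2,\qquad w_3=a_2^2-a_1^2\frac{|m_1|}{n}+(a_2-a_1)^2q.$$ **Lemma 1.** Let $\mathcal M_n$ be a finite non-empty collection of candidate models, $r_n=\min_{m\in\mathcal M_n}|m_1|$ and $s_n=\max_{m\in\mathcal M_n}|m|$. For every $\varepsilon>0$, $$\mathbb P\Big(\sup_{m\in\mathcal M_n}\Big|\log\frac{\hat\rho^2(m)}{\rho^2(m)}\Big|\ge\varepsilon\Big)\le 31\,|\mathcal M_n|\,s_n\exp\Big(-n\Big(\frac{r_n}{n}\Big)^2\Big(1-\frac{s_n}{n}\Big)^5\frac{\varepsilon^2}{14397(1+\varepsilon)^2}\Big),$$ for all data-generating processes as above, where $|\log(\hat\rho^2(m)/\rho^2(m))|$ is read as $\infty$ if $\hat\rho^2(m)\le 0$. Moreover, for every $d>0$ and all such data-generating processes with $\operatorname{Var}(y)/\sigma^2\le d$, the same probability is at most $$31\,|\mathcal M_n|\,s_n\exp\Big(-n\Big(1-\frac{s_n}{n}\Big)^5\frac{\varepsilon^2}{28279(1+\varepsilon)^2d^2}\Big).$$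 -/

import Mathlib

open MeasureTheory ProbabilityTheory Filter Topology
open scoped ENNReal Matrix

noncomputable section

namespace BlockJS

/-- The four Penrose conditions: `B` is the Moore-Penrose inverse of `A`. -/
structure IsMoorePenrose {k l : Type*} [Fintype k] [Fintype l]
    (A : Matrix k l ℝ) (B : Matrix l k ℝ) : Prop where
  aba : A * B * A = A
  bab : B * A * B = B
  symm_ab : (A * B)ᵀ = A * B
  symm_ba : (B * A)ᵀ = B * A

theorem IsMoorePenrose.unique {k l : Type*} [Fintype k] [Fintype l]
    {A : Matrix k l ℝ} {B C : Matrix l k ℝ}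
    (hB : IsMoorePenrose A B) (hC : IsMoorePenrose A C) : B = C := by
  have h1 : A * B = A * C := by
    calc A * B = (A * B)ᵀ := hB.symm_ab.symm
      _ = ((A * C) * (A * B))ᵀ := by rw [← Matrix.mul_assoc (A * C) A B, hC.aba]
      _ = (A * B) * (A * C) := by rw [Matrix.transpose_mul, hB.symm_ab, hC.symm_ab]
      _ = A * C := by rw [← Matrix.mul_assoc (A * B) A C, hB.aba]
  have h2 : B * A = C * A := by
    calc B * A = (B * A)ᵀ := hB.symm_ba.symm
      _ = ((B * A) * (C * A))ᵀ := by
        rw [Matrix.mul_assoc B A (C * A), ← Matrix.mul_assoc A C A, hC.aba]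
      _ = (C * A) * (B * A) := by rw [Matrix.transpose_mul, hB.symm_ba, hC.symm_ba]
      _ = C * A := by rw [Matrix.mul_assoc C A (B * A), ← Matrix.mul_assoc A B A, hB.aba]
  calc B = B * A * B := hB.bab.symm
    _ = C * (A * C) := by rw [h2, Matrix.mul_assoc, h1]
    _ = C := by rw [← Matrix.mul_assoc, hC.bab]

/-- Moore-Penrose inverse of a real square matrix. -/
def pinv {k : Type*} [Fintype k] (A : Matrix k k ℝ) : Matrix k k ℝ :=
  Classical.epsilon (IsMoorePenrose A)

theorem pinv_spec {k : Type*} [Fintype k] {A : Matrix k k ℝ} (hA : A.IsSymm) :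
    IsMoorePenrose A (pinv A) := by
  classical
  apply Classical.epsilon_spec (p := IsMoorePenrose A)
  have hH : A.IsHermitian := by
    rw [Matrix.IsHermitian, Matrix.conjTranspose_eq_transpose_of_trivial]; exact hA
  set U : Matrix k k ℝ := (hH.eigenvectorUnitary : Matrix k k ℝ) with hU
  have hUU : Uᵀ * U = 1 := by
    have := Unitary.coe_star_mul_self hH.eigenvectorUnitary
    rwa [Matrix.star_eq_conjTranspose, Matrix.conjTranspose_eq_transpose_of_trivial] at this
  set v := hH.eigenvalues with hv
  have hAe : A = U * Matrix.diagonal v * Uᵀ := by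
    have := hH.spectral_theorem
    rw [Unitary.conjStarAlgAut_apply, Matrix.star_eq_conjTranspose,
      Matrix.conjTranspose_eq_transpose_of_trivial] at this
    exact this
  have key : ∀ a b : k → ℝ, (U * Matrix.diagonal a * Uᵀ) * (U * Matrix.diagonal b * Uᵀ)
      = U * Matrix.diagonal (fun i => a i * b i) * Uᵀ := by
    intro a b
    rw [← Matrix.diagonal_mul_diagonal]
    calc _ = U * Matrix.diagonal a * (Uᵀ * U) * Matrix.diagonal b * Uᵀ := by
          simp only [Matrix.mul_assoc]
      _ = _ := by rw [hUU, Matrix.mul_one, Matrix.mul_assoc U]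
  have ht : ∀ a : k → ℝ, (U * Matrix.diagonal a * Uᵀ)ᵀ = U * Matrix.diagonal a * Uᵀ := by
    intro a
    simp [Matrix.transpose_mul, Matrix.mul_assoc]
  refine ⟨U * Matrix.diagonal (fun i => (v i)⁻¹) * Uᵀ, ?_, ?_, ?_, ?_⟩
  · rw [hAe, key, key]; congr 3; ext i; exact mul_inv_mul_cancel (v i)
  · rw [hAe, key, key]; congr 3; ext i
    simpa only [inv_inv] using mul_inv_mul_cancel (v i)⁻¹
  · rw [hAe, key, ht]
  · rw [hAe, key, ht]

theorem pinv_eq_inv {k : Type*} [Fintype k] [DecidableEq k] {A : Matrix k k ℝ}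
    (hA : IsUnit A.det) : pinv A = A⁻¹ := by
  have h : IsMoorePenrose A A⁻¹ := by
    constructor <;> simp [Matrix.mul_nonsing_inv A hA, Matrix.nonsing_inv_mul A hA]
  exact (Classical.epsilon_spec (p := IsMoorePenrose A) ⟨_, h⟩).unique h

/-- The data-generating process `y = ∑ᵢ xᵢ βᵢ + u`. Here `σsq` is the error variance. -/
structure IsDGP {Ω : Type*} [MeasurableSpace Ω] (P : Measure Ω)
    (y u : Ω → ℝ) (x : ℕ → Ω → ℝ) (β : ℕ → ℝ) (σsq : ℝ) : Prop where
  error_memLp : MemLp u 2 P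
  error_centered : ∫ ω, u ω ∂P = 0
  error_variance : Var[u; P] = σsq
  variance_pos : 0 < σsq
  regressor_centered : ∀ i, ∫ ω, x i ω ∂P = 0
  /-- Every finite subfamily of regressors has a positive definite covariance matrix. -/
  cov_posDef : ∀ I : Finset ℕ,
    (Matrix.of fun i j : I => ∫ ω, x i ω * x j ω ∂P).PosDef
  indep : IndepFun u (fun ω i => x i ω) P
  /-- The series `∑ᵢ xᵢ βᵢ` converges in mean square, with limit `y - u`. -/
  series : Tendsto
    (fun N => eLpNorm (fun ω => y ω - u ω - ∑ i ∈ Finset.range N, x i ω * β i) 2 P)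
    atTop (𝓝 0)
  /-- `(y, x)` is jointly Gaussian. -/
  gaussian : IsGaussianProcess (fun o : Option ℕ => o.elim y x) P

/-- `(ys j, xs j)`, `j = 0, …, n`, are i.i.d. copies of `(y, x)`: the copy `0` is the new
observation, the copies `1, …, n` are the training sample. -/
structure IsIIDCopies {Ω : Type*} [MeasurableSpace Ω] (P : Measure Ω) {n : ℕ}
    (y : Ω → ℝ) (x : ℕ → Ω → ℝ)
    (ys : Fin (n + 1) → Ω → ℝ) (xs : Fin (n + 1) → ℕ → Ω → ℝ) : Prop where
  indep : iIndepFun (fun j ω => (ys j ω, fun i => xs j i ω)) P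
  ident : ∀ j, IdentDistrib (fun ω => (ys j ω, fun i => xs j i ω))
    (fun ω => (y ω, fun i => x i ω)) P P

/-- A candidate model: the unrestricted coordinates, split into two disjoint blocks. -/
structure Model where
  block₁ : Finset ℕ
  block₂ : Finset ℕ
  disj : Disjoint block₁ block₂

namespace Model

variable (m : Model)

/-- `|m₁|` -/
def size₁ : ℕ := m.block₁.card

/-- `|m₂|` -/
def size₂ : ℕ := m.block₂.card

/-- `|m| = |m₁| + |m₂|` -/
def size : ℕ := m.size₁ + m.size₂

/-! In what follows `X j i` is the `i`-th regressor of the `j`-th training observation, `Y j`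
its response, and `c₁`, `c₂` are the tuning parameters. -/

variable {n : ℕ} (c₁ c₂ : ℝ) (X : Fin n → ℕ → ℝ) (Y : Fin n → ℝ)

/-- `X₁(m)` -/
def X₁ : Matrix (Fin n) m.block₁ ℝ := Matrix.of fun j i => X j i

/-- `X₂(m)` -/
def X₂ : Matrix (Fin n) m.block₂ ℝ := Matrix.of fun j i => X j i

/-- `X(m) = (X₁(m), X₂(m))` -/
def XX : Matrix (Fin n) (m.block₁ ⊕ m.block₂) ℝ := Matrix.fromCols (m.X₁ X) (m.X₂ X)

/-- `M₁(m)`, the projection onto the orthogonal complement of the column span of `X₁(m)` -/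
def M₁ : Matrix (Fin n) (Fin n) ℝ :=
  1 - m.X₁ X * pinv ((m.X₁ X)ᵀ * m.X₁ X) * (m.X₁ X)ᵀ

/-- `X₂*(m) = M₁(m) X₂(m)` -/
def X₂star : Matrix (Fin n) m.block₂ ℝ := m.M₁ X * m.X₂ X

/-- least-squares estimator `θ̂₁*` -/
def ls₁ : m.block₁ → ℝ := (pinv ((m.X₁ X)ᵀ * m.X₁ X) * (m.X₁ X)ᵀ) *ᵥ Y

/-- least-squares estimator `θ̂₂` -/
def ls₂ : m.block₂ → ℝ :=
  (pinv ((m.X₂ X)ᵀ * m.M₁ X * m.X₂ X) * (m.X₂ X)ᵀ * m.M₁ X) *ᵥ Y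

/-- least-squares estimator `θ̂` in the whole model `m` -/
def ls : m.block₁ ⊕ m.block₂ → ℝ := (pinv ((m.XX X)ᵀ * m.XX X) * (m.XX X)ᵀ) *ᵥ Y

/-- the usual unbiased variance estimator `σ̂²(m)` -/
def sigmaHatSq : ℝ :=
  ((Y - m.XX X *ᵥ m.ls X Y) ⬝ᵥ (Y - m.XX X *ᵥ m.ls X Y)) / ((n : ℝ) - m.size)

/-- `c₁ σ̂²(m) |m₁| / (θ̂₁*' X₁(m)' X₁(m) θ̂₁*)` -/
def ratio₁ : ℝ :=
  c₁ * m.sigmaHatSq X Y *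
    (m.size₁ / (m.ls₁ X Y ⬝ᵥ (((m.X₁ X)ᵀ * m.X₁ X) *ᵥ m.ls₁ X Y)))

/-- `c₂ σ̂²(m) |m₂| / (θ̂₂' X₂*(m)' X₂*(m) θ̂₂)` -/
def ratio₂ : ℝ :=
  c₂ * m.sigmaHatSq X Y *
    (m.size₂ / (m.ls₂ X Y ⬝ᵥ (((m.X₂star X)ᵀ * m.X₂star X) *ᵥ m.ls₂ X Y)))

/-- shrinkage factor `a₁(m)` -/
def a₁ : ℝ := min 1 (m.ratio₁ c₁ X Y)

/-- shrinkage factor `a₂(m)` -/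
def a₂ : ℝ := min 1 (m.ratio₂ c₂ X Y)

/-- positive part James-Stein estimator of `θ₁*` -/
def js₁star : m.block₁ → ℝ := max (1 - m.ratio₁ c₁ X Y) 0 • m.ls₁ X Y

/-- positive part James-Stein estimator of `θ₂` -/
def js₂ : m.block₂ → ℝ := max (1 - m.ratio₂ c₂ X Y) 0 • m.ls₂ X Y

/-- the resulting estimator of `θ₁` -/
def js₁ : m.block₁ → ℝ :=
  m.js₁star c₁ X Y -
    (pinv ((m.X₁ X)ᵀ * m.X₁ X) * (m.X₁ X)ᵀ * m.X₂ X) *ᵥ m.js₂ c₂ X Y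

/-- the block James-Stein estimator of `β` in model `m` -/
def betaHat (i : ℕ) : ℝ :=
  if h : i ∈ m.block₁ then m.js₁ c₁ c₂ X Y ⟨i, h⟩
  else if h : i ∈ m.block₂ then m.js₂ c₂ X Y ⟨i, h⟩
  else 0

/-- The mean-squared prediction error `ρ²(m)` for the new observation `(y₀, x₀)` with law
under `P`; the training sample `(Y, X)` is held fixed. -/
def rhoSq {Ω : Type*} [MeasurableSpace Ω] (P : Measure Ω) (y₀ : Ω → ℝ) (x₀ : ℕ → Ω → ℝ) : ℝ :=
  ∫ ω, ((∑' i, x₀ i ω * m.betaHat c₁ c₂ X Y i) - y₀ ω) ^ 2 ∂P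

/-- weight `w₁` -/
def w₁ : ℝ :=
  (1 - m.a₂ c₂ X Y) ^ 2 * (m.size / ((n : ℝ) - m.size + 1)) + 1 - m.a₂ c₂ X Y ^ 2
    - (m.a₁ c₁ X Y - m.a₂ c₂ X Y) ^ 2 * (m.size₁ / ((n : ℝ) - m.size₁ + 1))
    + (m.a₂ c₂ X Y - m.a₁ c₁ X Y) * (2 - m.a₁ c₁ X Y - m.a₂ c₂ X Y)
      * (m.size₁ / ((n : ℝ) - m.size₁ + 1))

/-- weight `w₂` -/
def w₂ : ℝ := m.a₁ c₁ X Y ^ 2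

/-- weight `w₃` -/
def w₃ : ℝ :=
  m.a₂ c₂ X Y ^ 2 - m.a₁ c₁ X Y ^ 2 * (m.size₁ / (n : ℝ))
    + (m.a₂ c₂ X Y - m.a₁ c₁ X Y) ^ 2 * (m.size₁ / ((n : ℝ) - m.size₁ + 1))

/-- the empirical mean-squared prediction error `ρ̂²(m)` -/
def rhoHatSq : ℝ :=
  m.w₁ c₁ c₂ X Y * m.sigmaHatSq X Y
    + m.w₂ c₁ X Y * ((Y ⬝ᵥ ((1 - m.M₁ X) *ᵥ Y)) / (n : ℝ))
    + m.w₃ c₁ c₂ X Y * ((Y ⬝ᵥ (m.M₁ X *ᵥ Y)) / ((n : ℝ) - m.size₁))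

end Model

/-- `|log t|` with values in `[0, ∞]`; it is `∞` where `t` is not positive. -/
def absLog (t : ℝ) : ℝ≥0∞ := if 0 < t then ENNReal.ofReal |Real.log t| else ∞

end BlockJS

end

open MeasureTheory ProbabilityTheory Filter Topology
open scoped ENNReal Matrix

namespace BlockJS


/-! Fix a model and whiten it. The second moments of (regressors in block 1, regressors in block 2,
response) are positive definite, hence equal to `Λᵀ * Λ` with `Λ` block upper triangular. Dividing
by `Λ` turns the training sample into an array `G` of independent standard normals (rows are
variables, columns are observations), with X₁ = C₁ᵀL₁, X₂ = C₁ᵀB + C₂ᵀL₂ and Y = aC₁ + bC₂ + σg.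
Here σ² is the variance of the part of y not linearly explained by the model, and a, b are the
standardized coefficients.

In these coordinates the least-squares errors are functions of `G` alone: v for the regression on
block 1, and (u, d) for the full regression. For shrinkage factors x₁, x₂ the prediction error is σ²
+ |(1-x₂)u + (x₂-x₁)v - x₁a|² + |(1-x₂)d - x₂b|². Its expansion involves |u|²+|d|², |v|², u·v and
linear functionals of the errors. The first two concentrate at s·qm and (s+t₂)·q, where s = σ², t₁ =
|a|², t₂ = |b|², q = k₁/(n-k₁+1), qm = k/(n-k+1); u·v concentrates at (s - b·d)q, and the linear
functionals are small. Substituting these values gives `target`; substituting s, s+t₂, s+t₂+t₁ for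
the variance estimators in the empirical error gives the same polynomial. All comparisons are
uniform over x₁, x₂ in [0,1], so the dependence of the shrinkage factors on the data is harmless.

Concentration rests on three facts. Residual sums of squares are chi-square (`quadForm_tail`). Given
the design C, the squared length of the coefficients of noise is distributed as h'(CC')⁻¹h with h
standard normal; with h held fixed instead, |h|²/h'(CC')⁻¹h is chi-square with n-k+1 degrees of
freedom (`gram_inv_quadForm_tail`, `coef_normSq_tail`). For the cross term u·v the weights of the
full residual are random, but they depend on the remaining rows only through their residuals from
block 1, which are independent of the fitted parts (`stdM_coef_unit`); polarization then reduces the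
bilinear form to quadratic ones (`abs_dotProduct_sub_le`).

The errors must be small relative to `target`. The dangerous term is x₁²t₂, controlled by a constant
K: either K = (n+1)/r, from minimizing over x₂, or K = d, from t₂ ≤ dσ² (`sq_mul_le_mul_target`).
The two choices give the two bounds. With relative accuracy τ = η²ε/(50(1+ε)K), η = 1-k/n, the
deterministic estimates `rhoHat_close` and `rho_close` hold on the event `Good`, whose complement
has probability at most 34 exp(-(n-k)τ²/4.2). A union bound over models finishes. -/

/-- The standard Gaussian measure on `ι → ℝ`. -/
noncomputable def stdG (ι : Type*) [Fintype ι] : Measure (ι → ℝ) :=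
  Measure.pi fun _ => gaussianReal 0 1

/-- The law of a matrix with independent standard normal entries; `κ` indexes rows. -/
noncomputable def stdM (κ ι : Type*) [Fintype κ] [Fintype ι] : Measure (κ → ι → ℝ) :=
  Measure.pi fun _ => stdG ι

instance (ι : Type*) [Fintype ι] : IsProbabilityMeasure (stdG ι) := by
  unfold stdG; infer_instance

instance (κ ι : Type*) [Fintype κ] [Fintype ι] : IsProbabilityMeasure (stdM κ ι) := by
  unfold stdM; infer_instance

/-! ### Standard Gaussian vectors and matrices and their invariances -/

section Law

variable {Ω : Type*} [MeasurableSpace Ω] {P : Measure Ω}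
variable {ι α κ κ' : Type*} [Fintype ι] [Fintype α] [Fintype κ] [Fintype κ']

/-- Uncorrelated coordinates of a jointly Gaussian vector are independent, so mean and covariance
determine the product law. -/
theorem hasLaw_stdG [DecidableEq ι] {g : ι → Ω → ℝ} (hg : HasGaussianLaw (fun ω i => g i ω) P)
    (hmean : ∀ i, ∫ ω, g i ω ∂P = 0)
    (hcov : ∀ i j, cov[g i, g j; P] = if i = j then 1 else 0) :
    HasLaw (fun ω i => g i ω) (stdG ι) P := by
  have hind : iIndepFun g P := hg.iIndepFun_of_covariance_eq_zero (fun i j hij => by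
    rw [hcov, if_neg hij])
  refine hind.hasLaw_pi (fun i => ⟨?_, ?_⟩)
  · exact (hg.eval i).aemeasurable
  · rw [(hg.eval i).map_eq_gaussianReal, hmean, ← covariance_self (hg.eval i).aemeasurable, hcov]
    simp

theorem hasLaw_stdG_eval (i : ι) :
    HasLaw (fun x : ι → ℝ => x i) (gaussianReal 0 1) (stdG ι) :=
  ⟨(measurable_pi_apply i).aemeasurable,
    (measurePreserving_eval (fun _ : ι => gaussianReal 0 1) i).map_eq⟩

theorem iIndepFun_stdG : iIndepFun (fun (i : ι) (x : ι → ℝ) => x i) (stdG ι) :=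
  iIndepFun_pi (μ := fun _ : ι => gaussianReal 0 1) (X := fun _ x => x) (fun _ => by fun_prop)

theorem hasGaussianLaw_stdG : HasGaussianLaw (fun (x : ι → ℝ) i => x i) (stdG ι) :=
  iIndepFun_stdG.hasGaussianLaw (fun i => (hasLaw_stdG_eval i).hasGaussianLaw)

theorem memLp_stdG_eval (i : ι) : MemLp (fun x : ι → ℝ => x i) 2 (stdG ι) :=
  (hasGaussianLaw_stdG.eval i).memLp_two

theorem integral_stdG_eval (i : ι) : ∫ x, x i ∂(stdG ι) = 0 := by
  have := (hasLaw_stdG_eval (ι := ι) i).integral_eq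
  rw [this]; simp

theorem covariance_stdG_eval [DecidableEq ι] (i j : ι) :
    cov[fun x : ι → ℝ => x i, fun x => x j; stdG ι] = if i = j then 1 else 0 := by
  split_ifs with h
  · subst h
    rw [covariance_self (measurable_pi_apply i).aemeasurable, (hasLaw_stdG_eval (ι := ι) i).variance_eq]
    simp
  · exact (iIndepFun_stdG.indepFun h).covariance_eq_zero (memLp_stdG_eval i) (memLp_stdG_eval j)

/-- Coisometries preserve the standard Gaussian measure. -/
theorem measurePreserving_mulVec [DecidableEq α] (Q : Matrix α ι ℝ) (hQ : Q * Qᵀ = 1) :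
    MeasurePreserving (fun x : ι → ℝ => Q *ᵥ x) (stdG ι) (stdG α) := by
  classical
  have hmeas : Measurable (fun x : ι → ℝ => Q *ᵥ x) := by
    unfold Matrix.mulVec dotProduct; fun_prop
  refine ⟨hmeas, HasLaw.map_eq (hasLaw_stdG (g := fun a x => (Q *ᵥ x) a) ?_ ?_ ?_)⟩
  · exact hasGaussianLaw_stdG.map_fun (LinearMap.toContinuousLinearMap (Matrix.mulVecLin Q))
  · intro a
    simp only [Matrix.mulVec, dotProduct]
    rw [integral_finsetSum _ (fun i _ => ((memLp_stdG_eval i).integrable (by norm_num)).const_mul _)]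
    simp [integral_const_mul, integral_stdG_eval]
  · intro a b
    simp only [Matrix.mulVec, dotProduct]
    rw [covariance_fun_sum_fun_sum (fun i => (memLp_stdG_eval i).const_mul _)
      (fun i => (memLp_stdG_eval i).const_mul _)]
    simp only [covariance_const_mul_left, covariance_const_mul_right, covariance_stdG_eval]
    have := congrFun (congrFun hQ a) b
    rw [Matrix.mul_apply] at this
    simp only [Matrix.transpose_apply, Matrix.one_apply] at this
    simp [← this, mul_comm]

/-- Viewing the array as one product over pairs of indices makes transposition a permutation of
independent, identically distributed coordinates. -/
theorem stdM_eq_map_curry (κ ι : Type*) [Fintype κ] [Fintype ι] : stdM κ ι =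
    (Measure.pi fun _ : κ × ι => gaussianReal 0 1).map (MeasurableEquiv.curry κ ι ℝ) := by
  have := Measure.infinitePi_map_curry (fun (_ : κ) (_ : ι) => gaussianReal 0 1)
  simp only [Measure.infinitePi_eq_pi] at this
  rw [this]; rfl

theorem measurePreserving_transpose :
    MeasurePreserving (fun (C : κ → ι → ℝ) i c => C c i) (stdM κ ι) (stdM ι κ) := by
  refine ⟨by fun_prop, ?_⟩
  rw [stdM_eq_map_curry κ ι, stdM_eq_map_curry ι κ, Measure.map_map (by fun_prop) (by fun_prop)]
  have h2 := (measurePreserving_piCongrLeft (fun _ : ι × κ => gaussianReal 0 1)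
    (Equiv.prodComm κ ι)).map_eq
  rw [← h2, Measure.map_map (by fun_prop) (by fun_prop)]
  congr 1

/-- Left multiplication acts separately on the columns, which are themselves independent standard
Gaussian vectors; hence the detour through the transpose. -/
theorem measurePreserving_matrix_mul_left [DecidableEq κ'] (Q : Matrix κ' κ ℝ)
    (hQ : Q * Qᵀ = 1) :
    MeasurePreserving (fun (C : κ → ι → ℝ) c i => (Q * Matrix.of C) c i) (stdM κ ι) (stdM κ' ι) := by
  have h := (measurePreserving_pi (fun _ : ι => stdG κ) (fun _ : ι => stdG κ')
    (fun _ => measurePreserving_mulVec Q hQ))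
  exact measurePreserving_transpose.comp (h.comp measurePreserving_transpose)

theorem measurePreserving_vecMul (u : κ → ℝ) (hu : u ⬝ᵥ u = 1) :
    MeasurePreserving (fun C : κ → ι → ℝ => u ᵥ* Matrix.of C) (stdM κ ι) (stdG ι) := by
  have hQ : (Matrix.of fun (_ : Unit) => u) * (Matrix.of fun (_ : Unit) => u)ᵀ = 1 := by
    ext i j
    simpa [Matrix.mul_apply, dotProduct, Matrix.one_apply] using hu
  have h := measurePreserving_matrix_mul_left (ι := ι) (Matrix.of fun (_ : Unit) => u) hQ
  exact (measurePreserving_eval (fun _ : Unit => stdG ι) ()).comp h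

theorem measurePreserving_sum_split :
    MeasurePreserving (fun C : κ ⊕ κ' → ι → ℝ => (fun c => C (Sum.inl c), fun c => C (Sum.inr c)))
      (stdM (κ ⊕ κ') ι) ((stdM κ ι).prod (stdM κ' ι)) :=
  measurePreserving_sumPiEquivProdPi (fun _ : κ ⊕ κ' => stdG ι)

theorem measurePreserving_sum_join :
    MeasurePreserving (fun p : (κ → ι → ℝ) × (κ' → ι → ℝ) => Sum.elim p.1 p.2)
      ((stdM κ ι).prod (stdM κ' ι)) (stdM (κ ⊕ κ') ι) := by
  have h := measurePreserving_sumPiEquivProdPi_symm (fun _ : κ ⊕ κ' => stdG ι)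
  convert! h using 1

end Law


/-! ### Chi-square and Gaussian tail bounds -/

section Tails

variable {ι α κ κ' : Type*} [Fintype ι] [Fintype α] [Fintype κ] [Fintype κ']

theorem exp_mul_sq_gaussian (t : ℝ) (x : ℝ) :
    gaussianPDFReal 0 1 x * Real.exp (t * x ^ 2)
      = (√(2 * Real.pi))⁻¹ * Real.exp (-(1 / 2 - t) * x ^ 2) := by
  rw [gaussianPDFReal_def]
  simp only [NNReal.coe_one, mul_one, sub_zero]
  rw [mul_assoc, ← Real.exp_add]
  congr 2; ring

theorem integrable_exp_mul_sq {t : ℝ} (ht : t < 1 / 2) :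
    Integrable (fun x => Real.exp (t * x ^ 2)) (gaussianReal 0 1) := by
  rw [gaussianReal_of_var_ne_zero 0 one_ne_zero]
  rw [integrable_withDensity_iff_integrable_smul' (measurable_gaussianPDF 0 1)
    (Eventually.of_forall fun x => gaussianPDF_lt_top)]
  simp only [toReal_gaussianPDF, smul_eq_mul, exp_mul_sq_gaussian]
  exact (integrable_exp_neg_mul_sq (by linarith)).const_mul _

theorem integral_exp_mul_sq {t : ℝ} (ht : t < 1 / 2) :
    ∫ x, Real.exp (t * x ^ 2) ∂(gaussianReal 0 1) = Real.exp (-(1 / 2) * Real.log (1 - 2 * t)) := by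
  rw [integral_gaussianReal_eq_integral_smul one_ne_zero]
  simp only [smul_eq_mul, exp_mul_sq_gaussian]
  rw [integral_const_mul, integral_gaussian, ← Real.sqrt_inv, ← Real.sqrt_mul (by positivity)]
  have h : (2 * Real.pi)⁻¹ * (Real.pi / (1 / 2 - t)) = (1 - 2 * t)⁻¹ := by
    have : (1 / 2 - t) ≠ 0 := by linarith
    have : (1 - 2 * t) ≠ 0 := by linarith
    have := Real.pi_ne_zero
    field_simp
  rw [h, Real.sqrt_eq_rpow, Real.rpow_def_of_pos (by rw [inv_pos]; linarith), Real.log_inv]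
  congr 1; ring

theorem exp_sum_mul_sq (t : ℝ) (d x : ι → ℝ) :
    Real.exp (t * ∑ i, d i * x i ^ 2) = ∏ i, Real.exp ((t * d i) * x i ^ 2) := by
  rw [← Real.exp_sum, Finset.mul_sum]
  congr 1
  exact Finset.sum_congr rfl fun i _ => by ring

theorem integrable_exp_sum_sq {t : ℝ} (ht : t < 1 / 2) {d : ι → ℝ} (hd : ∀ i, d i = 0 ∨ d i = 1) :
    Integrable (fun x : ι → ℝ => Real.exp (t * ∑ i, d i * x i ^ 2)) (stdG ι) := by
  simp only [exp_sum_mul_sq]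
  refine Integrable.fintype_prod (f := fun i x => Real.exp ((t * d i) * x ^ 2)) (fun i => ?_)
  apply integrable_exp_mul_sq
  rcases hd i with h | h <;> rw [h] <;> linarith

/-- The weights in {0, 1} are the eigenvalues of a projection, so this is the chi-square moment
generating function with the rank of the projection as degrees of freedom. -/
theorem mgf_sum_sq {t : ℝ} (ht : t < 1 / 2) {d : ι → ℝ} (hd : ∀ i, d i = 0 ∨ d i = 1) :
    mgf (fun x : ι → ℝ => ∑ i, d i * x i ^ 2) (stdG ι) t
      = Real.exp (-((∑ i, d i) / 2) * Real.log (1 - 2 * t)) := by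
  unfold mgf
  simp only [exp_sum_mul_sq]
  unfold stdG
  rw [integral_fintype_prod_eq_prod (f := fun i x => Real.exp ((t * d i) * x ^ 2))]
  have : ∀ i, ∫ x, Real.exp ((t * d i) * x ^ 2) ∂(gaussianReal 0 1)
      = Real.exp (d i * (-(1 / 2) * Real.log (1 - 2 * t))) := by
    intro i
    rcases hd i with h | h
    · simp [h]
    · rw [h, mul_one, one_mul, integral_exp_mul_sq ht]
  simp only [this]
  rw [← Real.exp_sum, ← Finset.sum_mul]
  congr 1; ring

/-- This is z ≤ sinh z at z = log(1+y), where sinh z = ((1+y) - 1/(1+y))/2. -/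
theorem log_one_add_le {y : ℝ} (hy : 0 ≤ y) :
    Real.log (1 + y) ≤ y - y ^ 2 / (2 * (1 + y)) := by
  have h1 : 0 < 1 + y := by linarith
  have h := Real.self_le_sinh_iff.2 (Real.log_nonneg (by linarith : 1 ≤ 1 + y))
  rw [Real.sinh_log h1] at h
  refine h.trans (le_of_eq ?_)
  field_simp; ring

theorem le_log_one_add {y : ℝ} (hy : 0 ≤ y) : y - y ^ 2 / 2 ≤ Real.log (1 + y) := by
  refine le_trans ?_ (Real.le_log_one_add_of_nonneg hy)
  rw [le_div_iff₀ (by linarith)]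
  nlinarith [pow_nonneg hy 3]

/-- Chernoff's bound at t = x/(2(p+x)), the exact minimizer of the exponent; `log_one_add_le` then
simplifies the optimal rate. -/
theorem sum_sq_upper {d : ι → ℝ} (hd : ∀ i, d i = 0 ∨ d i = 1) (hp : 0 < ∑ i, d i)
    {x : ℝ} (hx : 0 ≤ x) :
    (stdG ι).real {w | ∑ i, d i + x ≤ ∑ i, d i * w i ^ 2}
      ≤ Real.exp (-(x ^ 2 / (4 * (∑ i, d i + x)))) := by
  set p := ∑ i, d i with hpdef
  have hpx : 0 < p + x := by linarith
  have ht : x / (2 * (p + x)) < 1 / 2 := by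
    rw [div_lt_div_iff₀ (by positivity) (by norm_num)]; linarith
  refine (measure_ge_le_exp_mul_mgf _ (t := x / (2 * (p + x))) (by positivity)
    (integrable_exp_sum_sq ht hd)).trans ?_
  rw [mgf_sum_sq ht hd, ← Real.exp_add, ← hpdef]
  apply Real.exp_le_exp.2
  have h1 : 1 - 2 * (x / (2 * (p + x))) = (1 + x / p)⁻¹ := by field_simp; ring
  rw [h1, Real.log_inv]
  have h2 := mul_le_mul_of_nonneg_left (log_one_add_le (y := x / p) (by positivity))
    (by positivity : 0 ≤ p / 2)
  have h3 : p / 2 * (x / p - (x / p) ^ 2 / (2 * (1 + x / p))) = x / 2 - x ^ 2 / (4 * (p + x)) := by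
    field_simp; ring
  have h4 : -(x / (2 * (p + x))) * (p + x) = - (x / 2) := by field_simp
  rw [h4]; linarith

/-- Chernoff's bound at t = -x/(2p). This is not the minimizer, but unlike the minimizer it remains
admissible for x ≥ p. -/
theorem sum_sq_lower {d : ι → ℝ} (hd : ∀ i, d i = 0 ∨ d i = 1) (hp : 0 < ∑ i, d i)
    {x : ℝ} (hx : 0 ≤ x) :
    (stdG ι).real {w | ∑ i, d i * w i ^ 2 ≤ ∑ i, d i - x}
      ≤ Real.exp (-(x ^ 2 / (4 * ∑ i, d i))) := by
  set p := ∑ i, d i with hpdef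
  have ht0 : -(x / (2 * p)) ≤ 0 := by rw [neg_nonpos]; positivity
  have ht : -(x / (2 * p)) < 1 / 2 := by linarith
  refine (measure_le_le_exp_mul_mgf _ ht0 (integrable_exp_sum_sq ht hd)).trans ?_
  rw [mgf_sum_sq ht hd, ← Real.exp_add, ← hpdef]
  apply Real.exp_le_exp.2
  have h1 : 1 - 2 * (-(x / (2 * p))) = 1 + x / p := by field_simp; ring
  rw [h1]
  have h2 := mul_le_mul_of_nonneg_left (le_log_one_add (y := x / p) (by positivity))
    (by positivity : 0 ≤ p / 2)
  have h3 : p / 2 * (x / p - (x / p) ^ 2 / 2) = x / 2 - x ^ 2 / (4 * p) := by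
    field_simp; ring
  have h4 : -(-(x / (2 * p))) * (p - x) = x / 2 - 2 * (x ^ 2 / (4 * p)) := by field_simp; ring
  rw [h4]; linarith

/-- A quadratic form of a symmetric idempotent matrix is, up to a measure preserving map, a
sum of squares of some of the coordinates. -/
theorem exists_sum_sq_of_isIdempotent [DecidableEq ι] {M : Matrix ι ι ℝ} (hs : Mᵀ = M)
    (hi : M * M = M) : ∃ d : ι → ℝ, (∀ i, d i = 0 ∨ d i = 1) ∧ ∑ i, d i = M.trace ∧
      ∃ f : (ι → ℝ) → ι → ℝ, MeasurePreserving f (stdG ι) (stdG ι) ∧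
        ∀ w, w ⬝ᵥ (M *ᵥ w) = ∑ i, d i * f w i ^ 2 := by
  have hH : M.IsHermitian := by
    rw [Matrix.IsHermitian, Matrix.conjTranspose_eq_transpose_of_trivial]; exact hs
  set U : Matrix ι ι ℝ := (hH.eigenvectorUnitary : Matrix ι ι ℝ) with hU
  have hUU : Uᵀ * U = 1 := by
    have := Unitary.coe_star_mul_self hH.eigenvectorUnitary
    rwa [Matrix.star_eq_conjTranspose, Matrix.conjTranspose_eq_transpose_of_trivial] at this
  set v := hH.eigenvalues with hv
  have hAe : M = U * Matrix.diagonal v * Uᵀ := by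
    have := hH.spectral_theorem
    rw [Unitary.conjStarAlgAut_apply, Matrix.star_eq_conjTranspose,
      Matrix.conjTranspose_eq_transpose_of_trivial] at this
    exact this
  have hD : Matrix.diagonal v = Uᵀ * M * U := by
    rw [hAe]
    simp only [Matrix.mul_assoc, hUU, Matrix.mul_one]
    rw [← Matrix.mul_assoc, hUU, Matrix.one_mul]
  have hUU' : U * Uᵀ = 1 := mul_eq_one_comm.1 hUU
  have hDD : Matrix.diagonal v * Matrix.diagonal v = Matrix.diagonal v := by
    rw [hD]
    calc Uᵀ * M * U * (Uᵀ * M * U) = Uᵀ * M * (U * Uᵀ) * M * U := by simp only [Matrix.mul_assoc]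
      _ = Uᵀ * M * U := by rw [hUU', Matrix.mul_one, Matrix.mul_assoc Uᵀ, hi]
  refine ⟨v, fun i => ?_, ?_, fun w => Uᵀ *ᵥ w, ?_, fun w => ?_⟩
  · rw [Matrix.diagonal_mul_diagonal] at hDD
    have := congrFun (congrFun hDD i) i
    simp only [Matrix.diagonal_apply_eq] at this
    have h2 : v i * (v i - 1) = 0 := by linarith
    rcases mul_eq_zero.1 h2 with h | h
    · exact Or.inl h
    · exact Or.inr (by linarith)
  · rw [← Matrix.trace_diagonal, hD, Matrix.trace_mul_comm, ← Matrix.mul_assoc, hUU',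
      Matrix.one_mul]
  · exact measurePreserving_mulVec _ (by rw [Matrix.transpose_transpose, hUU])
  · conv_lhs => rw [hAe]
    rw [← Matrix.mulVec_mulVec, ← Matrix.mulVec_mulVec, Matrix.dotProduct_mulVec,
      ← Matrix.mulVec_transpose]
    simp only [dotProduct, Matrix.mulVec_diagonal]
    exact Finset.sum_congr rfl fun i _ => by ring

theorem quadForm_upper [DecidableEq ι] {M : Matrix ι ι ℝ} (hs : Mᵀ = M) (hi : M * M = M) {p : ℝ}
    (hp : M.trace = p) (hp0 : 0 < p) {x : ℝ} (hx : 0 ≤ x) :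
    (stdG ι).real {w | p + x ≤ w ⬝ᵥ (M *ᵥ w)} ≤ Real.exp (-(x ^ 2 / (4 * (p + x)))) := by
  obtain ⟨d, hd, hdp, f, hf, hq⟩ := exists_sum_sq_of_isIdempotent hs hi
  rw [hp] at hdp
  have := sum_sq_upper hd (by rwa [hdp]) hx
  rw [hdp] at this
  refine le_trans (le_of_eq ?_) this
  have hm : MeasurableSet {w : ι → ℝ | p + x ≤ ∑ i, d i * w i ^ 2} :=
    measurableSet_le (by fun_prop) (by fun_prop)
  rw [← hf.measureReal_preimage hm.nullMeasurableSet]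
  simp [hq]

theorem quadForm_lower [DecidableEq ι] {M : Matrix ι ι ℝ} (hs : Mᵀ = M) (hi : M * M = M) {p : ℝ}
    (hp : M.trace = p) (hp0 : 0 < p) {x : ℝ} (hx : 0 ≤ x) :
    (stdG ι).real {w | w ⬝ᵥ (M *ᵥ w) ≤ p - x} ≤ Real.exp (-(x ^ 2 / (4 * p))) := by
  obtain ⟨d, hd, hdp, f, hf, hq⟩ := exists_sum_sq_of_isIdempotent hs hi
  rw [hp] at hdp
  have := sum_sq_lower hd (by rwa [hdp]) hx
  rw [hdp] at this
  refine le_trans (le_of_eq ?_) this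
  have hm : MeasurableSet {w : ι → ℝ | ∑ i, d i * w i ^ 2 ≤ p - x} :=
    measurableSet_le (by fun_prop) (by fun_prop)
  rw [← hf.measureReal_preimage hm.nullMeasurableSet]
  simp [hq]

/-- Two-sided concentration of a chi-square variable. -/
theorem quadForm_tail [DecidableEq ι] {M : Matrix ι ι ℝ} (hs : Mᵀ = M) (hi : M * M = M) {p : ℝ}
    (hp : M.trace = p) (hp0 : 0 < p) {x : ℝ} (hx : 0 ≤ x) :
    (stdG ι) {w | x ≤ |w ⬝ᵥ (M *ᵥ w) - p|}
      ≤ ENNReal.ofReal (2 * Real.exp (-(x ^ 2 / (4 * (p + x))))) := by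
  rw [← ofReal_measureReal]
  apply ENNReal.ofReal_le_ofReal
  have hsub : {w : ι → ℝ | x ≤ |w ⬝ᵥ (M *ᵥ w) - p|} ⊆
      {w | p + x ≤ w ⬝ᵥ (M *ᵥ w)} ∪ {w | w ⬝ᵥ (M *ᵥ w) ≤ p - x} := by
    intro w hw
    simp only [Set.mem_ofPred_eq, le_abs, Set.mem_union] at hw ⊢
    rcases hw with h | h
    · left; linarith
    · right; linarith
  refine (measureReal_mono hsub).trans ((measureReal_union_le _ _).trans ?_)
  have h1 := quadForm_upper hs hi hp hp0 hx
  have h2 := quadForm_lower hs hi hp hp0 hx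
  have h3 : Real.exp (-(x ^ 2 / (4 * p))) ≤ Real.exp (-(x ^ 2 / (4 * (p + x)))) := by
    apply Real.exp_le_exp.2
    have : x ^ 2 / (4 * (p + x)) ≤ x ^ 2 / (4 * p) := by gcongr; linarith
    linarith
  linarith

theorem linear_tail (c : ι → ℝ) (hc : c ⬝ᵥ c = 1) {x : ℝ} (hx : 0 ≤ x) :
    (stdG ι) {w | x ≤ |c ⬝ᵥ w|} ≤ ENNReal.ofReal (2 * Real.exp (-(x ^ 2 / 2))) := by
  classical
  have hQ : (Matrix.of fun (_ : Unit) => c) * (Matrix.of fun (_ : Unit) => c)ᵀ = 1 := by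
    ext i j
    simpa [Matrix.mul_apply, dotProduct, Matrix.one_apply] using hc
  have h := measurePreserving_mulVec (Matrix.of fun (_ : Unit) => c) hQ
  have hlaw : (stdG ι).map (fun w => c ⬝ᵥ w) = gaussianReal 0 1 := by
    have h2 := (measurePreserving_eval (fun _ : Unit => gaussianReal 0 1) ()).comp h
    exact h2.map_eq
  have hm : mgf (fun w => c ⬝ᵥ w) (stdG ι) = fun t => Real.exp (t ^ 2 / 2) := by
    ext t; rw [mgf_gaussianReal hlaw]; simp
  have hint : ∀ t, Integrable (fun w => Real.exp (t * (c ⬝ᵥ w))) (stdG ι) := by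
    intro t
    have := integrable_exp_mul_gaussianReal (μ := 0) (v := 1) t
    rw [← hlaw] at this
    exact this.comp_measurable (by unfold dotProduct; fun_prop)
  rw [← ofReal_measureReal]
  apply ENNReal.ofReal_le_ofReal
  have hsub : {w : ι → ℝ | x ≤ |c ⬝ᵥ w|} ⊆ {w | x ≤ c ⬝ᵥ w} ∪ {w | c ⬝ᵥ w ≤ -x} := by
    intro w hw
    simp only [Set.mem_ofPred_eq, le_abs, Set.mem_union] at hw ⊢
    rcases hw with h | h
    · left; linarith
    · right; linarith
  refine (measureReal_mono hsub).trans ((measureReal_union_le _ _).trans ?_)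
  have h1 := measure_ge_le_exp_mul_mgf x hx (hint x)
  have h2 := measure_le_le_exp_mul_mgf (-x) (neg_nonpos.2 hx) (hint (-x))
  rw [hm, ← Real.exp_add] at h1 h2
  ring_nf at h1 h2 ⊢
  linarith

end Tails


/-! ### Measurability of matrix operations -/

section MatrixMeasurability

variable {X : Type*} [MeasurableSpace X] {ι α κ κ' : Type*}

instance matrixMeasurableSpace : MeasurableSpace (Matrix κ ι ℝ) :=
  inferInstanceAs (MeasurableSpace (κ → ι → ℝ))

theorem measurable_matrix_iff {A : X → Matrix κ ι ℝ} :
    Measurable A ↔ ∀ i j, Measurable fun x => A x i j := by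
  refine ⟨fun h i j => ?_, fun h => ?_⟩
  · have h1 : Measurable (fun M : Matrix κ ι ℝ => M i j) :=
      (measurable_pi_apply j).comp (measurable_pi_apply (X := fun _ : κ => ι → ℝ) i)
    exact h1.comp h
  · exact measurable_pi_iff.2 fun i => measurable_pi_iff.2 fun j => h i j

theorem measurable_matrix_apply {A : X → Matrix κ ι ℝ} (hA : Measurable A) (i : κ) (j : ι) :
    Measurable fun x => A x i j := measurable_matrix_iff.1 hA i j

@[fun_prop]
theorem measurable_matrix_of {f : X → κ → ι → ℝ} (hf : Measurable f) :
    Measurable fun x => (Matrix.of (f x) : Matrix κ ι ℝ) := hf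

@[fun_prop]
theorem measurable_matrix_transpose {A : X → Matrix κ ι ℝ} (hA : Measurable A) :
    Measurable fun x => (A x)ᵀ :=
  measurable_matrix_iff.2 fun i j => measurable_matrix_apply hA j i

@[fun_prop]
theorem measurable_matrix_mul [Fintype ι] {A : X → Matrix κ ι ℝ} {B : X → Matrix ι α ℝ}
    (hA : Measurable A) (hB : Measurable B) : Measurable fun x => A x * B x := by
  refine measurable_matrix_iff.2 fun i j => ?_
  simp only [Matrix.mul_apply]
  exact Finset.measurable_sum _ fun k _ =>
    (measurable_matrix_apply hA i k).mul (measurable_matrix_apply hB k j)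

@[fun_prop]
theorem measurable_matrix_sub {A B : X → Matrix κ ι ℝ}
    (hA : Measurable A) (hB : Measurable B) : Measurable fun x => A x - B x :=
  measurable_matrix_iff.2 fun i j => by
    exact (measurable_matrix_apply hA i j).sub (measurable_matrix_apply hB i j)

@[fun_prop]
theorem measurable_mulVec [Fintype ι] {A : X → Matrix κ ι ℝ} {v : X → ι → ℝ}
    (hA : Measurable A) (hv : Measurable v) : Measurable fun x => A x *ᵥ v x := by
  refine measurable_pi_iff.2 fun i => ?_
  simp only [Matrix.mulVec, dotProduct]
  exact Finset.measurable_sum _ fun k _ =>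
    (measurable_matrix_apply hA i k).mul ((measurable_pi_apply k).comp hv)

@[fun_prop]
theorem measurable_vecMul [Fintype κ] {A : X → Matrix κ ι ℝ} {v : X → κ → ℝ}
    (hA : Measurable A) (hv : Measurable v) : Measurable fun x => v x ᵥ* A x := by
  simp only [← Matrix.mulVec_transpose]
  fun_prop

@[fun_prop]
theorem measurable_dotProduct [Fintype ι] {v w : X → ι → ℝ}
    (hv : Measurable v) (hw : Measurable w) : Measurable fun x => v x ⬝ᵥ w x := by
  simp only [dotProduct]
  exact Finset.measurable_sum _ fun k _ =>
    ((measurable_pi_apply k).comp hv).mul ((measurable_pi_apply k).comp hw)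

@[fun_prop]
theorem measurable_det [Fintype κ] [DecidableEq κ] {A : X → Matrix κ κ ℝ} (hA : Measurable A) :
    Measurable fun x => (A x).det := by
  simp only [Matrix.det_apply]
  refine Finset.measurable_sum _ fun σ _ => ?_
  exact (Finset.measurable_prod _ fun i _ => measurable_matrix_apply hA _ _).const_smul _

-- Each entry of the inverse is an adjugate entry times the inverse determinant, and the convention
-- 0⁻¹ = 0 makes this valid for singular matrices too, so no invertibility is needed.
@[fun_prop]
theorem measurable_matrix_inv [Fintype κ] [DecidableEq κ] {A : X → Matrix κ κ ℝ}
    (hA : Measurable A) : Measurable fun x => (A x)⁻¹ := by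
  refine measurable_matrix_iff.2 fun i j => ?_
  simp only [Matrix.inv_def, Ring.inverse_eq_inv', Matrix.smul_apply, smul_eq_mul,
    Matrix.adjugate_apply]
  refine (measurable_det hA).inv.mul (measurable_det ?_)
  refine measurable_matrix_iff.2 fun a b => ?_
  simp only [Matrix.updateRow_apply]
  split_ifs
  · exact measurable_const
  · exact measurable_matrix_apply hA _ _

end MatrixMeasurability

/-! ### Bounding a product measure fibre by fibre -/

section ProductBound

variable {X Y : Type*} [MeasurableSpace X] [MeasurableSpace Y]

theorem prod_measure_le {μ : Measure X} {ν : Measure Y} [IsProbabilityMeasure μ] [SFinite ν]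
    {S : Set (X × Y)} (hS : MeasurableSet S) {b : ℝ≥0∞}
    (h : ∀ᵐ x ∂μ, ν (Prod.mk x ⁻¹' S) ≤ b) : (μ.prod ν) S ≤ b := by
  rw [Measure.prod_apply hS]
  calc ∫⁻ x, ν (Prod.mk x ⁻¹' S) ∂μ ≤ ∫⁻ _, b ∂μ := lintegral_mono_ae h
    _ = b := by simp

end ProductBound

/-! ### Gaussian matrices have full rank almost surely -/

section FullRank

variable {ι κ κ' : Type*} [Fintype ι] [Fintype κ] [Fintype κ']

theorem dotProduct_self_nonneg' (c : ι → ℝ) : 0 ≤ c ⬝ᵥ c :=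
  Finset.sum_nonneg fun i _ => mul_self_nonneg (c i)

theorem dotProduct_self_pos {c : ι → ℝ} (hc : c ≠ 0) : 0 < c ⬝ᵥ c :=
  lt_of_le_of_ne (dotProduct_self_nonneg' c) fun h => hc (dotProduct_self_eq_zero.1 h.symm)

/-- After normalizing the normal vector, the linear functional is a one-dimensional standard normal,
which has no atoms. -/
theorem stdG_hyperplane (c : ι → ℝ) (hc : c ≠ 0) : (stdG ι) {w | c ⬝ᵥ w = 0} = 0 := by
  have hpos : 0 < c ⬝ᵥ c := dotProduct_self_pos hc
  set r := √(c ⬝ᵥ c) with hr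
  have hr0 : 0 < r := Real.sqrt_pos.2 hpos
  have hrr : r * r = c ⬝ᵥ c := Real.mul_self_sqrt hpos.le
  have hu : (r⁻¹ • c) ⬝ᵥ (r⁻¹ • c) = 1 := by
    rw [smul_dotProduct, dotProduct_smul, ← hrr]; simp only [smul_eq_mul]; field_simp
  have hQ : (Matrix.of fun (_ : Unit) => r⁻¹ • c) * (Matrix.of fun (_ : Unit) => r⁻¹ • c)ᵀ = 1 := by
    ext i j
    simpa [Matrix.mul_apply, dotProduct, Matrix.one_apply] using hu
  have h2 := (measurePreserving_eval (fun _ : Unit => gaussianReal 0 1) ()).comp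
    (measurePreserving_mulVec (Matrix.of fun (_ : Unit) => r⁻¹ • c) hQ)
  have h3 := h2.measure_preimage (s := {0}) (measurableSet_singleton 0).nullMeasurableSet
  have : NullSingletonClass (gaussianReal 0 1) := nullSingletonClass_gaussianReal one_ne_zero
  rw [measure_singleton] at h3
  rw [← h3]
  congr 1
  ext w
  have : (Matrix.of (fun (_ : Unit) => r⁻¹ • c) *ᵥ w) () = r⁻¹ * (c ⬝ᵥ w) := by
    rw [← smul_eq_mul, ← smul_dotProduct]; rfl
  simp [this, hr0.ne']

/-- A proper subspace lies in the kernel of a nonzero functional, that is, in a hyperplane. -/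
theorem stdG_submodule (S : Submodule ℝ (ι → ℝ)) (hS : S ≠ ⊤) : (stdG ι) (S : Set (ι → ℝ)) = 0 := by
  classical
  obtain ⟨f, hf0, hf⟩ := S.exists_le_ker_of_lt_top (lt_top_iff_ne_top.2 hS)
  set c : ι → ℝ := fun i => f (Pi.single i 1)
  have hfc : ∀ w, f w = c ⬝ᵥ w := by
    intro w
    conv_lhs => rw [← Finset.univ_sum_single w]
    simp only [map_sum, dotProduct, c]
    refine Finset.sum_congr rfl fun i _ => ?_
    rw [mul_comm, ← smul_eq_mul, ← map_smul]
    congr 1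
    ext j
    by_cases h : j = i
    · subst h; simp
    · simp [h]
  have hc : c ≠ 0 := by
    rintro h
    apply hf0
    ext i
    simp [hfc, h]
  refine measure_mono_null (fun w hw => ?_) (stdG_hyperplane c hc)
  have := hf hw
  rw [LinearMap.mem_ker, hfc] at this
  exact this

theorem measurableSet_linearIndependent :
    MeasurableSet {C : κ → ι → ℝ | LinearIndependent ℝ C} := by
  classical
  -- Independence of the rows is non-vanishing of the Gram determinant, a polynomial in the entries.
  have : {C : κ → ι → ℝ | LinearIndependent ℝ C}
      = {C | (Matrix.of C * (Matrix.of C)ᵀ).det ≠ 0} := by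
    ext C
    have hg : Matrix.of C * (Matrix.of C)ᵀ = Matrix.gram ℝ (fun c => WithLp.toLp 2 (C c)) := by
      ext i j
      simp [Matrix.mul_apply, Matrix.gram, PiLp.inner_apply, mul_comm]
    have h1 := Matrix.det_gram_ne_zero_iff_linearIndependent (𝕜 := ℝ)
      (v := fun c => (WithLp.toLp 2 (C c) : EuclideanSpace ℝ ι))
    have h2 : LinearIndependent ℝ (fun c => (WithLp.toLp 2 (C c) : EuclideanSpace ℝ ι)) ↔
        LinearIndependent ℝ C := by
      exact LinearMap.linearIndependent_iff (v := C)
        (WithLp.linearEquiv 2 ℝ (ι → ℝ)).symm.toLinearMap (LinearEquiv.ker _)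
    simp only [Set.mem_ofPred_eq]
    rw [hg, ← h2, ← h1]
  rw [this]
  exact (measurableSet_eq_fun (by fun_prop) measurable_const).compl

/-- Induction on the number of rows: given the other rows, a new independent row almost surely
avoids their span, which is a proper subspace as long as there are fewer of them than the dimension.
-/
theorem ae_linearIndependent_fin : ∀ k : ℕ, k ≤ Fintype.card ι →
    ∀ᵐ C ∂(stdM (Fin k) ι), LinearIndependent ℝ C := by
  intro k
  induction k with
  | zero => intro _; exact Eventually.of_forall fun C => linearIndependent_empty_type
  | succ k ih =>
    intro hk
    have ih := ih (by omega)
    have hmp := (measurePreserving_piFinSuccAbove (fun _ : Fin (k + 1) => stdG ι) 0)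
    have hS : MeasurableSet {p : (ι → ℝ) × (Fin k → ι → ℝ) |
        ¬ LinearIndependent ℝ (Fin.cons p.1 p.2 : Fin (k + 1) → ι → ℝ)} := by
      refine (measurableSet_linearIndependent.preimage ?_).compl
      refine measurable_pi_iff.2 fun i => ?_
      refine Fin.cases ?_ (fun j => ?_) i
      · simpa using measurable_fst
      · simp only [Fin.cons_succ]; fun_prop
    have hnull : ((stdG ι).prod (stdM (Fin k) ι)) {p : (ι → ℝ) × (Fin k → ι → ℝ) |
        ¬ LinearIndependent ℝ (Fin.cons p.1 p.2 : Fin (k + 1) → ι → ℝ)} = 0 := by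
      rw [Measure.prod_apply_symm hS, lintegral_eq_zero_iff (measurable_measure_prodMk_right hS)]
      filter_upwards [ih] with C hC
      have hlt : Submodule.span ℝ (Set.range C) ≠ ⊤ := by
        intro h
        have h1 := finrank_span_eq_card hC
        rw [h, finrank_top, Module.finrank_fintype_fun_eq_card, Fintype.card_fin] at h1
        omega
      refine measure_mono_null (fun w hw => ?_) (stdG_submodule _ hlt)
      by_contra hcon
      apply hw
      exact linearIndependent_finCons.2 ⟨hC, hcon⟩
    have := hmp.measure_preimage hS.nullMeasurableSet
    change _ = ((stdG ι).prod (stdM (Fin k) ι)) _ at this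
    rw [hnull] at this
    rw [ae_iff]
    refine measure_mono_null (fun C hC => ?_) this
    simp only [Set.mem_preimage, Set.mem_ofPred_eq] at hC ⊢
    convert hC using 2
    ext i
    refine Fin.cases ?_ (fun j => ?_) i <;> simp [MeasurableEquiv.piFinSuccAbove, Fin.tail]

theorem ae_linearIndependent (h : Fintype.card κ ≤ Fintype.card ι) :
    ∀ᵐ C ∂(stdM κ ι), LinearIndependent ℝ C := by
  have h1 := ae_linearIndependent_fin (ι := ι) (Fintype.card κ) h
  have h2 := measurePreserving_piCongrLeft (fun _ : κ => stdG ι) (Fintype.equivFin κ).symm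
  have h3 := h2.symm.quasiMeasurePreserving.ae h1
  filter_upwards [h3] with C hC
  refine (linearIndependent_equiv (Fintype.equivFin κ).symm).1 ?_
  exact hC

end FullRank


/-! ### Regression algebra and the inverse Gram matrix -/

section Regression

variable {ι α κ κ' : Type*} [Fintype ι] [Fintype κ]

/-- Gram matrix of the rows of `B`. -/
def gram (B : Matrix κ ι ℝ) : Matrix κ κ ℝ := B * Bᵀ

/-- Least-squares coefficients of the regression on the rows of `B`. -/
noncomputable def coef [DecidableEq κ] (B : Matrix κ ι ℝ) : Matrix κ ι ℝ := (gram B)⁻¹ * B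

/-- Residual projection of the regression on the rows of `B`. -/
noncomputable def resid [DecidableEq κ] [DecidableEq ι] (B : Matrix κ ι ℝ) : Matrix ι ι ℝ :=
  1 - Bᵀ * coef B

theorem gram_posDef {C : κ → ι → ℝ} (hC : LinearIndependent ℝ C) :
    (gram (Matrix.of C)).PosDef := by
  have h := Matrix.PosDef.mul_conjTranspose_self (Matrix.of C)
    (Matrix.vecMul_injective_iff.2 hC)
  rwa [Matrix.conjTranspose_eq_transpose_of_trivial] at h

omit [Fintype κ] in
theorem gram_transpose (B : Matrix κ ι ℝ) : (gram B)ᵀ = gram B := by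
  simp [gram, Matrix.transpose_mul]

variable [DecidableEq κ]

theorem gram_inv_transpose (B : Matrix κ ι ℝ) : ((gram B)⁻¹)ᵀ = (gram B)⁻¹ := by
  rw [Matrix.transpose_nonsing_inv, gram_transpose]

theorem isUnit_det_gram {C : κ → ι → ℝ} (hC : LinearIndependent ℝ C) :
    IsUnit (gram (Matrix.of C)).det :=
  (gram_posDef hC).det_pos.ne'.isUnit

theorem coef_mul_transpose {B : Matrix κ ι ℝ} (hB : IsUnit (gram B).det) : coef B * Bᵀ = 1 := by
  rw [coef, Matrix.mul_assoc]; exact Matrix.nonsing_inv_mul _ hB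

theorem transpose_mul_coef_transpose (B : Matrix κ ι ℝ) : (Bᵀ * coef B)ᵀ = Bᵀ * coef B := by
  simp [coef, Matrix.transpose_mul, gram_inv_transpose, Matrix.mul_assoc]

variable [DecidableEq ι]

theorem resid_transpose (B : Matrix κ ι ℝ) : (resid B)ᵀ = resid B := by
  rw [resid, Matrix.transpose_sub, transpose_mul_coef_transpose, Matrix.transpose_one]

theorem coef_mul_resid {B : Matrix κ ι ℝ} (hB : IsUnit (gram B).det) : coef B * resid B = 0 := by
  rw [resid, Matrix.mul_sub, ← Matrix.mul_assoc, coef_mul_transpose hB]; simp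

theorem resid_mul_transpose {B : Matrix κ ι ℝ} (hB : IsUnit (gram B).det) :
    resid B * Bᵀ = 0 := by
  rw [resid, Matrix.sub_mul, Matrix.mul_assoc, coef_mul_transpose hB]; simp

theorem mul_resid {B : Matrix κ ι ℝ} (hB : IsUnit (gram B).det) : B * resid B = 0 := by
  have := congrArg Matrix.transpose (resid_mul_transpose hB)
  simpa [Matrix.transpose_mul, resid_transpose] using this

theorem resid_mul_resid {B : Matrix κ ι ℝ} (hB : IsUnit (gram B).det) :
    resid B * resid B = resid B := by
  have h : resid B * resid B = resid B - Bᵀ * (coef B * resid B) := by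
    nth_rewrite 1 [resid]
    rw [Matrix.sub_mul, Matrix.one_mul, Matrix.mul_assoc]
  rw [h, coef_mul_resid hB]; simp

theorem trace_resid {B : Matrix κ ι ℝ} (hB : IsUnit (gram B).det) :
    (resid B).trace = (Fintype.card ι : ℝ) - Fintype.card κ := by
  rw [resid, Matrix.trace_sub, Matrix.trace_mul_comm, coef_mul_transpose hB]; simp

omit [Fintype κ] [DecidableEq κ] [DecidableEq ι] in
@[fun_prop]
theorem measurable_gram {X : Type*} [MeasurableSpace X] {B : X → Matrix κ ι ℝ} (hB : Measurable B) :
    Measurable fun x => gram (B x) := by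
  unfold gram; fun_prop

omit [DecidableEq ι] in
@[fun_prop]
theorem measurable_coef {X : Type*} [MeasurableSpace X] {B : X → Matrix κ ι ℝ} (hB : Measurable B) :
    Measurable fun x => coef (B x) :=
  measurable_matrix_mul (measurable_matrix_inv (measurable_gram hB)) hB

@[fun_prop]
theorem measurable_resid {X : Type*} [MeasurableSpace X] {B : X → Matrix κ ι ℝ}
    (hB : Measurable B) : Measurable fun x => resid (B x) :=
  measurable_matrix_sub measurable_const
    (measurable_matrix_mul (measurable_matrix_transpose hB) (measurable_coef hB))

/-- The diagonal entries of the inverse Gram matrix are inverse residual sums of squares. -/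
theorem gram_inv_apply_last {D : Matrix (κ ⊕ Unit) ι ℝ} {B : Matrix κ ι ℝ} {w : ι → ℝ}
    (hB : ∀ i, D (Sum.inl i) = B i) (hw : D (Sum.inr ()) = w)
    (hBu : IsUnit (gram B).det) (hDu : IsUnit (gram D).det) :
    (gram D)⁻¹ (Sum.inr ()) (Sum.inr ()) = (w ⬝ᵥ (resid B *ᵥ w))⁻¹ := by
  -- This combination of the rows of `D` is the residual of `w` on `B`; it is orthogonal to `B`, so
  -- `gram D` maps `x` to a multiple of the last unit vector, and `x` is that multiple of the last
  -- column of the inverse.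
  set x : κ ⊕ Unit → ℝ := Sum.elim (-(coef B *ᵥ w)) (fun _ => 1) with hx
  have hxD : x ᵥ* D = resid B *ᵥ w := by
    have h1 : x ᵥ* D = w - (coef B *ᵥ w) ᵥ* B := by
      ext j
      simp only [Matrix.vecMul, dotProduct, Fintype.sum_sum_type, hx, Sum.elim_inl, Sum.elim_inr,
        Pi.neg_apply, hB, Pi.sub_apply]
      simp [hw]; ring
    rw [h1, ← Matrix.mulVec_transpose, Matrix.mulVec_mulVec, resid, Matrix.sub_mulVec,
      Matrix.one_mulVec]
  have hgx : gram D *ᵥ x = (w ⬝ᵥ (resid B *ᵥ w)) • Pi.single (Sum.inr ()) (1 : ℝ) := by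
    rw [gram, ← Matrix.mulVec_mulVec, Matrix.mulVec_transpose, hxD]
    ext c
    rcases c with c | c
    · have : (B *ᵥ (resid B *ᵥ w)) c = 0 := by
        rw [Matrix.mulVec_mulVec, mul_resid hBu]; simp
      simpa [Matrix.mulVec, hB] using this
    · simp [Matrix.mulVec, hw]
  have h2 : x = (gram D)⁻¹ *ᵥ ((w ⬝ᵥ (resid B *ᵥ w)) • Pi.single (Sum.inr ()) (1 : ℝ)) := by
    rw [← hgx, Matrix.mulVec_mulVec, Matrix.nonsing_inv_mul _ hDu, Matrix.one_mulVec]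
  have h3 := congrFun h2 (Sum.inr ())
  rw [Matrix.mulVec_smul] at h3
  simp only [hx, Sum.elim_inr, Pi.smul_apply, Matrix.mulVec_single_one, smul_eq_mul,
    Matrix.col_apply] at h3
  exact eq_inv_of_mul_eq_one_right h3.symm

-- Completing `e` to an orthonormal basis with `e` in last place turns a quadratic form at `e` into
-- a diagonal entry, to which `gram_inv_apply_last` applies.
omit [DecidableEq ι] in
theorem exists_orthogonal_frame (e : κ → ℝ) (he : e ⬝ᵥ e = 1) :
    ∃ k : ℕ, k + 1 = Fintype.card κ ∧ ∃ R : Matrix (Fin k ⊕ Unit) κ ℝ, R * Rᵀ = 1 ∧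
      Rᵀ * R = 1 ∧ R *ᵥ e = Pi.single (Sum.inr ()) 1 := by
  have hne : Nonempty κ := by
    by_contra h
    rw [not_nonempty_iff] at h
    simp [dotProduct] at he
  have hpos : 0 < Fintype.card κ := Fintype.card_pos
  have hcard : Fintype.card (Fin (Fintype.card κ - 1) ⊕ Unit) = Fintype.card κ := by
    simp; omega
  set E : EuclideanSpace ℝ κ := WithLp.toLp 2 e
  have hE : ‖E‖ = 1 := by
    rw [← sq_eq_sq₀ (norm_nonneg _) zero_le_one, EuclideanSpace.real_norm_sq_eq]
    simpa [dotProduct, pow_two, E] using he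
  obtain ⟨b, hb⟩ := Orthonormal.exists_orthonormalBasis_extension_of_card_eq (𝕜 := ℝ)
    (E := EuclideanSpace ℝ κ) (ι := Fin (Fintype.card κ - 1) ⊕ Unit)
    (by rw [finrank_euclideanSpace, hcard]) (v := fun _ => E) (s := {Sum.inr ()})
    ⟨fun _ => hE, fun i j hij => absurd (Subsingleton.elim i j) hij⟩
  have hR : (Matrix.of fun i c => b i c) * (Matrix.of fun i c => b i c)ᵀ = 1 := by
    ext i j
    have := orthonormal_iff_ite.1 b.orthonormal j i
    rw [PiLp.inner_apply] at this
    simp only [Matrix.mul_apply, Matrix.of_apply, Matrix.transpose_apply, Matrix.one_apply]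
    simp only [RCLike.inner_apply, conj_trivial] at this
    rw [this]
    simp [eq_comm]
  refine ⟨Fintype.card κ - 1, by omega, Matrix.of fun i c => b i c, hR,
    (Matrix.mul_eq_one_comm_of_equiv (Fintype.equivOfCardEq hcard)).1 hR, ?_⟩
  have hbe : e = fun c => b (Sum.inr ()) c := by rw [hb _ rfl]
  ext i
  have := congrFun (congrFun hR i) (Sum.inr ())
  rw [Matrix.mul_apply] at this
  rw [hbe]
  simp only [Matrix.mulVec, dotProduct, Matrix.of_apply, Matrix.transpose_apply] at this ⊢
  rw [this, Matrix.one_apply, Pi.single_apply]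

omit [DecidableEq ι] in
theorem gram_inv_frame {κ₁ : Type*} [Fintype κ₁] [DecidableEq κ₁] (R : Matrix κ₁ κ ℝ)
    (hR : R * Rᵀ = 1) (hR' : Rᵀ * R = 1) {B : Matrix κ ι ℝ} (hB : IsUnit (gram B).det) :
    IsUnit (gram (R * B)).det ∧ (gram (R * B))⁻¹ = R * (gram B)⁻¹ * Rᵀ := by
  have hg : gram (R * B) = R * gram B * Rᵀ := by
    simp [gram, Matrix.transpose_mul, Matrix.mul_assoc]
  have h1 : gram (R * B) * (R * (gram B)⁻¹ * Rᵀ) = 1 := by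
    rw [hg]
    calc R * gram B * Rᵀ * (R * (gram B)⁻¹ * Rᵀ) = R * gram B * (Rᵀ * R) * (gram B)⁻¹ * Rᵀ := by
          simp only [Matrix.mul_assoc]
      _ = 1 := by
        rw [hR', Matrix.mul_one, Matrix.mul_assoc R, Matrix.mul_nonsing_inv _ hB, Matrix.mul_one, hR]
  exact ⟨Matrix.isUnit_det_of_right_inverse h1, Matrix.inv_eq_right_inv h1⟩

theorem resid_tail {B : Matrix κ ι ℝ} (hB : IsUnit (gram B).det) {p : ℝ}
    (hp : p = (Fintype.card ι : ℝ) - Fintype.card κ) (hp0 : 0 < p) {x : ℝ} (hx : 0 ≤ x) :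
    (stdG ι) {w | x ≤ |w ⬝ᵥ (resid B *ᵥ w) - p|}
      ≤ ENNReal.ofReal (2 * Real.exp (-(x ^ 2 / (4 * (p + x))))) :=
  quadForm_tail (resid_transpose B) (resid_mul_resid hB) (by rw [trace_resid hB, hp]) hp0 hx

omit [DecidableEq ι] in
/-- The inverse of a diagonal entry of the inverse Gram matrix, in any orthonormal frame,
is a chi-square variable. -/
theorem gram_inv_quadForm_tail (e : κ → ℝ) (he : e ⬝ᵥ e = 1)
    (hk : Fintype.card κ ≤ Fintype.card ι) {N : ℝ}
    (hN : N = (Fintype.card ι : ℝ) - Fintype.card κ + 1) {x : ℝ} (hx : 0 ≤ x) :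
    (stdM κ ι) {C | x ≤ |(e ⬝ᵥ ((gram (Matrix.of C))⁻¹ *ᵥ e))⁻¹ - N|}
      ≤ ENNReal.ofReal (2 * Real.exp (-(x ^ 2 / (4 * (N + x))))) := by
  classical
  obtain ⟨k, hcard, R, hR, hR', hRe⟩ := exists_orthogonal_frame e he
  set S : Set ((Fin k → ι → ℝ) × (Unit → ι → ℝ)) :=
    {p | x ≤ |p.2 () ⬝ᵥ (resid (Matrix.of p.1) *ᵥ p.2 ()) - N|} with hSdef
  have hS : MeasurableSet S := by
    refine measurableSet_le measurable_const ?_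
    have : Measurable fun p : (Fin k → ι → ℝ) × (Unit → ι → ℝ) => p.2 () := by fun_prop
    exact (((by fun_prop : Measurable fun p : (Fin k → ι → ℝ) × (Unit → ι → ℝ) =>
      p.2 () ⬝ᵥ (resid (Matrix.of p.1) *ᵥ p.2 ()))).sub_const N).abs
  have hmp : MeasurePreserving (fun C : κ → ι → ℝ =>
      ((fun c => fun i => (R * Matrix.of C) (Sum.inl c) i),
        (fun c => fun i => (R * Matrix.of C) (Sum.inr c) i)))
      (stdM κ ι) ((stdM (Fin k) ι).prod (stdM Unit ι)) :=
    measurePreserving_sum_split.comp (measurePreserving_matrix_mul_left (ι := ι) R hR)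
  have hSle : ((stdM (Fin k) ι).prod (stdM Unit ι)) S ≤
      ENNReal.ofReal (2 * Real.exp (-(x ^ 2 / (4 * (N + x))))) := by
    -- With the first `k` rows fixed, the last row is an independent standard Gaussian vector. As
    -- `k` is one less than the number of rows of `C`, its residual has `N` degrees of freedom,
    -- which explains the `+ 1` in `N`.
    refine prod_measure_le hS ?_
    filter_upwards [ae_linearIndependent (κ := Fin k) (ι := ι) (by rw [Fintype.card_fin]; omega)] with C hC
    have h1 := (measurePreserving_eval (fun _ : Unit => stdG ι) ()).measure_preimage
      (s := {w | x ≤ |w ⬝ᵥ (resid (Matrix.of C) *ᵥ w) - N|})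
      (measurableSet_le measurable_const
        ((by fun_prop : Measurable fun w => w ⬝ᵥ (resid (Matrix.of C) *ᵥ w)).sub_const N).abs
        ).nullMeasurableSet
    refine le_trans (le_of_eq h1) (resid_tail (isUnit_det_gram hC) ?_ ?_ hx)
    · rw [hN, ← hcard, Fintype.card_fin]; push_cast; ring
    · have : (Fintype.card κ : ℝ) ≤ Fintype.card ι := by exact_mod_cast hk
      rw [hN]; linarith
  rw [← hmp.measure_preimage hS.nullMeasurableSet] at hSle
  refine le_trans (measure_mono_ae ?_) hSle
  have hLI : ∀ᵐ C ∂(stdM κ ι), LinearIndependent ℝ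
      (fun c : Fin k => fun i => (R * Matrix.of C) (Sum.inl c) i) := by
    have h := (ae_linearIndependent (κ := Fin k) (ι := ι) (by rw [Fintype.card_fin]; omega))
    exact (Measure.quasiMeasurePreserving_fst.comp hmp.quasiMeasurePreserving).ae h
  filter_upwards [ae_linearIndependent hk, hLI] with C hC hC0 hmem
  have hu := isUnit_det_gram hC
  obtain ⟨hu2, hinv⟩ := gram_inv_frame R hR hR' hu
  have hkey := gram_inv_apply_last (D := R * Matrix.of C)
    (B := Matrix.of fun c : Fin k => fun i => (R * Matrix.of C) (Sum.inl c) i)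
    (w := fun i => (R * Matrix.of C) (Sum.inr ()) i) (fun i => rfl) rfl (isUnit_det_gram hC0) hu2
  have hval : e ⬝ᵥ ((gram (Matrix.of C))⁻¹ *ᵥ e) =
      (gram (R * Matrix.of C))⁻¹ (Sum.inr ()) (Sum.inr ()) := by
    have he2 : Rᵀ *ᵥ Pi.single (Sum.inr ()) 1 = e := by
      rw [← hRe, Matrix.mulVec_mulVec, hR', Matrix.one_mulVec]
    have h1 : (gram (R * Matrix.of C))⁻¹ (Sum.inr ()) (Sum.inr ()) =
        Pi.single (Sum.inr ()) (1 : ℝ) ⬝ᵥ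
          ((gram (R * Matrix.of C))⁻¹ *ᵥ Pi.single (Sum.inr ()) 1) := by
      simp
    rw [h1, hinv, ← Matrix.mulVec_mulVec, ← Matrix.mulVec_mulVec, he2,
      Matrix.dotProduct_mulVec _ R, ← Matrix.mulVec_transpose R, he2]
  have hmem' : x ≤ |(e ⬝ᵥ ((gram (Matrix.of C))⁻¹ *ᵥ e))⁻¹ - N| := hmem
  rw [hval, hkey, inv_inv] at hmem'
  exact hmem'

end Regression


/-! ### Concentration of least-squares coefficients of pure noise -/

section RegressionTails

variable {ι κ : Type*} [Fintype ι] [Fintype κ] [DecidableEq κ]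

open scoped MatrixOrder in
theorem exists_symm_sqrt {A : Matrix κ κ ℝ} (hA : A.PosSemidef) :
    ∃ Q : Matrix κ κ ℝ, Qᵀ = Q ∧ Q * Q = A := by
  refine ⟨CFC.sqrt A, ?_, CFC.sqrt_mul_sqrt_self A hA.nonneg⟩
  have h : (CFC.sqrt A).PosSemidef := Matrix.nonneg_iff_posSemidef.1 (CFC.sqrt_nonneg A)
  have := h.isHermitian
  rwa [Matrix.IsHermitian, Matrix.conjTranspose_eq_transpose_of_trivial] at this

/-- For a fixed design, the squared length of the least-squares coefficients of pure noise has
the law of a quadratic form in the inverse Gram matrix. -/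
theorem stdG_coef_normSq {C : κ → ι → ℝ} (hC : LinearIndependent ℝ C) {S : Set ℝ}
    (hS : MeasurableSet S) :
    (stdG ι) {w | (coef (Matrix.of C) *ᵥ w) ⬝ᵥ (coef (Matrix.of C) *ᵥ w) ∈ S}
      = (stdG κ) {h | h ⬝ᵥ ((gram (Matrix.of C))⁻¹ *ᵥ h) ∈ S} := by
  set B : Matrix κ ι ℝ := Matrix.of C with hB
  have hu := isUnit_det_gram hC
  obtain ⟨Q, hQs, hQQ⟩ := exists_symm_sqrt (gram_posDef hC).inv.posSemidef
  rw [← hB] at hQQ hu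
  -- With `Q` the root of the inverse Gram matrix, `Q * B` has orthonormal rows, so the coefficients
  -- of `w` are `Q` applied to a standard Gaussian vector.
  have hT : (Q * B) * (Q * B)ᵀ = 1 := by
    have h1 : (Q * B) * (Q * B)ᵀ = Q * gram B * Q := by
      rw [Matrix.transpose_mul, hQs, gram]; simp only [Matrix.mul_assoc]
    have h2 : Q * (Q * gram B) = 1 := by
      rw [← Matrix.mul_assoc, hQQ]; exact Matrix.nonsing_inv_mul _ hu
    rw [h1]; exact mul_eq_one_comm.1 h2
  have hmp := measurePreserving_mulVec (Q * B) hT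
  have hmS : MeasurableSet {h : κ → ℝ | h ⬝ᵥ ((gram B)⁻¹ *ᵥ h) ∈ S} :=
    measurableSet_preimage (by fun_prop) hS
  rw [← hmp.measure_preimage hmS.nullMeasurableSet]
  congr 1
  ext w
  simp only [Set.mem_ofPred_eq, Set.mem_preimage]
  have h3 : coef B *ᵥ w = Q *ᵥ ((Q * B) *ᵥ w) := by
    rw [Matrix.mulVec_mulVec, ← Matrix.mul_assoc, hQQ, coef]
  rw [h3, Matrix.dotProduct_mulVec, ← Matrix.mulVec_transpose, hQs, Matrix.mulVec_mulVec, hQQ,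
    dotProduct_comm]

/-- The numerator of the difference is below 2τnN, and V ≥ (19/20)N; since 2·20/19 < 3, the constant
3 suffices. -/
theorem abs_div_sub_div_le {U V k N n τ : ℝ} (hk : 0 ≤ k) (hkn : k ≤ n) (hN : 0 < N)
    (hτ : τ ≤ 1 / 20) (hU : |U - k| < τ * n) (hV : |V - N| < τ * N) :
    |U / V - k / N| < 3 * τ * (n / N) := by
  have hV' := abs_lt.1 hV
  have hU' := abs_lt.1 hU
  have hτn : 0 < τ * n := (abs_nonneg _).trans_lt hU
  have hτN : 0 < τ * N := (abs_nonneg _).trans_lt hV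
  have hVN : 19 / 20 * N ≤ V := by nlinarith
  have hVpos : 0 < V := by nlinarith
  have h1 : U / V - k / N = ((U - k) * N - k * (V - N)) / (V * N) := by field_simp; ring
  rw [h1, abs_div, abs_of_pos (mul_pos hVpos hN), div_lt_iff₀ (mul_pos hVpos hN)]
  have h2 : 3 * τ * (n / N) * (V * N) = 3 * τ * n * V := by field_simp
  rw [h2]
  have h3 : |(U - k) * N - k * (V - N)| ≤ |U - k| * N + k * |V - N| := by
    refine (abs_sub _ _).trans ?_
    rw [abs_mul, abs_mul, abs_of_pos hN, abs_of_nonneg hk]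
  have h4 : |U - k| * N < τ * n * N := mul_lt_mul_of_pos_right hU hN
  have h5 : k * |V - N| ≤ n * (τ * N) := mul_le_mul hkn hV.le (abs_nonneg _) (hk.trans hkn)
  have h6 : 3 * (τ * n) * (19 / 20 * N) ≤ 3 * (τ * n) * V :=
    mul_le_mul_of_nonneg_left hVN (by positivity)
  nlinarith [mul_pos hτn hN]

/-- The constant 21/5 is 4(1 + 1/20), the denominator of the chi-square rate at the largest
admissible `τ`. -/
theorem exp_tail_le {p m τ : ℝ} (hp : 0 < p) (hmp : m ≤ p) (hτ0 : 0 ≤ τ) (hτ : τ ≤ 1 / 20) :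
    Real.exp (-((τ * p) ^ 2 / (4 * (p + τ * p)))) ≤ Real.exp (-(m * τ ^ 2 / (21 / 5))) := by
  apply Real.exp_le_exp.2
  rw [neg_le_neg_iff]
  have h1 : (τ * p) ^ 2 / (4 * (p + τ * p)) = p * τ ^ 2 / (4 * (1 + τ)) := by
    have : 1 + τ ≠ 0 := by linarith
    field_simp
  rw [h1]
  have h2 : m * τ ^ 2 ≤ p * τ ^ 2 := mul_le_mul_of_nonneg_right hmp (sq_nonneg τ)
  refine (div_le_div_of_nonneg_right h2 (by norm_num)).trans ?_
  apply div_le_div_of_nonneg_left (by positivity) (by positivity)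
  linarith

omit [DecidableEq κ] in
theorem normSq_eq_smul {h e : κ → ℝ} {r : ℝ} (he : h = r • e) (A : Matrix κ κ ℝ) :
    h ⬝ᵥ (A *ᵥ h) = r ^ 2 * (e ⬝ᵥ (A *ᵥ e)) := by
  rw [he, Matrix.mulVec_smul, smul_dotProduct, dotProduct_smul]
  simp only [smul_eq_mul]; ring

omit [DecidableEq κ] in
theorem exists_unit_smul {h : κ → ℝ} (hh : h ≠ 0) :
    ∃ (r : ℝ) (e : κ → ℝ), 0 < r ∧ h = r • e ∧ e ⬝ᵥ e = 1 ∧ r ^ 2 = h ⬝ᵥ h := by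
  have hpos := dotProduct_self_pos hh
  have hr0 : 0 < √(h ⬝ᵥ h) := Real.sqrt_pos.2 hpos
  refine ⟨√(h ⬝ᵥ h), (√(h ⬝ᵥ h))⁻¹ • h, hr0, ?_, ?_, Real.sq_sqrt hpos.le⟩
  · rw [smul_smul, mul_inv_cancel₀ hr0.ne', one_smul]
  · rw [smul_dotProduct, dotProduct_smul]
    simp only [smul_eq_mul]
    rw [← mul_assoc, ← mul_inv, Real.mul_self_sqrt hpos.le, inv_mul_cancel₀ hpos.ne']

omit [DecidableEq κ] in
-- Lets the vector `h` be normalized outside a null set.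
theorem stdG_singleton_zero [Nonempty κ] : (stdG κ) {(0 : κ → ℝ)} = 0 := by
  have h := stdG_submodule (⊥ : Submodule ℝ (κ → ℝ)) bot_ne_top
  simpa using h

/-- Concentration of the squared length of the least-squares coefficients of pure noise. -/
theorem coef_normSq_tail [Nonempty κ] {n k N m τ : ℝ} (hn : n = Fintype.card ι)
    (hk : k = Fintype.card κ) (hN : N = n - k + 1) (hm : m = n - k) (hm0 : 0 ≤ m)
    (hτ0 : 0 ≤ τ) (hτ : τ ≤ 1 / 20) (hkτ : k + τ * n ≤ n) :
    ((stdM κ ι).prod (stdG ι)) {p | 3 * τ * (n / N) ≤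
        |(coef (Matrix.of p.1) *ᵥ p.2) ⬝ᵥ (coef (Matrix.of p.1) *ᵥ p.2) - k / N|}
      ≤ ENNReal.ofReal (4 * Real.exp (-(m * τ ^ 2 / (21 / 5)))) := by
  have hkn : Fintype.card κ ≤ Fintype.card ι := by
    have : (Fintype.card κ : ℝ) ≤ Fintype.card ι := by rw [← hn, ← hk]; linarith
    exact_mod_cast this
  have hk0 : 0 < k := by rw [hk]; exact_mod_cast Fintype.card_pos
  have hn0 : 0 < n := by linarith
  have hN0 : 0 < N := by linarith
  set S : Set ℝ := {z | 3 * τ * (n / N) ≤ |z - k / N|} with hSdef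
  have hS : MeasurableSet S := measurableSet_le measurable_const (by fun_prop)
  have hm1 : MeasurableSet {p : (κ → ι → ℝ) × (ι → ℝ) |
      (coef (Matrix.of p.1) *ᵥ p.2) ⬝ᵥ (coef (Matrix.of p.1) *ᵥ p.2) ∈ S} :=
    measurableSet_preimage (by fun_prop) hS
  have hm2 : MeasurableSet {p : (κ → ι → ℝ) × (κ → ℝ) |
      p.2 ⬝ᵥ ((gram (Matrix.of p.1))⁻¹ *ᵥ p.2) ∈ S} :=
    measurableSet_preimage (by fun_prop) hS
  -- Given the design, the noise enters only through a vector independent of it. After this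
  -- replacement the order of integration can be reversed: `h` is fixed and the design is random,
  -- which separates |h|² (chi-square) from the quadratic form in the direction of `h`.
  have hswap : ((stdM κ ι).prod (stdG ι)) {p : (κ → ι → ℝ) × (ι → ℝ) |
      (coef (Matrix.of p.1) *ᵥ p.2) ⬝ᵥ (coef (Matrix.of p.1) *ᵥ p.2) ∈ S}
      = ((stdM κ ι).prod (stdG κ)) {p : (κ → ι → ℝ) × (κ → ℝ) |
      p.2 ⬝ᵥ ((gram (Matrix.of p.1))⁻¹ *ᵥ p.2) ∈ S} := by
    rw [Measure.prod_apply hm1, Measure.prod_apply hm2]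
    refine lintegral_congr_ae ?_
    filter_upwards [ae_linearIndependent hkn] with C hC
    exact stdG_coef_normSq hC hS
  refine le_trans (le_of_eq hswap) ?_
  rw [Measure.prod_apply_symm hm2]
  set b : ℝ≥0∞ := ENNReal.ofReal (2 * Real.exp (-(m * τ ^ 2 / (21 / 5)))) with hb
  set T : Set (κ → ℝ) := {h | τ * n ≤ |h ⬝ᵥ ((1 : Matrix κ κ ℝ) *ᵥ h) - k|} with hTdef
  have hT : MeasurableSet T := measurableSet_le measurable_const (by fun_prop)
  have hTle : (stdG κ) T ≤ b := by
    refine (quadForm_tail (M := (1 : Matrix κ κ ℝ)) Matrix.transpose_one (Matrix.mul_one 1)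
      (by rw [Matrix.trace_one, hk]) hk0 (by positivity)).trans ?_
    apply ENNReal.ofReal_le_ofReal
    refine mul_le_mul_of_nonneg_left (Real.exp_le_exp.2 ?_) (by norm_num)
    rw [neg_le_neg_iff]
    -- The deviation of |h|² is measured against `n` rather than `k`; `k + τ * n ≤ n` keeps the
    -- chi-square rate at n τ²/4.
    have h1 : n * τ ^ 2 / 4 ≤ (τ * n) ^ 2 / (4 * (k + τ * n)) := by
      rw [div_le_div_iff₀ (by norm_num) (by positivity)]
      nlinarith [mul_le_mul_of_nonneg_left hkτ (by positivity : 0 ≤ n * τ ^ 2)]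
    refine le_trans ?_ h1
    have h2 : m * τ ^ 2 ≤ n * τ ^ 2 := by gcongr; linarith
    have h3 : 0 ≤ n * τ ^ 2 := by positivity
    linarith
  have hfib : ∀ᵐ h ∂(stdG κ), (stdM κ ι) ((fun C => (C, h)) ⁻¹' {p : (κ → ι → ℝ) × (κ → ℝ) |
      p.2 ⬝ᵥ ((gram (Matrix.of p.1))⁻¹ *ᵥ p.2) ∈ S}) ≤ T.indicator (fun _ => 1) h + b := by
    have h0 : ∀ᵐ h ∂(stdG κ), h ≠ 0 := by
      rw [ae_iff]; simpa using stdG_singleton_zero (κ := κ)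
    filter_upwards [h0] with h hh
    -- Atypical lengths of `h` are charged probability one and integrated afterwards; for all others
    -- only the design can cause a deviation.
    by_cases hhT : h ∈ T
    · rw [Set.indicator_of_mem hhT]
      exact le_trans prob_le_one le_self_add
    · rw [Set.indicator_of_notMem hhT, zero_add]
      obtain ⟨r, e, hr, hre, he, hr2⟩ := exists_unit_smul hh
      refine le_trans (measure_mono (fun C hC => ?_)) ((gram_inv_quadForm_tail e he hkn
        (N := N) (by rw [hN, hn, hk]) (x := τ * N) (by positivity)).trans
        (ENNReal.ofReal_le_ofReal (mul_le_mul_of_nonneg_left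
          (exp_tail_le hN0 (by linarith : m ≤ N) hτ0 hτ) (by norm_num))))
      simp only [Set.mem_preimage, Set.mem_ofPred_eq, S] at hC
      simp only [Set.mem_ofPred_eq]
      by_contra hcon
      rw [not_le] at hcon
      rw [hTdef, Set.mem_ofPred_eq, not_le, Matrix.one_mulVec] at hhT
      have := abs_div_sub_div_le hk0.le (by linarith) hN0 hτ hhT hcon
      rw [normSq_eq_smul hre, hr2] at hC
      rw [div_inv_eq_mul] at this
      linarith
  calc _ ≤ ∫⁻ h, (T.indicator (fun _ => 1) h + b) ∂(stdG κ) := lintegral_mono_ae hfib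
    _ = (stdG κ) T + b := by
      rw [lintegral_add_right _ measurable_const, lintegral_indicator hT]
      simp
    _ ≤ b + b := by gcongr
    _ = _ := by
      rw [hb, ← ENNReal.ofReal_add (by positivity) (by positivity)]; congr 1; ring

theorem dotProduct_coef (C : Matrix κ ι ℝ) (c : κ → ℝ) (w : ι → ℝ) :
    c ⬝ᵥ (coef C *ᵥ w) = (c ᵥ* coef C) ⬝ᵥ w := Matrix.dotProduct_mulVec _ _ _

/-- The variance, given the design, of a linear functional of the coefficients of noise. -/
theorem vecMul_coef_normSq {C : Matrix κ ι ℝ} (hC : IsUnit (gram C).det) (c : κ → ℝ) :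
    (c ᵥ* coef C) ⬝ᵥ (c ᵥ* coef C) = c ⬝ᵥ ((gram C)⁻¹ *ᵥ c) := by
  rw [← Matrix.dotProduct_mulVec]
  congr 1
  rw [← Matrix.mulVec_transpose, Matrix.mulVec_mulVec]
  congr 1
  rw [coef, Matrix.transpose_mul, gram_inv_transpose, Matrix.mul_assoc, ← Matrix.mul_assoc C,
    ← gram, Matrix.mul_nonsing_inv _ hC, Matrix.mul_one]

/-- Concentration of a linear functional of the least-squares coefficients of pure noise. -/
theorem coef_linear_tail {n k N m τ : ℝ} (hn : n = Fintype.card ι)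
    (hk : k = Fintype.card κ) (hN : N = n - k + 1) (hm : m = n - k) (hm0 : 0 ≤ m)
    (hτ0 : 0 ≤ τ) (hτ : τ ≤ 1 / 20) (c : κ → ℝ) :
    ((stdM κ ι).prod (stdG ι)) {p | τ * √(c ⬝ᵥ c) < |c ⬝ᵥ (coef (Matrix.of p.1) *ᵥ p.2)|}
      ≤ ENNReal.ofReal (4 * Real.exp (-(m * τ ^ 2 / (21 / 5)))) := by
  -- The strict inequality in the event makes it empty for the zero functional.
  rcases eq_or_ne c 0 with rfl | hc
  · simp
  have hkn : Fintype.card κ ≤ Fintype.card ι := by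
    have : (Fintype.card κ : ℝ) ≤ Fintype.card ι := by rw [← hn, ← hk]; linarith
    exact_mod_cast this
  have hN0 : 0 < N := by linarith
  obtain ⟨r, e, hr, hre, he, hr2⟩ := exists_unit_smul hc
  have hsq : √(c ⬝ᵥ c) = r := by rw [← hr2, Real.sqrt_sq hr.le]
  set b : ℝ≥0∞ := ENNReal.ofReal (2 * Real.exp (-(m * τ ^ 2 / (21 / 5)))) with hb
  set T : Set (κ → ι → ℝ) :=
    {C | τ * N ≤ |(e ⬝ᵥ ((gram (Matrix.of C))⁻¹ *ᵥ e))⁻¹ - N|} with hTdef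
  have hT : MeasurableSet T := by
    refine measurableSet_le measurable_const ?_
    exact ((by fun_prop : Measurable fun C : κ → ι → ℝ =>
      e ⬝ᵥ ((gram (Matrix.of C))⁻¹ *ᵥ e)).inv.sub_const N).abs
  have hTle : (stdM κ ι) T ≤ b :=
    (gram_inv_quadForm_tail e he hkn (N := N) (by rw [hN, hn, hk]) (by positivity)).trans
      (ENNReal.ofReal_le_ofReal (mul_le_mul_of_nonneg_left
          (exp_tail_le hN0 (by linarith : m ≤ N) hτ0 hτ) (by norm_num)))
  have hm1 : MeasurableSet {p : (κ → ι → ℝ) × (ι → ℝ) |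
      τ * √(c ⬝ᵥ c) < |c ⬝ᵥ (coef (Matrix.of p.1) *ᵥ p.2)|} :=
    measurableSet_lt measurable_const
      (by fun_prop : Measurable fun p : (κ → ι → ℝ) × (ι → ℝ) =>
        c ⬝ᵥ (coef (Matrix.of p.1) *ᵥ p.2)).abs
  rw [Measure.prod_apply hm1]
  have hfib : ∀ᵐ C ∂(stdM κ ι), (stdG ι) (Prod.mk C ⁻¹' {p : (κ → ι → ℝ) × (ι → ℝ) |
      τ * √(c ⬝ᵥ c) < |c ⬝ᵥ (coef (Matrix.of p.1) *ᵥ p.2)|})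
      ≤ T.indicator (fun _ => 1) C + b := by
    classical
    filter_upwards [ae_linearIndependent hkn] with C hC
    -- Outside `T` the conditional variance of the normalized functional is below 20/(19N), so a
    -- Gaussian tail bound with rate (19/40)Nτ² applies, more than is needed.
    by_cases hCT : C ∈ T
    · rw [Set.indicator_of_mem hCT]
      exact le_trans prob_le_one le_self_add
    · rw [Set.indicator_of_notMem hCT, zero_add]
      rw [hTdef, Set.mem_ofPred_eq, not_le] at hCT
      set g := e ᵥ* coef (Matrix.of C) with hg
      have hgg : g ⬝ᵥ g = e ⬝ᵥ ((gram (Matrix.of C))⁻¹ *ᵥ e) :=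
        vecMul_coef_normSq (isUnit_det_gram hC) e
      rw [← hgg] at hCT
      have hinv : 19 / 20 * N < (g ⬝ᵥ g)⁻¹ := by
        have := (abs_lt.1 hCT).1
        nlinarith
      have hg0 : g ≠ 0 := by
        rintro h0
        rw [h0, dotProduct_zero, inv_zero] at hinv
        linarith
      obtain ⟨ρ, f, hρ, hρf, hf, hρ2⟩ := exists_unit_smul hg0
      have hgpos := dotProduct_self_pos hg0
      refine le_trans (measure_mono (fun w hw => ?_)) ((linear_tail f hf
        (x := τ / ρ) (by positivity)).trans (ENNReal.ofReal_le_ofReal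
          (mul_le_mul_of_nonneg_left (Real.exp_le_exp.2 ?_) (by norm_num))))
      · simp only [Set.mem_preimage, Set.mem_ofPred_eq] at hw ⊢
        rw [hsq] at hw
        have h1 : c ⬝ᵥ (coef (Matrix.of C) *ᵥ w) = r * (ρ * (f ⬝ᵥ w)) := by
          rw [hre, smul_dotProduct, dotProduct_coef, ← hg, hρf, smul_dotProduct]
          simp
        rw [h1, abs_mul, abs_mul, abs_of_pos hr, abs_of_pos hρ, mul_comm τ] at hw
        have h2 := lt_of_mul_lt_mul_left hw hr.le
        rw [div_le_iff₀ hρ]; linarith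
      · rw [neg_le_neg_iff, div_pow, hρ2, div_eq_mul_inv (τ ^ 2)]
        have h3 : m ≤ N := by linarith
        have h4 : τ ^ 2 * (19 / 20 * N) ≤ τ ^ 2 * (g ⬝ᵥ g)⁻¹ :=
          mul_le_mul_of_nonneg_left hinv.le (sq_nonneg τ)
        have h5 : τ ^ 2 * m ≤ τ ^ 2 * N := mul_le_mul_of_nonneg_left h3 (sq_nonneg τ)
        have h6 : 0 ≤ τ ^ 2 * N := by positivity
        linarith
  calc _ ≤ ∫⁻ C, (T.indicator (fun _ => 1) C + b) ∂(stdM κ ι) := lintegral_mono_ae hfib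
    _ = (stdM κ ι) T + b := by
      rw [lintegral_add_right _ measurable_const, lintegral_indicator hT]
      simp
    _ ≤ b + b := by gcongr
    _ = _ := by
      rw [hb, ← ENNReal.ofReal_add (by positivity) (by positivity)]; congr 1; ring

end RegressionTails


/-! ### Data-dependent weights that are independent of the fitted values -/

section Decoupling

variable {ι κ κ' : Type*} [Fintype ι] [Fintype κ] [Fintype κ'] [DecidableEq κ] [DecidableEq ι]

/-- Mixing the range part and the null part of two independent Gaussian matrices, with respect
to an orthogonal projection, gives a Gaussian matrix. -/
theorem measurePreserving_mix {M : Matrix ι ι ℝ} (hs : Mᵀ = M) (hi : M * M = M) :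
    MeasurePreserving (fun (p : (κ' → ι → ℝ) × (κ' → ι → ℝ)) k =>
      M *ᵥ p.1 k + (1 - M) *ᵥ p.2 k) ((stdM κ' ι).prod (stdM κ' ι)) (stdM κ' ι) := by
  have hQ : Matrix.fromCols M (1 - M) * (Matrix.fromCols M (1 - M))ᵀ = 1 := by
    rw [Matrix.transpose_fromCols, Matrix.fromCols_mul_fromRows, hs, Matrix.transpose_sub, hs,
      Matrix.transpose_one, hi, Matrix.mul_sub, Matrix.mul_one, Matrix.sub_mul, Matrix.one_mul, hi]
    abel
  have h := measurePreserving_transpose.comp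
    ((measurePreserving_matrix_mul_left (ι := κ') (Matrix.fromCols M (1 - M)) hQ).comp
      (measurePreserving_sum_join.comp
        ((measurePreserving_transpose (κ := κ') (ι := ι)).prod
          (measurePreserving_transpose (κ := κ') (ι := ι)))))
  convert h using 1
  ext p k i
  simp [Matrix.mul_apply, Matrix.mulVec, dotProduct, Fintype.sum_sum_type]

omit [Fintype κ] [DecidableEq κ] [DecidableEq ι] in
theorem mulVec_vecMul_of (c : κ' → ℝ) (W : κ' → ι → ℝ) (A : Matrix κ ι ℝ) :
    A *ᵥ (c ᵥ* Matrix.of W) = ∑ k, c k • (A *ᵥ W k) := by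
  rw [Matrix.vecMul_eq_sum, Matrix.mulVec_sum]
  simp only [Matrix.mulVec_smul]
  rfl

/-- If the unit vector `c W` depends on `W` only through the residuals of its rows, then the
regression coefficients of `c W ᵥ* W` are distributed as those of a single Gaussian vector. -/
theorem stdM_coef_unit {C : κ → ι → ℝ} (hC : LinearIndependent ℝ C)
    {c : (κ' → ι → ℝ) → κ' → ℝ} (hcm : Measurable c) (hcu : ∀ W, c W ⬝ᵥ c W = 1)
    (hcr : ∀ W W' : κ' → ι → ℝ,
      (∀ k, resid (Matrix.of C) *ᵥ W k = resid (Matrix.of C) *ᵥ W' k) → c W = c W')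
    {S : Set ℝ} (hS : MeasurableSet S) :
    (stdM κ' ι) {W | (coef (Matrix.of C) *ᵥ (c W ᵥ* Matrix.of W)) ⬝ᵥ
        (coef (Matrix.of C) *ᵥ (c W ᵥ* Matrix.of W)) ∈ S}
      = (stdG ι) {w | (coef (Matrix.of C) *ᵥ w) ⬝ᵥ (coef (Matrix.of C) *ᵥ w) ∈ S} := by
  have hu := isUnit_det_gram hC
  set B : Matrix κ ι ℝ := Matrix.of C with hB
  have hmix := measurePreserving_mix (κ' := κ') (resid_transpose B) (resid_mul_resid hu)
  have hm1 : MeasurableSet {W : κ' → ι → ℝ | (coef B *ᵥ (c W ᵥ* Matrix.of W)) ⬝ᵥ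
        (coef B *ᵥ (c W ᵥ* Matrix.of W)) ∈ S} := measurableSet_preimage (by fun_prop) hS
  rw [← hmix.measure_preimage hm1.nullMeasurableSet]
  have hm2 : MeasurableSet {p : (κ' → ι → ℝ) × (κ' → ι → ℝ) |
      (coef B *ᵥ (c p.1 ᵥ* Matrix.of p.2)) ⬝ᵥ (coef B *ᵥ (c p.1 ᵥ* Matrix.of p.2)) ∈ S} :=
    measurableSet_preimage (by fun_prop) hS
  have hm3 : MeasurableSet {w : ι → ℝ | (coef B *ᵥ w) ⬝ᵥ (coef B *ᵥ w) ∈ S} :=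
    measurableSet_preimage (by fun_prop) hS
  -- In the mixture the residuals come from `p.1` and the fitted parts from `p.2`. The weights see
  -- only the former and the coefficients only the latter, so for fixed `p.1` the weights are a
  -- deterministic unit vector.
  have hset : (fun (p : (κ' → ι → ℝ) × (κ' → ι → ℝ)) k =>
      resid B *ᵥ p.1 k + (1 - resid B) *ᵥ p.2 k) ⁻¹' {W : κ' → ι → ℝ |
        (coef B *ᵥ (c W ᵥ* Matrix.of W)) ⬝ᵥ (coef B *ᵥ (c W ᵥ* Matrix.of W)) ∈ S}
      = {p : (κ' → ι → ℝ) × (κ' → ι → ℝ) |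
      (coef B *ᵥ (c p.1 ᵥ* Matrix.of p.2)) ⬝ᵥ (coef B *ᵥ (c p.1 ᵥ* Matrix.of p.2)) ∈ S} := by
    ext p
    simp only [Set.mem_preimage, Set.mem_ofPred_eq]
    have h1 : c (fun k => resid B *ᵥ p.1 k + (1 - resid B) *ᵥ p.2 k) = c p.1 := by
      apply hcr
      intro k
      rw [Matrix.mulVec_add, Matrix.mulVec_mulVec, Matrix.mulVec_mulVec, resid_mul_resid hu,
        Matrix.mul_sub, resid_mul_resid hu]
      simp
    have h2 : coef B *ᵥ (c p.1 ᵥ* Matrix.of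
        (fun k => resid B *ᵥ p.1 k + (1 - resid B) *ᵥ p.2 k))
        = coef B *ᵥ (c p.1 ᵥ* Matrix.of p.2) := by
      rw [mulVec_vecMul_of, mulVec_vecMul_of]
      refine Finset.sum_congr rfl fun k _ => ?_
      rw [Matrix.mulVec_add, Matrix.mulVec_mulVec, Matrix.mulVec_mulVec, coef_mul_resid hu,
        Matrix.mul_sub, coef_mul_resid hu]
      simp
    rw [h1, h2]
  rw [hset, Measure.prod_apply hm2]
  have hfib : ∀ W, (stdM κ' ι) (Prod.mk W ⁻¹' {p : (κ' → ι → ℝ) × (κ' → ι → ℝ) |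
      (coef B *ᵥ (c p.1 ᵥ* Matrix.of p.2)) ⬝ᵥ (coef B *ᵥ (c p.1 ᵥ* Matrix.of p.2)) ∈ S})
      = (stdG ι) {w | (coef B *ᵥ w) ⬝ᵥ (coef B *ᵥ w) ∈ S} := by
    intro W
    have := (measurePreserving_vecMul (ι := ι) (c W) (hcu W)).measure_preimage
      hm3.nullMeasurableSet
    rw [← this]
    rfl
  simp only [hfib]
  simp

/-- Fibrewise over the first block, `stdM_coef_unit` replaces the randomly weighted combination of
rows by pure noise, so no loss occurs compared with fixed weights. -/
theorem coef_unit_tail [Nonempty κ] {n k N m τ : ℝ} (hn : n = Fintype.card ι)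
    (hk : k = Fintype.card κ) (hN : N = n - k + 1) (hm : m = n - k) (hm0 : 0 ≤ m)
    (hτ0 : 0 ≤ τ) (hτ : τ ≤ 1 / 20) (hkτ : k + τ * n ≤ n)
    {c : (κ → ι → ℝ) × (κ' → ι → ℝ) → κ' → ℝ} (hcm : Measurable c) (hcu : ∀ p, c p ⬝ᵥ c p = 1)
    (hcr : ∀ (C : κ → ι → ℝ) (W W' : κ' → ι → ℝ),
      (∀ k, resid (Matrix.of C) *ᵥ W k = resid (Matrix.of C) *ᵥ W' k) → c (C, W) = c (C, W')) :
    ((stdM κ ι).prod (stdM κ' ι)) {p | 3 * τ * (n / N) ≤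
        |(coef (Matrix.of p.1) *ᵥ (c p ᵥ* Matrix.of p.2)) ⬝ᵥ
          (coef (Matrix.of p.1) *ᵥ (c p ᵥ* Matrix.of p.2)) - k / N|}
      ≤ ENNReal.ofReal (4 * Real.exp (-(m * τ ^ 2 / (21 / 5)))) := by
  refine le_trans (le_of_eq ?_) (coef_normSq_tail hn hk hN hm hm0 hτ0 hτ hkτ)
  have hkn : Fintype.card κ ≤ Fintype.card ι := by
    have : (Fintype.card κ : ℝ) ≤ Fintype.card ι := by rw [← hn, ← hk]; linarith
    exact_mod_cast this
  set S : Set ℝ := {z | 3 * τ * (n / N) ≤ |z - k / N|} with hSdef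
  have hS : MeasurableSet S := measurableSet_le measurable_const (by fun_prop)
  have hm1 : MeasurableSet {p : (κ → ι → ℝ) × (ι → ℝ) |
      (coef (Matrix.of p.1) *ᵥ p.2) ⬝ᵥ (coef (Matrix.of p.1) *ᵥ p.2) ∈ S} :=
    measurableSet_preimage (by fun_prop) hS
  have hm2 : MeasurableSet {p : (κ → ι → ℝ) × (κ' → ι → ℝ) |
      (coef (Matrix.of p.1) *ᵥ (c p ᵥ* Matrix.of p.2)) ⬝ᵥ
          (coef (Matrix.of p.1) *ᵥ (c p ᵥ* Matrix.of p.2)) ∈ S} :=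
    measurableSet_preimage (by fun_prop) hS
  change ((stdM κ ι).prod (stdM κ' ι)) {p : (κ → ι → ℝ) × (κ' → ι → ℝ) |
      (coef (Matrix.of p.1) *ᵥ (c p ᵥ* Matrix.of p.2)) ⬝ᵥ
          (coef (Matrix.of p.1) *ᵥ (c p ᵥ* Matrix.of p.2)) ∈ S} =
    ((stdM κ ι).prod (stdG ι)) {p : (κ → ι → ℝ) × (ι → ℝ) |
      (coef (Matrix.of p.1) *ᵥ p.2) ⬝ᵥ (coef (Matrix.of p.1) *ᵥ p.2) ∈ S}
  rw [Measure.prod_apply hm1, Measure.prod_apply hm2]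
  refine lintegral_congr_ae ?_
  filter_upwards [ae_linearIndependent hkn] with C hC
  exact stdM_coef_unit hC (c := fun W => c (C, W)) (by fun_prop) (fun W => hcu _)
    (fun W W' h => hcr C W W' h) hS

end Decoupling


/-! ### Unit vectors and polarization -/

section Unitize

variable {κ : Type*} [Fintype κ]

open Classical in
/-- Normalization to unit length; the zero vector is sent to `e`. -/
noncomputable def unitize (e x : κ → ℝ) : κ → ℝ := if x = 0 then e else (√(x ⬝ᵥ x))⁻¹ • x

theorem unitize_dotProduct_self {e : κ → ℝ} (he : e ⬝ᵥ e = 1) (x : κ → ℝ) :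
    unitize e x ⬝ᵥ unitize e x = 1 := by
  unfold unitize
  split_ifs with h
  · exact he
  · have hpos := dotProduct_self_pos h
    rw [smul_dotProduct, dotProduct_smul]
    simp only [smul_eq_mul]
    rw [← mul_assoc, ← mul_inv, Real.mul_self_sqrt hpos.le, inv_mul_cancel₀ hpos.ne']

/-- Holds at zero as well, because the length factor vanishes there whatever the fallback direction.
-/
theorem smul_unitize (e x : κ → ℝ) : √(x ⬝ᵥ x) • unitize e x = x := by
  unfold unitize
  split_ifs with h
  · simp [h]
  · have hpos := dotProduct_self_pos h
    rw [smul_smul, mul_inv_cancel₀ (Real.sqrt_pos.2 hpos).ne', one_smul]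

@[fun_prop]
theorem measurable_unitize {X : Type*} [MeasurableSpace X] (e : κ → ℝ) {f : X → κ → ℝ}
    (hf : Measurable f) : Measurable fun x => unitize e (f x) := by
  unfold unitize
  refine Measurable.ite (hf (measurableSet_singleton 0)) measurable_const ?_
  exact (by fun_prop : Measurable fun x => f x ⬝ᵥ f x).sqrt.inv.smul hf

/-- Polarization: bilinear forms are controlled by quadratic forms at unit vectors. -/
theorem abs_dotProduct_sub_le {α : Type*} [Fintype α] {e : κ → ℝ}
    (he : e ⬝ᵥ e = 1) (x y : κ → ℝ) (A : Matrix α κ ℝ) {q δ : ℝ}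
    (hp : |(A *ᵥ unitize e (unitize e x + unitize e y)) ⬝ᵥ
      (A *ᵥ unitize e (unitize e x + unitize e y)) - q| ≤ δ)
    (hm : |(A *ᵥ unitize e (unitize e x - unitize e y)) ⬝ᵥ
      (A *ᵥ unitize e (unitize e x - unitize e y)) - q| ≤ δ) :
    |(A *ᵥ x) ⬝ᵥ (A *ᵥ y) - (x ⬝ᵥ y) * q| ≤ δ * (√(x ⬝ᵥ x) * √(y ⬝ᵥ y)) := by
  set X := unitize e x
  set Y := unitize e y
  have hX : X ⬝ᵥ X = 1 := unitize_dotProduct_self he x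
  have hY : Y ⬝ᵥ Y = 1 := unitize_dotProduct_self he y
  have hquad : ∀ z : κ → ℝ, (A *ᵥ z) ⬝ᵥ (A *ᵥ z) =
      (z ⬝ᵥ z) * ((A *ᵥ unitize e z) ⬝ᵥ (A *ᵥ unitize e z)) := by
    intro z
    have h : A *ᵥ z = √(z ⬝ᵥ z) • (A *ᵥ unitize e z) := by
      rw [← Matrix.mulVec_smul, smul_unitize]
    rw [h, smul_dotProduct, dotProduct_smul]
    simp only [smul_eq_mul]
    rw [← mul_assoc, Real.mul_self_sqrt (dotProduct_self_nonneg' z)]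
  have h1 := hquad (X + Y)
  have h2 := hquad (X - Y)
  set Fp := (A *ᵥ unitize e (X + Y)) ⬝ᵥ (A *ᵥ unitize e (X + Y))
  set Fm := (A *ᵥ unitize e (X - Y)) ⬝ᵥ (A *ᵥ unitize e (X - Y))
  rw [Matrix.mulVec_add] at h1
  rw [Matrix.mulVec_sub] at h2
  simp only [add_dotProduct, dotProduct_add, sub_dotProduct, dotProduct_sub, hX, hY,
    dotProduct_comm Y X, dotProduct_comm (A *ᵥ Y) (A *ᵥ X)] at h1 h2
  have hκ := dotProduct_self_nonneg' (X + Y)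
  have hκ' := dotProduct_self_nonneg' (X - Y)
  simp only [add_dotProduct, dotProduct_add, sub_dotProduct, dotProduct_sub, hX, hY,
    dotProduct_comm Y X] at hκ hκ'
  set c := X ⬝ᵥ Y
  -- For unit vectors |X ± Y|² = 2(1 ± c). The two error weights (1 ± c)/2 are nonnegative and sum
  -- to one, so polarization loses no constant.
  have h3 : (A *ᵥ X) ⬝ᵥ (A *ᵥ Y) - c * q =
      (1 + c) / 2 * (Fp - q) - (1 - c) / 2 * (Fm - q) := by linarith
  have h4 : |(A *ᵥ X) ⬝ᵥ (A *ᵥ Y) - c * q| ≤ δ := by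
    rw [h3]
    refine (abs_sub _ _).trans ?_
    rw [abs_mul, abs_mul, abs_of_nonneg (by linarith : 0 ≤ (1 + c) / 2),
      abs_of_nonneg (by linarith : 0 ≤ (1 - c) / 2)]
    have h5 := mul_le_mul_of_nonneg_left hp (by linarith : 0 ≤ (1 + c) / 2)
    have h6 := mul_le_mul_of_nonneg_left hm (by linarith : 0 ≤ (1 - c) / 2)
    linarith
  have h7 : (A *ᵥ x) ⬝ᵥ (A *ᵥ y) - (x ⬝ᵥ y) * q =
      (√(x ⬝ᵥ x) * √(y ⬝ᵥ y)) * ((A *ᵥ X) ⬝ᵥ (A *ᵥ Y) - c * q) := by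
    have hx : A *ᵥ x = √(x ⬝ᵥ x) • (A *ᵥ X) := by rw [← Matrix.mulVec_smul, smul_unitize]
    have hy : A *ᵥ y = √(y ⬝ᵥ y) • (A *ᵥ Y) := by rw [← Matrix.mulVec_smul, smul_unitize]
    have hxy : x ⬝ᵥ y = √(x ⬝ᵥ x) * (√(y ⬝ᵥ y) * c) := by
      have : x ⬝ᵥ y = (√(x ⬝ᵥ x) • X) ⬝ᵥ (√(y ⬝ᵥ y) • Y) := by rw [smul_unitize, smul_unitize]
      rw [this, smul_dotProduct, dotProduct_smul]; rfl
    rw [hx, hy, hxy, smul_dotProduct, dotProduct_smul]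
    simp only [smul_eq_mul]
    ring
  rw [h7, abs_mul, abs_of_nonneg (by positivity), mul_comm δ]
  exact mul_le_mul_of_nonneg_left h4 (by positivity)

end Unitize

/-! ### The standardized sample and its good event -/

section Sample

variable {ι ι₁ ι₂ : Type*} [Fintype ι] [Fintype ι₁] [Fintype ι₂]
  [DecidableEq ι] [DecidableEq ι₁] [DecidableEq ι₂]

/-- Error of the least-squares coefficients of the second block, as a function of the first block
`p.1` and of the second block together with the noise `p.2`. -/
noncomputable def secondErr (σ : ℝ) (p : (ι₁ → ι → ℝ) × (ι₂ ⊕ Unit → ι → ℝ)) : ι₂ → ℝ :=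
  σ • (coef (Matrix.of (fun c => p.2 (Sum.inl c)) * resid (Matrix.of p.1)) *ᵥ
    (resid (Matrix.of p.1) *ᵥ p.2 (Sum.inr ())))

/-- Weights of the residual of the full regression, projected on the first block. -/
noncomputable def fullWeights (σ : ℝ) (p : (ι₁ → ι → ℝ) × (ι₂ ⊕ Unit → ι → ℝ)) :
    ι₂ ⊕ Unit → ℝ := Sum.elim (-(secondErr σ p)) (fun _ => σ)

/-- Weights of the residual of the regression on the first block. -/
def blockWeights (σ : ℝ) (b : ι₂ → ℝ) : ι₂ ⊕ Unit → ℝ := Sum.elim b (fun _ => σ)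

/-- Weights of the response. -/
def respWeights (σ : ℝ) (a : ι₁ → ℝ) (b : ι₂ → ℝ) : (ι₁ ⊕ ι₂) ⊕ Unit → ℝ :=
  Sum.elim (Sum.elim a b) (fun _ => σ)

/-- First block and remaining rows of the sample. -/
def firstRest (G : (ι₁ ⊕ ι₂) ⊕ Unit → ι → ℝ) : (ι₁ → ι → ℝ) × (ι₂ ⊕ Unit → ι → ℝ) :=
  (fun c => G (Sum.inl (Sum.inl c)),
    Sum.elim (fun c => G (Sum.inl (Sum.inr c))) (fun _ => G (Sum.inr ())))

/-- Regressors and noise of the sample. -/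
def designNoise (G : (ι₁ ⊕ ι₂) ⊕ Unit → ι → ℝ) : (ι₁ ⊕ ι₂ → ι → ℝ) × (ι → ℝ) :=
  (fun c => G (Sum.inl c), G (Sum.inr ()))

omit [DecidableEq ι] [DecidableEq ι₁] [DecidableEq ι₂] in
theorem measurePreserving_designNoise :
    MeasurePreserving (designNoise (ι := ι) (ι₁ := ι₁) (ι₂ := ι₂))
      (stdM ((ι₁ ⊕ ι₂) ⊕ Unit) ι) ((stdM (ι₁ ⊕ ι₂) ι).prod (stdG ι)) :=
  ((MeasurePreserving.id _).prod
    (measurePreserving_eval (fun _ : Unit => stdG ι) ())).comp measurePreserving_sum_split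

omit [DecidableEq ι] [DecidableEq ι₁] [DecidableEq ι₂] in
theorem measurePreserving_firstRest :
    MeasurePreserving (firstRest (ι := ι) (ι₁ := ι₁) (ι₂ := ι₂))
      (stdM ((ι₁ ⊕ ι₂) ⊕ Unit) ι) ((stdM ι₁ ι).prod (stdM (ι₂ ⊕ Unit) ι)) := by
  have h := measurePreserving_piCongrLeft (fun _ : ι₁ ⊕ (ι₂ ⊕ Unit) => stdG ι)
    (Equiv.sumAssoc ι₁ ι₂ Unit)
  have h2 := (measurePreserving_sum_split (κ := ι₁) (κ' := ι₂ ⊕ Unit) (ι := ι)).comp h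
  convert! h2 using 1
  ext G
  · rfl
  · rename_i c i
    rcases c with c | c <;> rfl

theorem measurable_secondErr (σ : ℝ) :
    Measurable (secondErr (ι := ι) (ι₁ := ι₁) (ι₂ := ι₂) σ) := by
  unfold secondErr
  have h1 : Measurable fun p : (ι₁ → ι → ℝ) × (ι₂ ⊕ Unit → ι → ℝ) =>
      resid (Matrix.of p.1) := by fun_prop
  have h2 : Measurable fun p : (ι₁ → ι → ℝ) × (ι₂ ⊕ Unit → ι → ℝ) =>
      Matrix.of (fun c => p.2 (Sum.inl c)) := measurable_matrix_of (by fun_prop)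
  have h3 : Measurable fun p : (ι₁ → ι → ℝ) × (ι₂ ⊕ Unit → ι → ℝ) =>
      p.2 (Sum.inr ()) := by fun_prop
  exact (measurable_mulVec (measurable_coef (measurable_matrix_mul h2 h1))
    (measurable_mulVec h1 h3)).const_smul σ

theorem measurable_fullWeights (σ : ℝ) :
    Measurable (fullWeights (ι := ι) (ι₁ := ι₁) (ι₂ := ι₂) σ) := by
  refine measurable_pi_iff.2 fun c => ?_
  rcases c with c | c
  · exact ((measurable_pi_apply c).comp (measurable_secondErr σ)).neg
  · exact measurable_const

/-- By Frisch–Waugh–Lovell the second-block error sees the second block and the noise only after the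
first block has been projected out. This is the hypothesis that decoupling requires of the weights.
-/
theorem secondErr_congr (σ : ℝ) (C : ι₁ → ι → ℝ) (W W' : ι₂ ⊕ Unit → ι → ℝ)
    (h : ∀ k, resid (Matrix.of C) *ᵥ W k = resid (Matrix.of C) *ᵥ W' k) :
    secondErr σ (C, W) = secondErr σ (C, W') := by
  have h1 : ∀ W : ι₂ ⊕ Unit → ι → ℝ, Matrix.of (fun c => W (Sum.inl c)) * resid (Matrix.of C)
      = Matrix.of (fun c => resid (Matrix.of C) *ᵥ W (Sum.inl c)) := by
    intro W
    ext c i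
    have : (resid (Matrix.of C) *ᵥ W (Sum.inl c)) i = (W (Sum.inl c) ᵥ* resid (Matrix.of C)) i := by
      rw [← Matrix.mulVec_transpose, resid_transpose]
    rw [Matrix.of_apply, this]
    rfl
  unfold secondErr
  simp only [h1, h]

/-- The event on which all sample quantities are close to their population values. -/
structure Good (σ τ : ℝ) (a : ι₁ → ℝ) (b : ι₂ → ℝ) (n k k₁ : ℝ)
    (G : (ι₁ ⊕ ι₂) ⊕ Unit → ι → ℝ) : Prop where
  li : LinearIndependent ℝ (designNoise G).1
  rss : |(designNoise G).2 ⬝ᵥ (resid (Matrix.of (designNoise G).1) *ᵥ (designNoise G).2) - (n - k)|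
    ≤ τ * (n - k)
  rss₁ : |(blockWeights σ b ᵥ* Matrix.of (firstRest G).2) ⬝ᵥ (resid (Matrix.of (firstRest G).1) *ᵥ
    (blockWeights σ b ᵥ* Matrix.of (firstRest G).2))
      - (blockWeights σ b ⬝ᵥ blockWeights σ b) * (n - k₁)|
    ≤ τ * ((blockWeights σ b ⬝ᵥ blockWeights σ b) * (n - k₁))
  tss : |(respWeights σ a b ᵥ* Matrix.of G) ⬝ᵥ (respWeights σ a b ᵥ* Matrix.of G)
      - (respWeights σ a b ⬝ᵥ respWeights σ a b) * n|
    ≤ τ * ((respWeights σ a b ⬝ᵥ respWeights σ a b) * n)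
  coef_normSq : |(coef (Matrix.of (designNoise G).1) *ᵥ (designNoise G).2) ⬝ᵥ
      (coef (Matrix.of (designNoise G).1) *ᵥ (designNoise G).2) - k / (n - k + 1)|
    ≤ 3 * τ * (n / (n - k + 1))
  coef_normSq₁ : |(coef (Matrix.of (firstRest G).1) *ᵥ
        (blockWeights σ b ᵥ* Matrix.of (firstRest G).2)) ⬝ᵥ (coef (Matrix.of (firstRest G).1) *ᵥ
        (blockWeights σ b ᵥ* Matrix.of (firstRest G).2))
      - (blockWeights σ b ⬝ᵥ blockWeights σ b) * (k₁ / (n - k₁ + 1))|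
    ≤ (blockWeights σ b ⬝ᵥ blockWeights σ b) * (3 * τ * (n / (n - k₁ + 1)))
  cross : |(coef (Matrix.of (firstRest G).1) *ᵥ
        (fullWeights σ (firstRest G) ᵥ* Matrix.of (firstRest G).2)) ⬝ᵥ
        (coef (Matrix.of (firstRest G).1) *ᵥ
        (blockWeights σ b ᵥ* Matrix.of (firstRest G).2))
      - (fullWeights σ (firstRest G) ⬝ᵥ blockWeights σ b) * (k₁ / (n - k₁ + 1))|
    ≤ 3 * τ * (n / (n - k₁ + 1)) * (√(fullWeights σ (firstRest G) ⬝ᵥ fullWeights σ (firstRest G))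
      * √(blockWeights σ b ⬝ᵥ blockWeights σ b))
  linear₁ : |a ⬝ᵥ (coef (Matrix.of (firstRest G).1) *ᵥ
        (blockWeights σ b ᵥ* Matrix.of (firstRest G).2))|
    ≤ τ * √(a ⬝ᵥ a) * √(blockWeights σ b ⬝ᵥ blockWeights σ b)
  linear : |Sum.elim a b ⬝ᵥ (coef (Matrix.of (designNoise G).1) *ᵥ (designNoise G).2)|
    ≤ τ * √(Sum.elim a b ⬝ᵥ Sum.elim a b)
  linear₂ : |Sum.elim (0 : ι₁ → ℝ) b ⬝ᵥ (coef (Matrix.of (designNoise G).1) *ᵥ (designNoise G).2)|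
    ≤ τ * √(Sum.elim (0 : ι₁ → ℝ) b ⬝ᵥ Sum.elim (0 : ι₁ → ℝ) b)

/-- Uses only the inequality between a measure and its push-forward that holds for every set, so
neither `S` nor `T` need be measurable. -/
theorem measure_preimage_le_of_le {X Y : Type*} [MeasurableSpace X] [MeasurableSpace Y]
    {μ : Measure X} {ν : Measure Y} {f : X → Y} (hf : MeasurePreserving f μ ν) {S : Set X}
    {T : Set Y} (hST : S ⊆ f ⁻¹' T) {b : ℝ≥0∞} (hT : ν T ≤ b) : μ S ≤ b := by
  refine (measure_mono hST).trans ((Measure.le_map_apply hf.measurable.aemeasurable T).trans ?_)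
  rwa [hf.map_eq]

end Sample


section Sample

variable {ι ι₁ ι₂ : Type*} [Fintype ι] [Fintype ι₁] [Fintype ι₂]
  [DecidableEq ι] [DecidableEq ι₁] [DecidableEq ι₂]

theorem exp_neg_le_exp_neg {m m' τ : ℝ} (h : m ≤ m') :
    Real.exp (-(m' * τ ^ 2 / (21 / 5))) ≤ Real.exp (-(m * τ ^ 2 / (21 / 5))) := by
  apply Real.exp_le_exp.2
  rw [neg_le_neg_iff]
  exact div_le_div_of_nonneg_right (mul_le_mul_of_nonneg_right h (sq_nonneg τ)) (by norm_num)

theorem resid_rel_tail {κ : Type*} [Fintype κ] [DecidableEq κ] {n k m τ : ℝ}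
    (hn : n = Fintype.card ι) (hk : k = Fintype.card κ) (hm : m ≤ n - k) (hm0 : 0 < m)
    (hτ0 : 0 ≤ τ) (hτ : τ ≤ 1 / 20) :
    ((stdM κ ι).prod (stdG ι)) {p | τ * (n - k) <
        |p.2 ⬝ᵥ (resid (Matrix.of p.1) *ᵥ p.2) - (n - k)|}
      ≤ ENNReal.ofReal (2 * Real.exp (-(m * τ ^ 2 / (21 / 5)))) := by
  have hkn : Fintype.card κ ≤ Fintype.card ι := by
    have : (Fintype.card κ : ℝ) ≤ Fintype.card ι := by rw [← hn, ← hk]; linarith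
    exact_mod_cast this
  refine prod_measure_le ?_ ?_
  · refine measurableSet_lt measurable_const ?_
    exact ((by fun_prop : Measurable fun p : (κ → ι → ℝ) × (ι → ℝ) =>
      p.2 ⬝ᵥ (resid (Matrix.of p.1) *ᵥ p.2)).sub_const _).abs
  · filter_upwards [ae_linearIndependent hkn] with C hC
    refine le_trans (measure_mono ?_) ((resid_tail (isUnit_det_gram hC) (p := n - k)
      (x := τ * (n - k)) (by rw [hn, hk]) (by linarith)
      (mul_nonneg hτ0 (by linarith))).trans (ENNReal.ofReal_le_ofReal
        (mul_le_mul_of_nonneg_left (exp_tail_le (by linarith) hm hτ0 hτ) (by norm_num))))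
    intro w hw
    simp only [Set.mem_preimage, Set.mem_ofPred_eq] at hw ⊢
    exact hw.le

omit [DecidableEq ι] [DecidableEq ι₁] [DecidableEq ι₂] in
theorem measurePreserving_first_unit (u : ι₂ ⊕ Unit → ℝ) (hu : u ⬝ᵥ u = 1) :
    MeasurePreserving (fun G : (ι₁ ⊕ ι₂) ⊕ Unit → ι → ℝ =>
      ((firstRest G).1, u ᵥ* Matrix.of (firstRest G).2))
      (stdM ((ι₁ ⊕ ι₂) ⊕ Unit) ι) ((stdM ι₁ ι).prod (stdG ι)) :=
  ((MeasurePreserving.id _).prod (measurePreserving_vecMul (ι := ι) u hu)).comp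
    measurePreserving_firstRest

theorem vecMul_smul_unit {κ α : Type*} [Fintype κ] {u e : κ → ℝ} {r : ℝ} (h : u = r • e)
    (A : Matrix κ α ℝ) : u ᵥ* A = r • (e ᵥ* A) := by
  rw [h, Matrix.smul_vecMul]

theorem quad_smul {κ : Type*} [Fintype κ] (r : ℝ) (x y : κ → ℝ) :
    (r • x) ⬝ᵥ (r • y) = r ^ 2 * (x ⬝ᵥ y) := by
  rw [smul_dotProduct, dotProduct_smul]; simp only [smul_eq_mul]; ring

/-- Union bound after scaling all fixed weight vectors to unit length. Rank failure costs nothing,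
the three sums of squares cost 2 each, and the other seven events cost 4 each: two squared
coefficient lengths, two polarization directions for the cross term, three linear functionals. The
total is 34. -/
theorem good_compl_le [Nonempty ι₁] {σ τ : ℝ} (hσ : 0 < σ) (a : ι₁ → ℝ) (b : ι₂ → ℝ) {n k k₁ : ℝ}
    (hn : n = Fintype.card ι) (hk : k = Fintype.card (ι₁ ⊕ ι₂)) (hk₁ : k₁ = Fintype.card ι₁)
    (hkn : k < n) (hτ0 : 0 ≤ τ) (hτ : τ ≤ 1 / 20) (hkτ : k + τ * n ≤ n) :
    (stdM ((ι₁ ⊕ ι₂) ⊕ Unit) ι) {G | ¬ Good σ τ a b n k k₁ G}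
      ≤ ENNReal.ofReal (34 * Real.exp (-((n - k) * τ ^ 2 / (21 / 5)))) := by
  have hk₁k : k₁ ≤ k := by
    rw [hk, hk₁, Fintype.card_sum]; push_cast; linarith [Nat.cast_nonneg (α := ℝ) (Fintype.card ι₂)]
  have hk0 : 0 ≤ k := by rw [hk]; positivity
  have hn0 : 0 < n := by linarith
  have hkn' : Fintype.card (ι₁ ⊕ ι₂) ≤ Fintype.card ι := by
    have : (Fintype.card (ι₁ ⊕ ι₂) : ℝ) ≤ Fintype.card ι := by rw [← hn, ← hk]; linarith
    exact_mod_cast this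
  set E := Real.exp (-((n - k) * τ ^ 2 / (21 / 5))) with hE
  have hE0 : 0 < E := Real.exp_pos _
  have hE1 : Real.exp (-((n - k₁) * τ ^ 2 / (21 / 5))) ≤ E := exp_neg_le_exp_neg (by linarith)
  set μ := stdM ((ι₁ ⊕ ι₂) ⊕ Unit) ι with hμ
  -- unit versions of the weight vectors
  have hbw : blockWeights σ b ≠ 0 := fun h => hσ.ne' (congrFun h (Sum.inr ()))
  have hrw : respWeights σ a b ≠ 0 := fun h => hσ.ne' (congrFun h (Sum.inr ()))
  obtain ⟨r, e, hr, hre, he, hr2⟩ := exists_unit_smul hbw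
  obtain ⟨r', e', hr', hre', he', hr2'⟩ := exists_unit_smul hrw
  have hsq : √(blockWeights σ b ⬝ᵥ blockWeights σ b) = r := by rw [← hr2, Real.sqrt_sq hr.le]
  have he0 : (Pi.single (Sum.inr ()) 1 : ι₂ ⊕ Unit → ℝ) ⬝ᵥ Pi.single (Sum.inr ()) 1 = 1 := by simp
  set e₀ : ι₂ ⊕ Unit → ℝ := Pi.single (Sum.inr ()) 1
  have hfw : Measurable (fullWeights (ι := ι) (ι₁ := ι₁) (ι₂ := ι₂) σ) := measurable_fullWeights σ
  have hfwc : ∀ (C : ι₁ → ι → ℝ) (W W' : ι₂ ⊕ Unit → ι → ℝ),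
      (∀ k, resid (Matrix.of C) *ᵥ W k = resid (Matrix.of C) *ᵥ W' k) →
      fullWeights σ (C, W) = fullWeights σ (C, W') := by
    intro C W W' h
    unfold fullWeights
    rw [secondErr_congr σ C W W' h]
  -- the exceptional sets
  let Ali : Set ((ι₁ ⊕ ι₂) ⊕ Unit → ι → ℝ) := {G | ¬ LinearIndependent ℝ (designNoise G).1}
  let Arss : Set ((ι₁ ⊕ ι₂) ⊕ Unit → ι → ℝ) := {G | τ * (n - k) <
    |(designNoise G).2 ⬝ᵥ (resid (Matrix.of (designNoise G).1) *ᵥ (designNoise G).2) - (n - k)|}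
  let Arss₁ : Set ((ι₁ ⊕ ι₂) ⊕ Unit → ι → ℝ) := {G | τ * (n - k₁) <
    |(e ᵥ* Matrix.of (firstRest G).2) ⬝ᵥ (resid (Matrix.of (firstRest G).1) *ᵥ
      (e ᵥ* Matrix.of (firstRest G).2)) - (n - k₁)|}
  let Atss : Set ((ι₁ ⊕ ι₂) ⊕ Unit → ι → ℝ) := {G | τ * n <
    |(e' ᵥ* Matrix.of G) ⬝ᵥ (e' ᵥ* Matrix.of G) - n|}
  let Anrm : Set ((ι₁ ⊕ ι₂) ⊕ Unit → ι → ℝ) := {G | 3 * τ * (n / (n - k + 1)) ≤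
    |(coef (Matrix.of (designNoise G).1) *ᵥ (designNoise G).2) ⬝ᵥ
      (coef (Matrix.of (designNoise G).1) *ᵥ (designNoise G).2) - k / (n - k + 1)|}
  let Anrm₁ : Set ((ι₁ ⊕ ι₂) ⊕ Unit → ι → ℝ) := {G | 3 * τ * (n / (n - k₁ + 1)) ≤
    |(coef (Matrix.of (firstRest G).1) *ᵥ (e ᵥ* Matrix.of (firstRest G).2)) ⬝ᵥ
      (coef (Matrix.of (firstRest G).1) *ᵥ (e ᵥ* Matrix.of (firstRest G).2)) - k₁ / (n - k₁ + 1)|}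
  -- The normalized sum and difference of the two weight vectors, as required by
  -- `abs_dotProduct_sub_le`. They inherit from `fullWeights` the dependence on residuals only.
  let cp : (ι₁ → ι → ℝ) × (ι₂ ⊕ Unit → ι → ℝ) → ι₂ ⊕ Unit → ℝ := fun p =>
    unitize e₀ (unitize e₀ (fullWeights σ p) + unitize e₀ (blockWeights σ b))
  let cm : (ι₁ → ι → ℝ) × (ι₂ ⊕ Unit → ι → ℝ) → ι₂ ⊕ Unit → ℝ := fun p =>
    unitize e₀ (unitize e₀ (fullWeights σ p) - unitize e₀ (blockWeights σ b))
  let Apol (c : (ι₁ → ι → ℝ) × (ι₂ ⊕ Unit → ι → ℝ) → ι₂ ⊕ Unit → ℝ) :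
    Set ((ι₁ ⊕ ι₂) ⊕ Unit → ι → ℝ) := {G | 3 * τ * (n / (n - k₁ + 1)) ≤
      |(coef (Matrix.of (firstRest G).1) *ᵥ (c (firstRest G) ᵥ* Matrix.of (firstRest G).2)) ⬝ᵥ
        (coef (Matrix.of (firstRest G).1) *ᵥ (c (firstRest G) ᵥ* Matrix.of (firstRest G).2))
          - k₁ / (n - k₁ + 1)|}
  let Alin₁ : Set ((ι₁ ⊕ ι₂) ⊕ Unit → ι → ℝ) := {G | τ * √(a ⬝ᵥ a) <
    |a ⬝ᵥ (coef (Matrix.of (firstRest G).1) *ᵥ (e ᵥ* Matrix.of (firstRest G).2))|}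
  let Alin (c : ι₁ ⊕ ι₂ → ℝ) : Set ((ι₁ ⊕ ι₂) ⊕ Unit → ι → ℝ) := {G | τ * √(c ⬝ᵥ c) <
    |c ⬝ᵥ (coef (Matrix.of (designNoise G).1) *ᵥ (designNoise G).2)|}
  have hAli : μ Ali = 0 := by
    have h := (Measure.quasiMeasurePreserving_fst.comp
      measurePreserving_designNoise.quasiMeasurePreserving).ae
      (ae_linearIndependent (κ := ι₁ ⊕ ι₂) (ι := ι) hkn')
    exact h
  have hArss : μ Arss ≤ ENNReal.ofReal (2 * E) :=
    measure_preimage_le_of_le measurePreserving_designNoise (fun G hG => hG)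
      (resid_rel_tail hn hk le_rfl (by linarith) hτ0 hτ)
  have hArss₁ : μ Arss₁ ≤ ENNReal.ofReal (2 * E) :=
    measure_preimage_le_of_le (measurePreserving_first_unit e he) (fun G hG => hG)
      (resid_rel_tail hn hk₁ (by linarith : n - k ≤ n - k₁) (by linarith) hτ0 hτ)
  have hAtss : μ Atss ≤ ENNReal.ofReal (2 * E) := by
    refine measure_preimage_le_of_le (measurePreserving_vecMul (ι := ι) e' he')
      (T := {w | τ * n ≤ |w ⬝ᵥ ((1 : Matrix ι ι ℝ) *ᵥ w) - n|}) (fun G hG => ?_) ?_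
    · simp only [Set.mem_preimage, Set.mem_ofPred_eq, Matrix.one_mulVec]
      exact le_of_lt hG
    · exact (quadForm_tail (M := (1 : Matrix ι ι ℝ)) Matrix.transpose_one (Matrix.mul_one 1)
        (by rw [Matrix.trace_one, hn]) hn0 (by positivity)).trans (ENNReal.ofReal_le_ofReal
        (mul_le_mul_of_nonneg_left (exp_tail_le hn0 (by linarith) hτ0 hτ) (by norm_num)))
  have hAnrm : μ Anrm ≤ ENNReal.ofReal (4 * E) :=
    measure_preimage_le_of_le measurePreserving_designNoise (fun G hG => hG)
      (coef_normSq_tail hn hk rfl rfl (by linarith) hτ0 hτ hkτ)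
  have h4 : ENNReal.ofReal (4 * Real.exp (-((n - k₁) * τ ^ 2 / (21 / 5))))
      ≤ ENNReal.ofReal (4 * E) := ENNReal.ofReal_le_ofReal (by linarith)
  have hAnrm₁ : μ Anrm₁ ≤ ENNReal.ofReal (4 * E) :=
    measure_preimage_le_of_le (measurePreserving_first_unit e he) (fun G hG => hG)
      ((coef_normSq_tail hn hk₁ rfl rfl (by linarith) hτ0 hτ (by linarith)).trans h4)
  have hApol : ∀ c : (ι₁ → ι → ℝ) × (ι₂ ⊕ Unit → ι → ℝ) → ι₂ ⊕ Unit → ℝ, Measurable c →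
      (∀ p, c p ⬝ᵥ c p = 1) → (∀ (C : ι₁ → ι → ℝ) (W W' : ι₂ ⊕ Unit → ι → ℝ),
      (∀ k, resid (Matrix.of C) *ᵥ W k = resid (Matrix.of C) *ᵥ W' k) → c (C, W) = c (C, W')) →
      μ (Apol c) ≤ ENNReal.ofReal (4 * E) := fun c h1 h2 h3 =>
    measure_preimage_le_of_le measurePreserving_firstRest (fun G hG => hG)
      ((coef_unit_tail hn hk₁ rfl rfl (by linarith) hτ0 hτ (by linarith) h1 h2 h3).trans h4)
  have hAcp := hApol cp (measurable_unitize _ ((measurable_unitize _ hfw).add_const _))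
    (fun p => unitize_dotProduct_self he0 _) (fun C W W' h => by simp only [cp, hfwc C W W' h])
  have hAcm := hApol cm (measurable_unitize _ ((measurable_unitize _ hfw).sub_const _))
    (fun p => unitize_dotProduct_self he0 _) (fun C W W' h => by simp only [cm, hfwc C W W' h])
  have hAlin₁ : μ Alin₁ ≤ ENNReal.ofReal (4 * E) :=
    measure_preimage_le_of_le (measurePreserving_first_unit e he) (fun G hG => hG)
      ((coef_linear_tail hn hk₁ rfl rfl (by linarith) hτ0 hτ a).trans h4)
  have hAlin : ∀ c, μ (Alin c) ≤ ENNReal.ofReal (4 * E) := fun c =>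
    measure_preimage_le_of_le measurePreserving_designNoise (fun G hG => hG)
      (coef_linear_tail hn hk rfl rfl (by linarith) hτ0 hτ c)
  have hsub : {G | ¬ Good σ τ a b n k k₁ G} ⊆ Ali ∪ (Arss ∪ (Arss₁ ∪ (Atss ∪ (Anrm ∪ (Anrm₁ ∪
      (Apol cp ∪ (Apol cm ∪ (Alin₁ ∪ (Alin (Sum.elim a b) ∪ Alin (Sum.elim 0 b)))))))))) := by
    intro G hG
    by_contra hcon
    simp only [Set.mem_union, not_or] at hcon
    obtain ⟨h0, h1, h2, h3, h4, h5, h6, h7, h8, h9, h10⟩ := hcon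
    simp only [Ali, Arss, Arss₁, Atss, Anrm, Anrm₁, Apol, cp, cm, Alin₁, Alin, Set.mem_ofPred_eq,
      not_not, not_lt, not_le] at h0 h1 h2 h3 h4 h5 h6 h7 h8 h9 h10
    apply hG
    refine ⟨h0, h1, ?_, ?_, h4.le, ?_, ?_, ?_, h9, h10⟩
    · have h2' := h2
      rw [vecMul_smul_unit hre, Matrix.mulVec_smul, quad_smul, ← hr2, ← mul_sub, abs_mul,
        abs_of_pos (by positivity)]
      have := mul_le_mul_of_nonneg_left h2' (by positivity : 0 ≤ r ^ 2)
      linarith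
    · have h3' := h3
      rw [vecMul_smul_unit hre', quad_smul, ← hr2', ← mul_sub, abs_mul,
        abs_of_pos (by positivity)]
      have := mul_le_mul_of_nonneg_left h3' (by positivity : 0 ≤ r' ^ 2)
      linarith
    · have h5' := h5.le
      rw [vecMul_smul_unit hre, Matrix.mulVec_smul, quad_smul, ← hr2, ← mul_sub, abs_mul,
        abs_of_pos (by positivity)]
      exact mul_le_mul_of_nonneg_left h5' (by positivity : 0 ≤ r ^ 2)
    · have h := abs_dotProduct_sub_le he0 (fullWeights σ (firstRest G)) (blockWeights σ b)
        (coef (Matrix.of (firstRest G).1) * (Matrix.of (firstRest G).2)ᵀ)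
        (q := k₁ / (n - k₁ + 1)) (δ := 3 * τ * (n / (n - k₁ + 1)))
        (by
          have := h6.le
          simpa only [← Matrix.mulVec_mulVec, Matrix.mulVec_transpose] using this)
        (by
          have := h7.le
          simpa only [← Matrix.mulVec_mulVec, Matrix.mulVec_transpose] using this)
      simpa only [← Matrix.mulVec_mulVec, Matrix.mulVec_transpose] using h
    · have h8' := h8
      rw [vecMul_smul_unit hre, Matrix.mulVec_smul, dotProduct_smul, hsq, smul_eq_mul, abs_mul,
        abs_of_pos hr, mul_comm r]
      exact mul_le_mul_of_nonneg_right h8' hr.le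
  refine (measure_mono hsub).trans ?_
  have hsum : ENNReal.ofReal (34 * E) = 0 + (ENNReal.ofReal (2 * E) + (ENNReal.ofReal (2 * E) +
      (ENNReal.ofReal (2 * E) + (ENNReal.ofReal (4 * E) + (ENNReal.ofReal (4 * E) +
      (ENNReal.ofReal (4 * E) + (ENNReal.ofReal (4 * E) + (ENNReal.ofReal (4 * E) +
      (ENNReal.ofReal (4 * E) + ENNReal.ofReal (4 * E)))))))))) := by
    rw [zero_add]
    repeat rw [← ENNReal.ofReal_add (by positivity) (by positivity)]
    congr 1; ring
  rw [hsum]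
  refine (measure_union_le _ _).trans (add_le_add hAli.le ?_)
  refine (measure_union_le _ _).trans (add_le_add hArss ?_)
  refine (measure_union_le _ _).trans (add_le_add hArss₁ ?_)
  refine (measure_union_le _ _).trans (add_le_add hAtss ?_)
  refine (measure_union_le _ _).trans (add_le_add hAnrm ?_)
  refine (measure_union_le _ _).trans (add_le_add hAnrm₁ ?_)
  refine (measure_union_le _ _).trans (add_le_add hAcp ?_)
  refine (measure_union_le _ _).trans (add_le_add hAcm ?_)
  refine (measure_union_le _ _).trans (add_le_add hAlin₁ ?_)
  exact (measure_union_le _ _).trans (add_le_add (hAlin _) (hAlin _))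

end Sample


/-! ### Deterministic comparison of both errors with their common target -/

section Scalar

/-- Population counterpart of the prediction error, for given shrinkage factors `x₁`, `x₂`. -/
def target (s t₁ t₂ q qm x₁ x₂ : ℝ) : ℝ :=
  s * (1 + (1 - x₂) ^ 2 * (qm - q) + (1 - x₁) ^ 2 * q) + t₂ * (x₂ ^ 2 + (x₂ - x₁) ^ 2 * q)
    + t₁ * x₁ ^ 2

variable {s t₁ t₂ q qm x₁ x₂ η K τ : ℝ}

theorem le_target (hs : 0 ≤ s) (ht₂ : 0 ≤ t₂) (hq : 0 ≤ q) (hqm : q ≤ qm) :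
    s + t₂ * x₂ ^ 2 + t₁ * x₁ ^ 2 ≤ target s t₁ t₂ q qm x₁ x₂ := by
  unfold target
  have h1 : 0 ≤ s * ((1 - x₂) ^ 2 * (qm - q)) :=
    mul_nonneg hs (mul_nonneg (sq_nonneg _) (by linarith))
  have h2 : 0 ≤ s * ((1 - x₁) ^ 2 * q) := mul_nonneg hs (mul_nonneg (sq_nonneg _) hq)
  have h3 : 0 ≤ t₂ * ((x₂ - x₁) ^ 2 * q) := mul_nonneg ht₂ (mul_nonneg (sq_nonneg _) hq)
  linarith

/-- Both factors are nonnegative, so (x₂-x₁)² is at most the larger of x₁² and x₂². The target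
controls x₂²t₂ outright, and x₁²t₂ up to `K`. -/
theorem sq_sub_mul_le (hs : 0 < s) (ht₁ : 0 ≤ t₁) (ht₂ : 0 ≤ t₂) (hq : 0 ≤ q) (hqm : q ≤ qm)
    (hK : 1 ≤ K) (hx₁ : 0 ≤ x₁) (hx₂ : 0 ≤ x₂)
    (hKR : x₁ ^ 2 * t₂ ≤ K * target s t₁ t₂ q qm x₁ x₂) :
    (x₂ - x₁) ^ 2 * t₂ ≤ K * target s t₁ t₂ q qm x₁ x₂ := by
  have hR := le_target (t₁ := t₁) (x₁ := x₁) (x₂ := x₂) hs.le ht₂ hq hqm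
  have h0 : 0 ≤ t₁ * x₁ ^ 2 := by positivity
  have h0' : 0 ≤ t₂ * x₂ ^ 2 := by positivity
  rcases le_total x₁ x₂ with h | h
  · have h1 : (x₂ - x₁) ^ 2 ≤ x₂ ^ 2 := by nlinarith
    have h2 := mul_le_mul_of_nonneg_right h1 ht₂
    nlinarith
  · have h1 : (x₂ - x₁) ^ 2 ≤ x₁ ^ 2 := by nlinarith
    exact (mul_le_mul_of_nonneg_right h1 ht₂).trans hKR

-- The empirical error is linear in its three variance estimators and equals the target at their
-- population values. The relative errors thus enter multiplied by coefficients of the target: s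
-- times either bracket is at most R/η, and t₂ times the second is at most KR. The five resulting
-- summands, each at most KR/η², give the factor 5.
set_option maxHeartbeats 400000 in
theorem rhoHat_close (hs : 0 < s) (ht₁ : 0 ≤ t₁) (ht₂ : 0 ≤ t₂) (hq : 0 ≤ q) (hqm : q ≤ qm)
    (hη : 0 < η) (hη1 : η ≤ 1) (hqη : 1 + qm ≤ 1 / η) (hK : 1 ≤ K) (hτ : 0 ≤ τ)
    (hx₁ : 0 ≤ x₁) (hx₁' : x₁ ≤ 1) (hx₂ : 0 ≤ x₂) (hx₂' : x₂ ≤ 1)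
    (hKR : x₁ ^ 2 * t₂ ≤ K * target s t₁ t₂ q qm x₁ x₂) {sh s₁h yy : ℝ}
    (hsh : |sh - s| ≤ τ * s) (hs₁h : |s₁h - (s + t₂)| ≤ τ * (s + t₂))
    (hyy : |yy - (s + t₂ + t₁)| ≤ τ * (s + t₂ + t₁)) :
    |sh * ((1 - x₂) ^ 2 * (1 + qm) + 2 * (1 - x₂) * (x₂ - x₁) * (1 + q) + 2 * (1 - x₂) * x₁)
        + s₁h * ((x₂ - x₁) ^ 2 * (1 + q) + 2 * (x₂ - x₁) * x₁) + yy * x₁ ^ 2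
      - target s t₁ t₂ q qm x₁ x₂| ≤ 5 * (τ * K / η ^ 2) * target s t₁ t₂ q qm x₁ x₂ := by
  have hR := le_target (t₁ := t₁) (x₁ := x₁) (x₂ := x₂) hs.le ht₂ hq hqm
  set R := target s t₁ t₂ q qm x₁ x₂ with hRdef
  have h0 : 0 ≤ t₁ * x₁ ^ 2 := by positivity
  have h0' : 0 ≤ t₂ * x₂ ^ 2 := by positivity
  have hR0 : 0 < R := by linarith
  set B₁ := (1 - x₂) ^ 2 * (1 + qm) + 2 * (1 - x₂) * (x₂ - x₁) * (1 + q) + 2 * (1 - x₂) * x₁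
    with hB₁
  set B₂ := (x₂ - x₁) ^ 2 * (1 + q) + 2 * (x₂ - x₁) * x₁ with hB₂
  have hdec : sh * B₁ + s₁h * B₂ + yy * x₁ ^ 2 - R
      = (sh - s) * B₁ + (s₁h - (s + t₂)) * B₂ + (yy - (s + t₂ + t₁)) * x₁ ^ 2 := by
    rw [hRdef, hB₁, hB₂]; unfold target; ring
  have hη' : 1 ≤ 1 / η := by rw [le_div_iff₀ hη]; linarith
  have hRη : R ≤ R * (1 / η) := le_mul_of_one_le_right hR0.le hη'
  have hx12 : (x₂ - x₁) ^ 2 ≤ 1 := (sq_le_one_iff_abs_le_one _).2 (abs_le.2 ⟨by linarith, by linarith⟩)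
  have hx2 : x₂ ^ 2 ≤ 1 := pow_le_one₀ hx₂ hx₂'
  have hx1 : x₁ ^ 2 ≤ 1 := pow_le_one₀ hx₁ hx₁'
  have hY : x₂ ^ 2 + (x₂ - x₁) ^ 2 * q ≤ 1 / η := by
    have : (x₂ - x₁) ^ 2 * q ≤ q := mul_le_of_le_one_left hq hx12
    linarith
  have hY0 : 0 ≤ x₂ ^ 2 + (x₂ - x₁) ^ 2 * q := by positivity
  have hsR : s ≤ R := by linarith
  have hsη : s * (1 / η) ≤ R * (1 / η) := mul_le_mul_of_nonneg_right hsR (by positivity)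
  have hKRR : R ≤ K * R := le_mul_of_one_le_left hR0.le hK
  -- first bracket
  have hb1 : s * |B₁| ≤ R * (1 / η) := by
    rw [show s * |B₁| = |s * B₁| by rw [abs_mul, abs_of_pos hs], abs_le]
    have e1 : s * B₁ = s * (1 + (1 - x₂) ^ 2 * (qm - q) + (1 - x₁) ^ 2 * q)
        - s * (x₂ ^ 2 + (x₂ - x₁) ^ 2 * q) := by rw [hB₁]; ring
    have e2 : s * (x₂ ^ 2 + (x₂ - x₁) ^ 2 * q) ≤ s * (1 / η) := mul_le_mul_of_nonneg_left hY hs.le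
    have e3 : 0 ≤ s * (x₂ ^ 2 + (x₂ - x₁) ^ 2 * q) := mul_nonneg hs.le hY0
    have e4 : s * (1 + (1 - x₂) ^ 2 * (qm - q) + (1 - x₁) ^ 2 * q) ≤ R := by
      rw [hRdef]; unfold target
      have : 0 ≤ t₂ * (x₂ ^ 2 + (x₂ - x₁) ^ 2 * q) := by positivity
      linarith
    have e5 : 0 ≤ s * (1 + (1 - x₂) ^ 2 * (qm - q) + (1 - x₁) ^ 2 * q) := by
      have : 0 ≤ (1 - x₂) ^ 2 * (qm - q) := mul_nonneg (sq_nonneg _) (by linarith)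
      positivity
    constructor <;> linarith
  have hB2e : B₂ = x₂ ^ 2 + (x₂ - x₁) ^ 2 * q - x₁ ^ 2 := by rw [hB₂]; ring
  have hb2 : s * |B₂| ≤ R * (1 / η) := by
    refine le_trans (mul_le_mul_of_nonneg_left ?_ hs.le) hsη
    rw [abs_le, hB2e]
    have := sq_nonneg x₁
    constructor <;> linarith
  have hb3 : t₂ * |B₂| ≤ K * R := by
    rw [show t₂ * |B₂| = |t₂ * B₂| by rw [abs_mul, abs_of_nonneg ht₂], abs_le, hB2e, mul_sub]
    have e1 : t₂ * (x₂ ^ 2 + (x₂ - x₁) ^ 2 * q) ≤ R := by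
      rw [hRdef]; unfold target
      have h1 : 0 ≤ (1 - x₂) ^ 2 * (qm - q) := mul_nonneg (sq_nonneg _) (by linarith)
      have : 0 ≤ s * (1 + (1 - x₂) ^ 2 * (qm - q) + (1 - x₁) ^ 2 * q) := by positivity
      linarith
    have e2 : 0 ≤ t₂ * (x₂ ^ 2 + (x₂ - x₁) ^ 2 * q) := by positivity
    have e3 : 0 ≤ x₁ ^ 2 * t₂ := by positivity
    constructor <;> linarith
  have hb4 : (s + t₂ + t₁) * x₁ ^ 2 ≤ R + K * R := by
    have : s * x₁ ^ 2 ≤ s := mul_le_of_le_one_right hs.le hx1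
    linarith
  have hfin : |sh * B₁ + s₁h * B₂ + yy * x₁ ^ 2 - R|
      ≤ τ * (R * (1 / η) + (R * (1 / η) + K * R) + (R + K * R)) := by
    rw [hdec]
    refine (abs_add_three _ _ _).trans ?_
    rw [abs_mul, abs_mul, abs_mul, abs_of_nonneg (sq_nonneg x₁)]
    have f1 := mul_le_mul_of_nonneg_right hsh (abs_nonneg B₁)
    have f2 := mul_le_mul_of_nonneg_right hs₁h (abs_nonneg B₂)
    have f3 := mul_le_mul_of_nonneg_right hyy (sq_nonneg x₁)
    have g1 := mul_le_mul_of_nonneg_left hb1 hτ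
    have g2 := mul_le_mul_of_nonneg_left (add_le_add hb2 hb3) hτ
    have g3 := mul_le_mul_of_nonneg_left hb4 hτ
    linarith
  refine hfin.trans ?_
  have hη2 : 1 / η ≤ 1 / η ^ 2 := by
    exact one_div_le_one_div_of_le (by positivity) (pow_le_of_le_one hη.le hη1 two_ne_zero)
  have k1 : R * (1 / η) ≤ K * R * (1 / η ^ 2) :=
    mul_le_mul hKRR hη2 (by positivity) (by positivity)
  have k2 : K * R ≤ K * R * (1 / η ^ 2) := le_mul_of_one_le_right (by positivity) (by linarith)
  have k3 : R * (1 / η) + (R * (1 / η) + K * R) + (R + K * R) ≤ 5 * (K * R * (1 / η ^ 2)) := by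
    linarith
  calc _ ≤ τ * (5 * (K * R * (1 / η ^ 2))) := mul_le_mul_of_nonneg_left k3 hτ
    _ = _ := by ring

/-- The arithmetic–geometric mean inequality, in the form that absorbs linear terms into the target.
-/
theorem two_mul_le_of_sq {A B u v c : ℝ} (hu : 0 ≤ u) (hv : 0 ≤ v) (hA : A ^ 2 * u ≤ B)
    (hc : v ≤ c) : 2 * (|A| * (√u * √v)) ≤ B + c := by
  have h1 := two_mul_le_add_sq (|A| * √u) (√v)
  rw [mul_pow, sq_abs, Real.sq_sqrt hu, Real.sq_sqrt hv] at h1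
  linarith

/-- Each of the six deviations is bounded by τKR/η² times a constant; these are 3, 6, 9, 2, 2 and 2,
with sum 24. The factor 1/η² comes from the cross term, where 1/η arises once from its tail bound
and once from the length of the random weights. -/
theorem rho_close (hs : 0 < s) (ht₁ : 0 ≤ t₁) (ht₂ : 0 ≤ t₂) (hq : 0 ≤ q) (hqm : q ≤ qm)
    (hη : 0 < η) (hη1 : η ≤ 1) (hqη : 1 + qm ≤ 1 / η) (hK : 1 ≤ K) (hτ : 0 ≤ τ)
    (hτ' : τ ≤ 1 / 50)
    (hx₁ : 0 ≤ x₁) (hx₁' : x₁ ≤ 1) (hx₂ : 0 ≤ x₂) (hx₂' : x₂ ≤ 1)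
    (hKR : x₁ ^ 2 * t₂ ≤ K * target s t₁ t₂ q qm x₁ x₂) {D D₁ p l₁ l l₂ : ℝ}
    (hD0 : 0 ≤ D)
    (hD : |D - s * qm| ≤ 3 * τ * (1 / η) * s)
    (hD₁ : |D₁ - (s + t₂) * q| ≤ 3 * τ * (1 / η) * (s + t₂))
    (hp : |p - (s - l₂) * q| ≤ 3 * τ * (1 / η) * (√(s + D) * √(s + t₂)))
    (hl₂ : |l₂| ≤ τ * (√s * √t₂)) (hl : |l| ≤ τ * (√s * √(t₁ + t₂)))
    (hl₁ : |l₁| ≤ τ * (√t₁ * √(s + t₂))) :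
    |s + (1 - x₂) ^ 2 * D + (x₂ - x₁) ^ 2 * D₁ + x₁ ^ 2 * t₁ + x₂ ^ 2 * t₂
        + 2 * (1 - x₂) * (x₂ - x₁) * p - 2 * (1 - x₂) * x₁ * l - 2 * (1 - x₂) * (x₂ - x₁) * l₂
        - 2 * (x₂ - x₁) * x₁ * l₁
      - target s t₁ t₂ q qm x₁ x₂| ≤ 24 * (τ * K / η ^ 2) * target s t₁ t₂ q qm x₁ x₂ := by
  have hR := le_target (t₁ := t₁) (x₁ := x₁) (x₂ := x₂) hs.le ht₂ hq hqm
  have hd := sq_sub_mul_le hs ht₁ ht₂ hq hqm hK hx₁ hx₂ hKR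
  have hdec : s + (1 - x₂) ^ 2 * D + (x₂ - x₁) ^ 2 * D₁ + x₁ ^ 2 * t₁ + x₂ ^ 2 * t₂
        + 2 * (1 - x₂) * (x₂ - x₁) * p - 2 * (1 - x₂) * x₁ * l - 2 * (1 - x₂) * (x₂ - x₁) * l₂
        - 2 * (x₂ - x₁) * x₁ * l₁ - target s t₁ t₂ q qm x₁ x₂
      -- The centre (s - l₂)q of the cross term is itself random; its `l₂` part joins the linear
      -- term and turns the coefficient of `l₂` into 1 + q.
      = (1 - x₂) ^ 2 * (D - s * qm) + (x₂ - x₁) ^ 2 * (D₁ - (s + t₂) * q)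
        + 2 * (1 - x₂) * (x₂ - x₁) * (p - (s - l₂) * q)
        - 2 * (1 - x₂) * (x₂ - x₁) * (1 + q) * l₂ - 2 * (1 - x₂) * x₁ * l
        - 2 * (x₂ - x₁) * x₁ * l₁ := by
    unfold target; ring
  generalize target s t₁ t₂ q qm x₁ x₂ = R at *
  have h0 : 0 ≤ t₁ * x₁ ^ 2 := by positivity
  have h0' : 0 ≤ t₂ * x₂ ^ 2 := by positivity
  have hR0 : 0 < R := by linarith
  have hsR : s ≤ R := by linarith
  have hKRR : R ≤ K * R := le_mul_of_one_le_left hR0.le hK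
  have hη' : 1 ≤ 1 / η := by rw [le_div_iff₀ hη]; linarith
  have hx12 : (x₂ - x₁) ^ 2 ≤ 1 := (sq_le_one_iff_abs_le_one _).2 (abs_le.2 ⟨by linarith, by linarith⟩)
  rw [show 24 * (τ * K / η ^ 2) * R = τ * (24 * (1 / η * (1 / η * (K * R)))) by ring]
  generalize 1 / η = i at *
  have hi0 : 0 < i := by linarith
  have hF0 : 0 ≤ 1 - x₂ := by linarith
  have hF1 : 1 - x₂ ≤ 1 := by linarith
  have hds : (x₂ - x₁) ^ 2 * s ≤ R := (mul_le_of_le_one_left hs.le hx12).trans hsR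
  -- the six terms
  have T1 : |(1 - x₂) ^ 2 * (D - s * qm)| ≤ τ * (3 * (i * R)) := by
    rw [abs_mul, abs_of_nonneg (sq_nonneg _)]
    have h1 : (1 - x₂) ^ 2 ≤ 1 := by nlinarith
    calc (1 - x₂) ^ 2 * |D - s * qm| ≤ 1 * (3 * τ * i * s) :=
          mul_le_mul h1 hD (abs_nonneg _) zero_le_one
      _ ≤ 1 * (3 * τ * i * R) := by gcongr
      _ = _ := by ring
  have T2 : |(x₂ - x₁) ^ 2 * (D₁ - (s + t₂) * q)| ≤ τ * (3 * (i * (R + K * R))) := by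
    rw [abs_mul, abs_of_nonneg (sq_nonneg _)]
    calc (x₂ - x₁) ^ 2 * |D₁ - (s + t₂) * q| ≤ (x₂ - x₁) ^ 2 * (3 * τ * i * (s + t₂)) := by gcongr
      _ = 3 * τ * i * ((x₂ - x₁) ^ 2 * s + (x₂ - x₁) ^ 2 * t₂) := by ring
      _ ≤ 3 * τ * i * (R + K * R) := by gcongr
      _ = _ := by ring
  have T3 : |2 * (1 - x₂) * (x₂ - x₁) * (p - (s - l₂) * q)| ≤ τ * (9 * (i * (i * (K * R)))) := by
    -- From `1 + qm ≤ i` and `τ ≤ 1 / 50`: the factor is at most 1 + 3/50, rounded up so that the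
    -- square root below is exactly 3/2.
    have hDu : s + D ≤ 9 / 8 * i * s := by
      have := (abs_le.1 hD).2
      have h1 : s * (1 + qm) ≤ s * i := mul_le_mul_of_nonneg_left hqη hs.le
      have h2 : 3 * τ * i * s ≤ 3 * (1 / 50) * i * s := by gcongr
      have h3 : 0 ≤ i * s := by positivity
      linarith
    have h1 : |x₂ - x₁| * (√(s + D) * √(s + t₂)) ≤ 3 / 2 * (i * (K * R)) := by
      have e1 : |x₂ - x₁| * (√(s + D) * √(s + t₂))
          = √((x₂ - x₁) ^ 2 * ((s + D) * (s + t₂))) := by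
        rw [Real.sqrt_mul (sq_nonneg _), Real.sqrt_sq_eq_abs, Real.sqrt_mul (by positivity)]
      rw [e1]
      apply Real.sqrt_le_iff.2 ⟨by positivity, ?_⟩
      have e2 : (x₂ - x₁) ^ 2 * (s + t₂) ≤ 2 * (K * R) := by linarith
      calc (x₂ - x₁) ^ 2 * ((s + D) * (s + t₂)) = (s + D) * ((x₂ - x₁) ^ 2 * (s + t₂)) := by ring
        _ ≤ (9 / 8 * i * s) * (2 * (K * R)) := mul_le_mul hDu e2 (by positivity) (by positivity)
        _ ≤ (9 / 8 * i * (K * R)) * (2 * (K * R)) := by gcongr; linarith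
        _ = 9 / 4 * (i * (K * R) ^ 2) := by ring
        _ ≤ 9 / 4 * (i * (K * R) ^ 2) * i := le_mul_of_one_le_right (by positivity) hη'
        _ = _ := by ring
    rw [abs_mul, abs_mul, abs_mul, abs_two, abs_of_nonneg hF0]
    calc 2 * (1 - x₂) * |x₂ - x₁| * |p - (s - l₂) * q|
        ≤ 2 * 1 * |x₂ - x₁| * (3 * τ * i * (√(s + D) * √(s + t₂))) := by gcongr
      _ = 6 * τ * i * (|x₂ - x₁| * (√(s + D) * √(s + t₂))) := by ring
      _ ≤ 6 * τ * i * (3 / 2 * (i * (K * R))) := by gcongr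
      _ = _ := by ring
  have T4 : |2 * (1 - x₂) * (x₂ - x₁) * (1 + q) * l₂| ≤ τ * (i * (R + K * R)) := by
    have h1 := two_mul_le_of_sq (A := x₂ - x₁) ht₂ hs.le hd hsR
    have hqi : 1 + q ≤ i := by linarith
    rw [abs_mul, abs_mul, abs_mul, abs_mul, abs_two, abs_of_nonneg hF0,
      abs_of_nonneg (by linarith : 0 ≤ 1 + q)]
    calc 2 * (1 - x₂) * |x₂ - x₁| * (1 + q) * |l₂|
        ≤ 2 * 1 * |x₂ - x₁| * i * (τ * (√s * √t₂)) := by gcongr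
      _ = τ * i * (2 * (|x₂ - x₁| * (√t₂ * √s))) := by ring
      _ ≤ τ * i * (K * R + R) := by gcongr
      _ = _ := by ring
  have T5 : |2 * (1 - x₂) * x₁ * l| ≤ τ * (R + K * R) := by
    have hB : x₁ ^ 2 * (t₁ + t₂) ≤ (R - s) + K * R := by linarith
    have h1 := two_mul_le_of_sq (A := x₁) (by positivity) hs.le hB le_rfl
    rw [abs_mul, abs_mul, abs_mul, abs_two, abs_of_nonneg hF0]
    calc 2 * (1 - x₂) * |x₁| * |l| ≤ 2 * 1 * |x₁| * (τ * (√s * √(t₁ + t₂))) := by gcongr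
      _ = τ * (2 * (|x₁| * (√(t₁ + t₂) * √s))) := by ring
      _ ≤ τ * ((R - s) + K * R + s) := by gcongr
      _ = _ := by ring
  have T6 : |2 * (x₂ - x₁) * x₁ * l₁| ≤ τ * (R + K * R) := by
    have h1 := two_mul_le_add_sq (|x₂ - x₁| * √(s + t₂)) (x₁ * √t₁)
    rw [mul_pow, mul_pow, sq_abs, Real.sq_sqrt (by positivity), Real.sq_sqrt ht₁] at h1
    have h2 : (x₂ - x₁) ^ 2 * (s + t₂) + x₁ ^ 2 * t₁ ≤ R + K * R := by
      have : (x₂ - x₁) ^ 2 * s ≤ s := mul_le_of_le_one_left hs.le hx12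
      linarith
    rw [abs_mul, abs_mul, abs_mul, abs_two, abs_of_nonneg hx₁]
    calc 2 * |x₂ - x₁| * x₁ * |l₁| ≤ 2 * |x₂ - x₁| * x₁ * (τ * (√t₁ * √(s + t₂))) := by gcongr
      _ = τ * (2 * (|x₂ - x₁| * √(s + t₂)) * (x₁ * √t₁)) := by ring
      _ ≤ τ * (R + K * R) := by gcongr; linarith
  have hsum : |(1 - x₂) ^ 2 * (D - s * qm) + (x₂ - x₁) ^ 2 * (D₁ - (s + t₂) * q)
        + 2 * (1 - x₂) * (x₂ - x₁) * (p - (s - l₂) * q)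
        - 2 * (1 - x₂) * (x₂ - x₁) * (1 + q) * l₂ - 2 * (1 - x₂) * x₁ * l
        - 2 * (x₂ - x₁) * x₁ * l₁| ≤ τ * (3 * (i * R)) + τ * (3 * (i * (R + K * R)))
          + τ * (9 * (i * (i * (K * R)))) + τ * (i * (R + K * R)) + τ * (R + K * R)
          + τ * (R + K * R) := by
    refine (abs_sub _ _).trans (add_le_add ?_ T6)
    refine (abs_sub _ _).trans (add_le_add ?_ T5)
    refine (abs_sub _ _).trans (add_le_add ?_ T4)
    exact (abs_add_three _ _ _).trans (add_le_add (add_le_add T1 T2) T3)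
  rw [hdec]
  refine hsum.trans ?_
  have hKR0 : 0 ≤ K * R := by positivity
  have k1 : i * R ≤ i * (i * (K * R)) := by
    gcongr
    exact hKRR.trans (le_mul_of_one_le_left hKR0 hη')
  have k2 : i * (K * R) ≤ i * (i * (K * R)) :=
    mul_le_mul_of_nonneg_left (le_mul_of_one_le_left hKR0 hη') hi0.le
  have k3 : K * R ≤ i * (i * (K * R)) := le_trans (le_mul_of_one_le_left hKR0 hη') k2
  have k4 : 3 * (i * R) + 3 * (i * (R + K * R)) + 9 * (i * (i * (K * R))) + i * (R + K * R)
      + (R + K * R) + (R + K * R) ≤ 24 * (i * (i * (K * R))) := by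
    rw [mul_add i]; linarith
  calc _ = τ * (3 * (i * R) + 3 * (i * (R + K * R)) + 9 * (i * (i * (K * R))) + i * (R + K * R)
      + (R + K * R) + (R + K * R)) := by ring
    _ ≤ τ * (24 * (i * (i * (K * R)))) := mul_le_mul_of_nonneg_left k4 hτ

/-- Since 50c(1+ε) = ε, both (1+5c)/(1-24c) and (1+24c)/(1-5c) are at most 1+ε, and log(1+ε) < ε.
The bound c < 1/50 makes both errors positive, which excludes the value ∞. -/
theorem absLog_lt_of_close {R ρ ρh ε c : ℝ} (hR : 0 < R) (hε : 0 < ε)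
    (hc : c = ε / (50 * (1 + ε))) (h1 : |ρh - R| ≤ 5 * c * R) (h2 : |ρ - R| ≤ 24 * c * R) :
    absLog (ρh / ρ) < ENNReal.ofReal ε := by
  have hc0 : 0 < c := by rw [hc]; positivity
  have hcε : 50 * c * (1 + ε) = ε := by rw [hc]; field_simp
  have hc1 : c < 1 / 50 := by
    rw [hc, div_lt_div_iff₀ (by positivity) (by norm_num)]; linarith
  obtain ⟨a1, a2⟩ := abs_le.1 h1
  obtain ⟨b1, b2⟩ := abs_le.1 h2
  have hcR : 0 < c * R := mul_pos hc0 hR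
  have hcR1 : c * R < 1 / 50 * R := mul_lt_mul_of_pos_right hc1 hR
  have hρ : 0 < ρ := by linarith
  have hρh : 0 < ρh := by linarith
  have hkey : 50 * (c * R) + 50 * (c * R * ε) = ε * R := by
    have : (50 * c * (1 + ε)) * R = ε * R := by rw [hcε]
    linarith
  have hcRε : 0 < c * R * ε := mul_pos hcR hε
  have e1 : ρh ≤ (1 + ε) * ρ := by
    have : (1 + ε) * (R - 24 * c * R) ≤ (1 + ε) * ρ :=
      mul_le_mul_of_nonneg_left (by linarith) (by linarith)
    nlinarith
  have e2 : ρ ≤ (1 + ε) * ρh := by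
    have : (1 + ε) * (R - 5 * c * R) ≤ (1 + ε) * ρh :=
      mul_le_mul_of_nonneg_left (by linarith) (by linarith)
    nlinarith
  have hlog : Real.log (1 + ε) < ε := by
    have := Real.log_lt_sub_one_of_pos (by linarith : 0 < 1 + ε) (by linarith)
    linarith
  unfold absLog
  rw [if_pos (div_pos hρh hρ), ENNReal.ofReal_lt_ofReal_iff hε, abs_lt,
    Real.log_div hρh.ne' hρ.ne']
  have l1 := Real.log_le_log hρh e1
  have l2 := Real.log_le_log hρ e2
  rw [Real.log_mul (by linarith) hρ.ne'] at l1
  rw [Real.log_mul (by linarith) hρh.ne'] at l2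
  constructor <;> linarith

end Scalar


/-! ### Two-block regression algebra -/

section TwoBlock

variable {ι ι₁ ι₂ κ : Type*} [Fintype ι] [Fintype ι₁] [Fintype ι₂] [Fintype κ]
  [DecidableEq ι] [DecidableEq ι₁] [DecidableEq ι₂] [DecidableEq κ]

omit [DecidableEq ι] in
/-- Least-squares coefficients for the regressors `Cᵀ * L`. -/
theorem pinv_mul_transpose {C : Matrix κ ι ℝ} {L : Matrix κ κ ℝ} (hC : IsUnit (gram C).det)
    (hL : IsUnit L.det) {X : Matrix ι κ ℝ} (hX : X = Cᵀ * L) :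
    pinv (Xᵀ * X) * Xᵀ = L⁻¹ * coef C := by
  have hg : Xᵀ * X = Lᵀ * gram C * L := by
    rw [hX, Matrix.transpose_mul, Matrix.transpose_transpose, gram]
    simp only [Matrix.mul_assoc]
  have hLt : IsUnit Lᵀ.det := by rwa [Matrix.det_transpose]
  have hu : IsUnit (Xᵀ * X).det := by
    rw [hg, Matrix.det_mul, Matrix.det_mul]
    exact (hLt.mul hC).mul hL
  rw [pinv_eq_inv hu, hg, Matrix.mul_inv_rev, Matrix.mul_inv_rev, hX, Matrix.transpose_mul,
    Matrix.transpose_transpose, coef, Matrix.mul_assoc, Matrix.mul_assoc, ← Matrix.mul_assoc _ Lᵀ C,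
    Matrix.nonsing_inv_mul _ hLt, Matrix.one_mul]

theorem mulVec_resid_dotProduct {C : Matrix κ ι ℝ} (hC : IsUnit (gram C).det) (w : ι → ℝ) :
    (resid C *ᵥ w) ⬝ᵥ (resid C *ᵥ w) = w ⬝ᵥ (resid C *ᵥ w) := by
  rw [Matrix.dotProduct_mulVec, ← Matrix.mulVec_transpose, resid_transpose, Matrix.mulVec_mulVec,
    resid_mul_resid hC, dotProduct_comm]

theorem resid_mulVec_vecMul {C : Matrix κ ι ℝ} (hC : IsUnit (gram C).det) (v : κ → ℝ) :
    resid C *ᵥ (v ᵥ* C) = 0 := by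
  rw [← Matrix.mulVec_transpose, Matrix.mulVec_mulVec, resid_mul_transpose hC, Matrix.zero_mulVec]

omit [DecidableEq ι] in
theorem coef_mulVec_vecMul {C : Matrix κ ι ℝ} (hC : IsUnit (gram C).det) (v : κ → ℝ) :
    coef C *ᵥ (v ᵥ* C) = v := by
  rw [← Matrix.mulVec_transpose, Matrix.mulVec_mulVec, coef_mul_transpose hC, Matrix.one_mulVec]

omit [Fintype ι] [DecidableEq ι] [DecidableEq ι₁] [DecidableEq ι₂] in
theorem sumElim_vecMul (C : ι₁ ⊕ ι₂ → ι → ℝ) (v₁ : ι₁ → ℝ) (v₂ : ι₂ → ℝ) :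
    Sum.elim v₁ v₂ ᵥ* Matrix.of C = v₁ ᵥ* Matrix.of (fun c => C (Sum.inl c))
      + v₂ ᵥ* Matrix.of (fun c => C (Sum.inr c)) := by
  ext j
  simp [Matrix.vecMul, dotProduct, Fintype.sum_sum_type]

variable {C : ι₁ ⊕ ι₂ → ι → ℝ}

omit [DecidableEq ι] [DecidableEq ι₂] [Fintype ι₂] in
theorem isUnit_det_gram_first (hC : LinearIndependent ℝ C) :
    IsUnit (gram (Matrix.of fun c => C (Sum.inl c))).det :=
  isUnit_det_gram (hC.comp _ Sum.inl_injective)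

/-- Second block, with the first block projected out. -/
noncomputable def partialled (C : ι₁ ⊕ ι₂ → ι → ℝ) : Matrix ι₂ ι ℝ :=
  Matrix.of (fun c => C (Sum.inr c)) * resid (Matrix.of fun c => C (Sum.inl c))

/-- A combination of second-block rows that is annihilated by the residual projection lies in the
span of the first block, which contradicts independence of all rows. -/
theorem isUnit_det_gram_partialled (hC : LinearIndependent ℝ C) :
    IsUnit (gram (partialled C)).det := by
  refine isUnit_det_gram (C := partialled C) (Matrix.vecMul_injective_iff.1 ?_)
  have hinj := Matrix.vecMul_injective_iff.2 (show LinearIndependent ℝ (Matrix.of C).row from hC)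
  refine (injective_iff_map_eq_zero' (Matrix.vecMulLinear (partialled C))).2 fun v => ⟨fun hv => ?_,
    fun hv => by simp [hv]⟩
  set C₁ := Matrix.of fun c => C (Sum.inl c) with hC₁
  set w := v ᵥ* Matrix.of (fun c => C (Sum.inr c)) with hw
  have h1 : resid C₁ *ᵥ w = 0 := by
    have : v ᵥ* partialled C = 0 := hv
    rwa [partialled, ← Matrix.vecMul_vecMul, ← Matrix.mulVec_transpose, resid_transpose] at this
  have h2 : w = (coef C₁ *ᵥ w) ᵥ* C₁ := by
    rw [resid, Matrix.sub_mulVec, Matrix.one_mulVec, ← Matrix.mulVec_mulVec,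
      Matrix.mulVec_transpose] at h1
    exact sub_eq_zero.1 h1
  have h3 : Sum.elim (-(coef C₁ *ᵥ w)) v ᵥ* Matrix.of C = 0 := by
    rw [sumElim_vecMul, Matrix.neg_vecMul, ← h2, neg_add_cancel]
  have h4 : Sum.elim (-(coef C₁ *ᵥ w)) v = 0 := hinj (by simpa using h3)
  ext c
  exact congrFun h4 (Sum.inr c)

omit [Fintype ι₂] [DecidableEq ι₂] in
theorem partialled_mul_resid (hC : LinearIndependent ℝ C) :
    partialled C * resid (Matrix.of fun c => C (Sum.inl c)) = partialled C := by
  rw [partialled, Matrix.mul_assoc, resid_mul_resid (isUnit_det_gram_first hC)]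

omit [Fintype ι₂] [DecidableEq ι₂] in
theorem partialled_mulVec_first (hC : LinearIndependent ℝ C) (v : ι₁ → ℝ) :
    partialled C *ᵥ (v ᵥ* Matrix.of fun c => C (Sum.inl c)) = 0 := by
  rw [partialled, ← Matrix.mulVec_mulVec, resid_mulVec_vecMul (isUnit_det_gram_first hC),
    Matrix.mulVec_zero]

omit [DecidableEq ι₂] in
theorem partialled_mulVec_second (hC : LinearIndependent ℝ C) (v : ι₂ → ℝ) :
    partialled C *ᵥ (v ᵥ* Matrix.of fun c => C (Sum.inr c)) = gram (partialled C) *ᵥ v := by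
  have h : gram (partialled C) = partialled C * (Matrix.of fun c => C (Sum.inr c))ᵀ := by
    rw [gram]
    nth_rewrite 2 [partialled]
    rw [Matrix.transpose_mul, resid_transpose, ← Matrix.mul_assoc, partialled_mul_resid hC]
  rw [h, ← Matrix.mulVec_mulVec, Matrix.mulVec_transpose]

/-- The Frisch-Waugh-Lovell decomposition of the least-squares coefficients. -/
theorem coef_mulVec_eq_sumElim (hC : LinearIndependent ℝ C) (g : ι → ℝ) (d : ι₂ → ℝ)
    (hd : d = coef (partialled C) *ᵥ g) :
    coef (Matrix.of C) *ᵥ g = Sum.elim (coef (Matrix.of fun c => C (Sum.inl c)) *ᵥ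
      (g - d ᵥ* Matrix.of fun c => C (Sum.inr c))) d := by
  set C₁ := Matrix.of fun c => C (Sum.inl c) with hC₁
  set C₂ := Matrix.of fun c => C (Sum.inr c) with hC₂
  set w := g - d ᵥ* C₂ with hw
  have hu₁ := isUnit_det_gram_first hC
  -- Splits `g` into the claimed fit and a remainder, which is then shown orthogonal to both blocks.
  have hg : g = Sum.elim (coef C₁ *ᵥ w) d ᵥ* Matrix.of C + resid C₁ *ᵥ w := by
    rw [sumElim_vecMul, resid, Matrix.sub_mulVec, Matrix.one_mulVec, ← Matrix.mulVec_mulVec,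
      Matrix.mulVec_transpose, hw]
    abel
  have h0 : Matrix.of C *ᵥ (resid C₁ *ᵥ w) = 0 := by
    ext c
    rcases c with c | c
    · have : (C₁ *ᵥ (resid C₁ *ᵥ w)) c = 0 := by
        rw [Matrix.mulVec_mulVec, mul_resid hu₁]; simp
      exact this
    · have : C₂ *ᵥ (resid C₁ *ᵥ w) = partialled C *ᵥ w := by
        rw [Matrix.mulVec_mulVec, partialled]
      have h2 : partialled C *ᵥ w = 0 := by
        rw [hw, Matrix.mulVec_sub, partialled_mulVec_second hC, hd, coef, ← Matrix.mulVec_mulVec,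
          Matrix.mulVec_mulVec _ (gram _), Matrix.mul_nonsing_inv _ (isUnit_det_gram_partialled hC),
          Matrix.one_mulVec, sub_self]
      exact congrFun (this.trans h2) c
  have h1 : coef (Matrix.of C) *ᵥ (resid C₁ *ᵥ w) = 0 := by
    rw [coef, ← Matrix.mulVec_mulVec, h0, Matrix.mulVec_zero]
  conv_lhs => rw [hg]
  rw [Matrix.mulVec_add, coef_mulVec_vecMul (isUnit_det_gram hC), h1, add_zero]

end TwoBlock


/-! ### The estimators in standardized coordinates -/

section Factorized

variable {n : ℕ} {m : Model} {X : Fin n → ℕ → ℝ} {Y : Fin n → ℝ} {c₁ c₂ σ : ℝ}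
  {L₁ : Matrix m.block₁ m.block₁ ℝ} {B : Matrix m.block₁ m.block₂ ℝ}
  {L₂ : Matrix m.block₂ m.block₂ ℝ} {a : m.block₁ → ℝ} {b : m.block₂ → ℝ}
  {G : (m.block₁ ⊕ m.block₂) ⊕ Unit → Fin n → ℝ}

/-- The training sample is obtained from the standardized sample `G` by a triangular linear
transformation of the regressors, and the response has standardized coefficients `a`, `b`, `σ`. -/
structure Factorized (m : Model) (X : Fin n → ℕ → ℝ) (Y : Fin n → ℝ)
    (L₁ : Matrix m.block₁ m.block₁ ℝ) (B : Matrix m.block₁ m.block₂ ℝ)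
    (L₂ : Matrix m.block₂ m.block₂ ℝ) (a : m.block₁ → ℝ) (b : m.block₂ → ℝ) (σ : ℝ)
    (G : (m.block₁ ⊕ m.block₂) ⊕ Unit → Fin n → ℝ) : Prop where
  det₁ : IsUnit L₁.det
  det₂ : IsUnit L₂.det
  X₁_eq : m.X₁ X = (Matrix.of fun c => G (Sum.inl (Sum.inl c)))ᵀ * L₁
  X₂_eq : m.X₂ X = (Matrix.of fun c => G (Sum.inl (Sum.inl c)))ᵀ * B
    + (Matrix.of fun c => G (Sum.inl (Sum.inr c)))ᵀ * L₂
  Y_eq : Y = respWeights σ a b ᵥ* Matrix.of G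

theorem const_vecMul_unit {ι : Type*} (W : Unit → ι → ℝ) (σ : ℝ) :
    (fun _ : Unit => σ) ᵥ* Matrix.of W = σ • W () := by
  ext j
  simp [Matrix.vecMul, dotProduct]

theorem blockWeights_vecMul (σ : ℝ) (b : m.block₂ → ℝ) :
    blockWeights σ b ᵥ* Matrix.of (firstRest G).2
      = b ᵥ* Matrix.of (fun c => G (Sum.inl (Sum.inr c))) + σ • G (Sum.inr ()) := by
  rw [blockWeights, sumElim_vecMul, const_vecMul_unit]
  rfl

namespace Factorized

variable (h : Factorized m X Y L₁ B L₂ a b σ G)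
  (hC : LinearIndependent ℝ fun c => G (Sum.inl c))

include h

theorem Y_eq_full : Y = Sum.elim a b ᵥ* Matrix.of (fun c => G (Sum.inl c)) + σ • G (Sum.inr ()) := by
  rw [h.Y_eq, respWeights, sumElim_vecMul, const_vecMul_unit]

theorem Y_eq_first : Y = a ᵥ* Matrix.of (fun c => G (Sum.inl (Sum.inl c)))
    + blockWeights σ b ᵥ* Matrix.of (firstRest G).2 := by
  rw [h.Y_eq_full, sumElim_vecMul, blockWeights_vecMul, add_assoc]

theorem XX_eq : m.XX X
    = (Matrix.of fun c => G (Sum.inl c))ᵀ * Matrix.fromBlocks L₁ B 0 L₂ := by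
  have : (Matrix.of fun c => G (Sum.inl c))ᵀ = Matrix.fromCols
      (Matrix.of fun c => G (Sum.inl (Sum.inl c)))ᵀ
      (Matrix.of fun c => G (Sum.inl (Sum.inr c)))ᵀ := by
    ext i c
    rcases c with c | c <;> rfl
  rw [Model.XX, h.X₁_eq, h.X₂_eq, this, Matrix.fromCols_mul_fromBlocks]
  simp

include hC

theorem M₁_eq : m.M₁ X = resid (Matrix.of (firstRest G).1) := by
  rw [Model.M₁, Matrix.mul_assoc,
    pinv_mul_transpose (isUnit_det_gram_first hC) h.det₁ h.X₁_eq, h.X₁_eq, Matrix.mul_assoc,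
    ← Matrix.mul_assoc L₁, Matrix.mul_nonsing_inv _ h.det₁, Matrix.one_mul]
  rfl

theorem sigmaHatSq_eq : m.sigmaHatSq X Y = σ ^ 2 * ((designNoise G).2 ⬝ᵥ
    (resid (Matrix.of (designNoise G).1) *ᵥ (designNoise G).2)) / ((n : ℝ) - m.size) := by
  have hu := isUnit_det_gram hC
  have hL : IsUnit (Matrix.fromBlocks L₁ B 0 L₂).det := by
    rw [Matrix.det_fromBlocks_zero₂₁]; exact h.det₁.mul h.det₂
  have h1 : Y - m.XX X *ᵥ m.ls X Y = resid (Matrix.of fun c => G (Sum.inl c)) *ᵥ Y := by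
    rw [Model.ls, pinv_mul_transpose hu hL h.XX_eq, Matrix.mulVec_mulVec, h.XX_eq, Matrix.mul_assoc,
      ← Matrix.mul_assoc _ _ (coef _), Matrix.mul_nonsing_inv _ hL, Matrix.one_mul, resid,
      Matrix.sub_mulVec, Matrix.one_mulVec]
  have h2 : resid (Matrix.of fun c => G (Sum.inl c)) *ᵥ Y
      = σ • (resid (Matrix.of (designNoise G).1) *ᵥ (designNoise G).2) := by
    rw [h.Y_eq_full, Matrix.mulVec_add, resid_mulVec_vecMul hu, zero_add, Matrix.mulVec_smul]
    rfl
  rw [Model.sigmaHatSq, h1, h2, smul_dotProduct, dotProduct_smul, smul_eq_mul, smul_eq_mul,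
    mulVec_resid_dotProduct (C := Matrix.of (designNoise G).1) hu]
  ring

theorem dotProduct_M₁ : Y ⬝ᵥ (m.M₁ X *ᵥ Y) =
    (blockWeights σ b ᵥ* Matrix.of (firstRest G).2) ⬝ᵥ (resid (Matrix.of (firstRest G).1) *ᵥ
      (blockWeights σ b ᵥ* Matrix.of (firstRest G).2)) := by
  have hu := isUnit_det_gram_first hC
  rw [h.M₁_eq hC]
  change Y ⬝ᵥ (resid (Matrix.of fun c => G (Sum.inl (Sum.inl c))) *ᵥ Y) = _ ⬝ᵥ
    (resid (Matrix.of fun c => G (Sum.inl (Sum.inl c))) *ᵥ _)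
  rw [← mulVec_resid_dotProduct hu, h.Y_eq_first, Matrix.mulVec_add, resid_mulVec_vecMul hu,
    zero_add, mulVec_resid_dotProduct hu]

theorem mulVec_ls₁ : L₁ *ᵥ m.ls₁ X Y = a + coef (Matrix.of (firstRest G).1) *ᵥ
    (blockWeights σ b ᵥ* Matrix.of (firstRest G).2) := by
  have hu := isUnit_det_gram_first hC
  rw [Model.ls₁, pinv_mul_transpose hu h.det₁ h.X₁_eq, Matrix.mulVec_mulVec, ← Matrix.mul_assoc,
    Matrix.mul_nonsing_inv _ h.det₁, Matrix.one_mul, h.Y_eq_first, Matrix.mulVec_add,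
    coef_mulVec_vecMul hu]
  rfl

omit h in
theorem secondErr_eq : secondErr σ (firstRest G)
    = σ • (coef (partialled fun c => G (Sum.inl c)) *ᵥ G (Sum.inr ())) := by
  have : secondErr σ (firstRest G) = σ • (coef (partialled fun c => G (Sum.inl c)) *ᵥ
    (resid (Matrix.of fun c => G (Sum.inl (Sum.inl c))) *ᵥ G (Sum.inr ()))) := rfl
  rw [this, Matrix.mulVec_mulVec, coef, Matrix.mul_assoc, partialled_mul_resid hC]

/-- Projecting out block 1 removes both `a` and the off-diagonal factor `B`, leaving a regression on
`partialled` with coefficients `b` and noise of scale `σ`. -/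
theorem mulVec_ls₂ : L₂ *ᵥ m.ls₂ X Y = b + secondErr σ (firstRest G) := by
  have hu := isUnit_det_gram_first hC
  have hE := isUnit_det_gram_partialled hC
  have hXs : m.X₂star X = (partialled fun c => G (Sum.inl c))ᵀ * L₂ := by
    rw [Model.X₂star, h.M₁_eq hC, h.X₂_eq, Matrix.mul_add, ← Matrix.mul_assoc,
      show resid (Matrix.of (firstRest G).1) * (Matrix.of fun c => G (Sum.inl (Sum.inl c)))ᵀ = 0
        from resid_mul_transpose hu, Matrix.zero_mul, zero_add, ← Matrix.mul_assoc, partialled,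
      Matrix.transpose_mul, resid_transpose]
    rfl
  have h1 : (m.X₂ X)ᵀ * m.M₁ X = (m.X₂star X)ᵀ := by
    rw [Model.X₂star, Matrix.transpose_mul, h.M₁_eq hC, resid_transpose]
  have h2 : (m.X₂ X)ᵀ * m.M₁ X * m.X₂ X = (m.X₂star X)ᵀ * m.X₂star X := by
    rw [← h1, Model.X₂star, Matrix.mul_assoc, Matrix.mul_assoc, ← Matrix.mul_assoc (m.M₁ X),
      h.M₁_eq hC]
    congr 1
    rw [show resid (Matrix.of (firstRest G).1) * resid (Matrix.of (firstRest G).1) = _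
      from resid_mul_resid hu]
  rw [Model.ls₂, h2, Matrix.mul_assoc, h1, pinv_mul_transpose hE h.det₂ hXs, Matrix.mulVec_mulVec,
    ← Matrix.mul_assoc, Matrix.mul_nonsing_inv _ h.det₂, Matrix.one_mul, secondErr_eq hC,
    h.Y_eq_full, sumElim_vecMul, Matrix.mulVec_add, Matrix.mulVec_smul, coef,
    ← Matrix.mulVec_mulVec, Matrix.mulVec_add, partialled_mulVec_first hC,
    partialled_mulVec_second hC, zero_add, Matrix.mulVec_mulVec, Matrix.nonsing_inv_mul _ hE,
    Matrix.one_mulVec]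

end Factorized

/-- Identifies the positive-part form of the estimators with the truncated shrinkage factors in the
weights. -/
theorem max_one_sub_zero (t : ℝ) : max (1 - t) 0 = 1 - min 1 t := by
  rcases le_total 1 t with h | h
  · rw [min_eq_left h, max_eq_right (by linarith)]; ring
  · rw [min_eq_right h, max_eq_left (by linarith)]

namespace Factorized

variable (h : Factorized m X Y L₁ B L₂ a b σ G)
  (hC : LinearIndependent ℝ fun c => G (Sum.inl c))

include h hC

-- Frisch–Waugh–Lovell applied to the noise: the full error vector has second block d and first
-- block u, so its length and linear functionals are those of a single noise regression.
omit h in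
theorem coef_smul_noise : σ • (coef (Matrix.of (designNoise G).1) *ᵥ (designNoise G).2)
    = Sum.elim (coef (Matrix.of (firstRest G).1) *ᵥ
      (fullWeights σ (firstRest G) ᵥ* Matrix.of (firstRest G).2)) (secondErr σ (firstRest G)) := by
  have h1 := coef_mulVec_eq_sumElim hC (σ • G (Sum.inr ())) (secondErr σ (firstRest G))
    (by rw [secondErr_eq hC, Matrix.mulVec_smul])
  rw [Matrix.mulVec_smul] at h1
  refine h1.trans ?_
  congr 2
  rw [fullWeights, sumElim_vecMul, const_vecMul_unit, Matrix.neg_vecMul, neg_add_eq_sub]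
  rfl

theorem pred₂ : L₂ *ᵥ m.js₂ c₂ X Y - b
    = (1 - m.a₂ c₂ X Y) • secondErr σ (firstRest G) - m.a₂ c₂ X Y • b := by
  rw [Model.js₂, max_one_sub_zero, Matrix.mulVec_smul, h.mulVec_ls₂ hC, Model.a₂]
  ext i
  simp only [Pi.sub_apply, Pi.smul_apply, Pi.add_apply, smul_eq_mul]
  ring

/-- The back-substitution defining `js₁` uses the shrunken second block. The omitted part of `b`
therefore remains in the first-block regression, which yields the mixture of u and v with weights
1-x₂ and x₂-x₁. -/
theorem pred₁ : L₁ *ᵥ m.js₁ c₁ c₂ X Y + B *ᵥ m.js₂ c₂ X Y - a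
    = (1 - m.a₂ c₂ X Y) • (coef (Matrix.of (firstRest G).1) *ᵥ
        (fullWeights σ (firstRest G) ᵥ* Matrix.of (firstRest G).2))
      + (m.a₂ c₂ X Y - m.a₁ c₁ X Y) • (coef (Matrix.of (firstRest G).1) *ᵥ
        (blockWeights σ b ᵥ* Matrix.of (firstRest G).2)) - m.a₁ c₁ X Y • a := by
  have hu := isUnit_det_gram_first hC
  set C₁ := Matrix.of (firstRest G).1 with hC₁
  set C₂ := Matrix.of fun c => G (Sum.inl (Sum.inr c)) with hC₂
  have e1 : L₁ *ᵥ ((pinv ((m.X₁ X)ᵀ * m.X₁ X) * (m.X₁ X)ᵀ * m.X₂ X) *ᵥ m.js₂ c₂ X Y)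
      = B *ᵥ m.js₂ c₂ X Y + coef C₁ *ᵥ (C₂ᵀ *ᵥ (L₂ *ᵥ m.js₂ c₂ X Y)) := by
    rw [pinv_mul_transpose hu h.det₁ h.X₁_eq, Matrix.mulVec_mulVec, Matrix.mul_assoc L₁⁻¹,
      ← Matrix.mul_assoc L₁, Matrix.mul_nonsing_inv _ h.det₁, Matrix.one_mul, h.X₂_eq,
      Matrix.mul_add, ← Matrix.mul_assoc, coef_mul_transpose hu, Matrix.one_mul, Matrix.add_mulVec,
      Matrix.mulVec_mulVec, Matrix.mulVec_mulVec, Matrix.mul_assoc]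
    rfl
  have e2 : L₂ *ᵥ m.js₂ c₂ X Y = (1 - m.a₂ c₂ X Y) • (b + secondErr σ (firstRest G)) := by
    rw [Model.js₂, max_one_sub_zero, Matrix.mulVec_smul, h.mulVec_ls₂ hC, Model.a₂]
  -- The fitted second block is the block-1 regression noise minus the noise that remains in the
  -- full regression.
  have e3 : C₂ᵀ *ᵥ (b + secondErr σ (firstRest G)) = blockWeights σ b ᵥ* Matrix.of (firstRest G).2
      - fullWeights σ (firstRest G) ᵥ* Matrix.of (firstRest G).2 := by
    rw [blockWeights_vecMul, fullWeights, sumElim_vecMul, const_vecMul_unit, Matrix.neg_vecMul,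
      Matrix.mulVec_transpose, Matrix.add_vecMul]
    change _ = b ᵥ* C₂ + σ • G (Sum.inr ())
      - (-(secondErr σ (firstRest G) ᵥ* C₂) + σ • G (Sum.inr ()))
    abel
  rw [Model.js₁, Matrix.mulVec_sub, e1, e2, Matrix.mulVec_smul, e3, Matrix.mulVec_smul,
    Matrix.mulVec_sub, Model.js₁star, max_one_sub_zero, Matrix.mulVec_smul, h.mulVec_ls₁ hC]
  change _ = _ + (m.a₂ c₂ X Y - min 1 (m.ratio₁ c₁ X Y)) • _ - min 1 (m.ratio₁ c₁ X Y) • _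
  ext i
  simp only [Pi.sub_apply, Pi.smul_apply, Pi.add_apply, smul_eq_mul]
  ring

end Factorized

end Factorized


/-! ### From the good event to closeness of the two errors -/

theorem sumElim_dotProduct {α β : Type*} [Fintype α] [Fintype β] (v w : α → ℝ) (v' w' : β → ℝ) :
    Sum.elim v v' ⬝ᵥ Sum.elim w w' = v ⬝ᵥ w + v' ⬝ᵥ w' := by
  simp [dotProduct, Fintype.sum_sum_type]

theorem const_dotProduct_unit (s t : ℝ) : (fun _ : Unit => s) ⬝ᵥ (fun _ : Unit => t) = s * t := by
  simp [dotProduct]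

theorem abs_div_sub_le {v w c τ : ℝ} (hc : 0 < c) (h : |v - w * c| ≤ τ * (w * c)) :
    |v / c - w| ≤ τ * w := by
  rw [show v / c - w = (v - w * c) / c by field_simp, abs_div, abs_of_pos hc, div_le_iff₀ hc]
  linarith

theorem smul_add_dotProduct_expand {α β : Type*} [Fintype α] [Fintype β] (F R x₁ x₂ : ℝ)
    (u v a : α → ℝ) (d b : β → ℝ) :
    (F • u + R • v - x₁ • a) ⬝ᵥ (F • u + R • v - x₁ • a) + (F • d - x₂ • b) ⬝ᵥ (F • d - x₂ • b)
      = F ^ 2 * (u ⬝ᵥ u + d ⬝ᵥ d) + R ^ 2 * (v ⬝ᵥ v) + x₁ ^ 2 * (a ⬝ᵥ a) + x₂ ^ 2 * (b ⬝ᵥ b)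
        + 2 * F * R * (u ⬝ᵥ v) - 2 * F * x₁ * (a ⬝ᵥ u) - 2 * R * x₁ * (a ⬝ᵥ v)
        - 2 * F * x₂ * (b ⬝ᵥ d) := by
  simp only [add_dotProduct, dotProduct_add, sub_dotProduct, dotProduct_sub, smul_dotProduct,
    dotProduct_smul, smul_eq_mul, dotProduct_comm v u, dotProduct_comm u a, dotProduct_comm v a,
    dotProduct_comm d b]
  ring

/-- First alternative: the minimum of x₂² + (x₂-x₁)²q over x₂ is x₁²q/(1+q), by completing the
square, so t₂ is charged even when x₂ is small. Second alternative: x₁² ≤ 1, and the target is at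
least s. -/
theorem sq_mul_le_mul_target {s t₁ t₂ q qm x₁ x₂ K : ℝ} (hs : 0 ≤ s) (ht₁ : 0 ≤ t₁) (ht₂ : 0 ≤ t₂)
    (hq : 0 ≤ q) (hqm : q ≤ qm) (hx₁ : 0 ≤ x₁) (hx₁' : x₁ ≤ 1) (hK0 : 0 ≤ K)
    (hK : 1 + q ≤ K * q ∨ t₂ ≤ K * s) :
    x₁ ^ 2 * t₂ ≤ K * target s t₁ t₂ q qm x₁ x₂ := by
  have h1 : 0 ≤ (1 - x₂) ^ 2 * (qm - q) := mul_nonneg (sq_nonneg _) (by linarith)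
  rcases hK with hK | hK
  · have h2 : 0 ≤ s * (1 + (1 - x₂) ^ 2 * (qm - q) + (1 - x₁) ^ 2 * q) := by positivity
    have h3 : x₁ ^ 2 * q ≤ (1 + q) * (x₂ ^ 2 + (x₂ - x₁) ^ 2 * q) := by
      linarith [sq_nonneg ((1 + q) * x₂ - q * x₁)]
    have h4 : x₁ ^ 2 ≤ K * (x₂ ^ 2 + (x₂ - x₁) ^ 2 * q) := by
      have h5 : x₁ ^ 2 * (1 + q) ≤ K * (x₂ ^ 2 + (x₂ - x₁) ^ 2 * q) * (1 + q) :=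
        calc x₁ ^ 2 * (1 + q) ≤ x₁ ^ 2 * (K * q) := mul_le_mul_of_nonneg_left hK (sq_nonneg _)
          _ = K * (x₁ ^ 2 * q) := by ring
          _ ≤ K * ((1 + q) * (x₂ ^ 2 + (x₂ - x₁) ^ 2 * q)) := mul_le_mul_of_nonneg_left h3 hK0
          _ = _ := by ring
      exact le_of_mul_le_mul_right h5 (by linarith)
    have h6 : t₂ * (x₂ ^ 2 + (x₂ - x₁) ^ 2 * q) ≤ target s t₁ t₂ q qm x₁ x₂ := by
      have : 0 ≤ t₁ * x₁ ^ 2 := by positivity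
      unfold target; linarith
    calc x₁ ^ 2 * t₂ ≤ K * (x₂ ^ 2 + (x₂ - x₁) ^ 2 * q) * t₂ := mul_le_mul_of_nonneg_right h4 ht₂
      _ = K * (t₂ * (x₂ ^ 2 + (x₂ - x₁) ^ 2 * q)) := by ring
      _ ≤ _ := mul_le_mul_of_nonneg_left h6 hK0
  · have hR := le_target (t₁ := t₁) (x₁ := x₁) (x₂ := x₂) hs ht₂ hq hqm
    have h2 : 0 ≤ t₁ * x₁ ^ 2 := by positivity
    have h3 : 0 ≤ t₂ * x₂ ^ 2 := by positivity
    calc x₁ ^ 2 * t₂ ≤ t₂ := mul_le_of_le_one_left ht₂ (pow_le_one₀ hx₁ hx₁')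
      _ ≤ K * s := hK
      _ ≤ _ := mul_le_mul_of_nonneg_left (by linarith) hK0

namespace Model

variable {n : ℕ} (m : Model) {X : Fin n → ℕ → ℝ} {Y : Fin n → ℝ} {c₁ c₂ : ℝ}

theorem sigmaHatSq_nonneg (hk : m.size < n) : 0 ≤ m.sigmaHatSq X Y := by
  have : (m.size : ℝ) < n := by exact_mod_cast hk
  exact div_nonneg (dotProduct_self_nonneg' _) (by linarith)

theorem transpose_mul_self_dotProduct_nonneg {α β : Type*} [Fintype α] [Fintype β]
    (A : Matrix α β ℝ) (v : β → ℝ) : 0 ≤ v ⬝ᵥ ((Aᵀ * A) *ᵥ v) := by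
  rw [← Matrix.mulVec_mulVec, Matrix.dotProduct_mulVec, Matrix.vecMul_transpose]
  exact dotProduct_self_nonneg' _

theorem a₁_nonneg (hk : m.size < n) (hc : 0 ≤ c₁) : 0 ≤ m.a₁ c₁ X Y :=
  le_min zero_le_one (mul_nonneg (mul_nonneg hc (m.sigmaHatSq_nonneg hk))
    (div_nonneg (Nat.cast_nonneg _) (transpose_mul_self_dotProduct_nonneg _ _)))

theorem a₂_nonneg (hk : m.size < n) (hc : 0 ≤ c₂) : 0 ≤ m.a₂ c₂ X Y :=
  le_min zero_le_one (mul_nonneg (mul_nonneg hc (m.sigmaHatSq_nonneg hk))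
    (div_nonneg (Nat.cast_nonneg _) (transpose_mul_self_dotProduct_nonneg _ _)))

/-- Regroups the estimator by the full residual variance, the block-1 residual variance and the
total sum of squares, the form that `rhoHat_close` takes. -/
theorem rhoHatSq_eq (hk : m.size < n) : m.rhoHatSq c₁ c₂ X Y =
    m.sigmaHatSq X Y * ((1 - m.a₂ c₂ X Y) ^ 2 * (1 + m.size / ((n : ℝ) - m.size + 1))
        + 2 * (1 - m.a₂ c₂ X Y) * (m.a₂ c₂ X Y - m.a₁ c₁ X Y)
          * (1 + m.size₁ / ((n : ℝ) - m.size₁ + 1))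
        + 2 * (1 - m.a₂ c₂ X Y) * m.a₁ c₁ X Y)
      + (Y ⬝ᵥ (m.M₁ X *ᵥ Y)) / ((n : ℝ) - m.size₁)
        * ((m.a₂ c₂ X Y - m.a₁ c₁ X Y) ^ 2 * (1 + m.size₁ / ((n : ℝ) - m.size₁ + 1))
        + 2 * (m.a₂ c₂ X Y - m.a₁ c₁ X Y) * m.a₁ c₁ X Y)
      + (Y ⬝ᵥ Y) / n * m.a₁ c₁ X Y ^ 2 := by
  have hkn : (m.size₁ : ℝ) < n := by
    exact_mod_cast lt_of_le_of_lt (Nat.le_add_right m.size₁ m.size₂) hk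
  have hn : (0 : ℝ) < n := lt_of_le_of_lt (Nat.cast_nonneg _) hkn
  have h1 : (Y ⬝ᵥ (m.M₁ X *ᵥ Y)) / (n : ℝ)
      = (Y ⬝ᵥ (m.M₁ X *ᵥ Y)) / ((n : ℝ) - m.size₁) * (1 - m.size₁ / (n : ℝ)) := by
    have : (n : ℝ) - m.size₁ ≠ 0 := by linarith
    field_simp
  rw [rhoHatSq, Matrix.sub_mulVec, Matrix.one_mulVec, dotProduct_sub, sub_div, h1, w₁, w₂, w₃]
  ring

end Model

/-- The choice of `τ` makes τK/η² equal to ε/(50(1+ε)), the constant `c` of `absLog_lt_of_close`.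
The sample sizes enter only through n/(n-k+1) ≤ 1/η and its companions. -/
theorem absLog_lt_of_good {n : ℕ} {m : Model} {X : Fin n → ℕ → ℝ} {Y : Fin n → ℝ} {c₁ c₂ σ : ℝ}
    {L₁ : Matrix m.block₁ m.block₁ ℝ} {B : Matrix m.block₁ m.block₂ ℝ}
    {L₂ : Matrix m.block₂ m.block₂ ℝ} {a : m.block₁ → ℝ} {b : m.block₂ → ℝ}
    {G : (m.block₁ ⊕ m.block₂) ⊕ Unit → Fin n → ℝ}
    (h : Factorized m X Y L₁ B L₂ a b σ G) (hσ : 0 < σ) (hk : m.size < n)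
    (hc₁ : 0 ≤ c₁) (hc₂ : 0 ≤ c₂) {η K ε τ : ℝ} (hη : η = 1 - m.size / (n : ℝ)) (hK1 : 1 ≤ K)
    (hK : (n : ℝ) + 1 ≤ K * m.size₁ ∨ b ⬝ᵥ b ≤ K * σ ^ 2) (hε : 0 < ε)
    (hτ : τ = η ^ 2 * (ε / (50 * (1 + ε))) / K) (good : Good σ τ a b n m.size m.size₁ G) {ρ : ℝ}
    (hρ : ρ = σ ^ 2 + ((L₁ *ᵥ m.js₁ c₁ c₂ X Y + B *ᵥ m.js₂ c₂ X Y - a) ⬝ᵥ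
        (L₁ *ᵥ m.js₁ c₁ c₂ X Y + B *ᵥ m.js₂ c₂ X Y - a)
      + (L₂ *ᵥ m.js₂ c₂ X Y - b) ⬝ᵥ (L₂ *ᵥ m.js₂ c₂ X Y - b))) :
    absLog (m.rhoHatSq c₁ c₂ X Y / ρ) < ENNReal.ofReal ε := by
  have hC : LinearIndependent ℝ fun c => G (Sum.inl c) := good.li
  have hkR : (m.size : ℝ) < n := by exact_mod_cast hk
  have hk1 : (m.size₁ : ℝ) ≤ m.size := by exact_mod_cast Nat.le_add_right m.size₁ m.size₂
  have hk10 : (0 : ℝ) ≤ m.size₁ := Nat.cast_nonneg _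
  have hn : (0 : ℝ) < n := by linarith
  have hηe : η = ((n : ℝ) - m.size) / n := by rw [hη]; field_simp
  have hη0 : 0 < η := by rw [hηe]; exact div_pos (by linarith) hn
  have hη1 : η ≤ 1 := by
    rw [hη]; linarith [div_nonneg (by linarith : (0 : ℝ) ≤ m.size) hn.le]
  have h1η : 1 / η = n / ((n : ℝ) - m.size) := by rw [hηe, one_div_div]
  have hnk : (n : ℝ) / (n - m.size + 1) ≤ 1 / η := by
    rw [h1η]; exact div_le_div_of_nonneg_left hn.le (by linarith) (by linarith)
  have hnk₁ : (n : ℝ) / (n - m.size₁ + 1) ≤ 1 / η := by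
    rw [h1η]; exact div_le_div_of_nonneg_left hn.le (by linarith) (by linarith)
  set c := ε / (50 * (1 + ε)) with hc
  have hc0 : 0 < c := by positivity
  have hc50 : c ≤ 1 / 50 := by
    rw [hc, div_le_div_iff₀ (by positivity) (by norm_num)]; linarith
  have hτ0 : 0 ≤ τ := by rw [hτ]; positivity
  have hτ50 : τ ≤ 1 / 50 := by
    rw [hτ, div_le_iff₀ (by linarith)]
    calc η ^ 2 * c ≤ 1 * (1 / 50) :=
          mul_le_mul (pow_le_one₀ hη0.le hη1) hc50 hc0.le zero_le_one
      _ ≤ 1 / 50 * K := by linarith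
  have hτK : τ * K / η ^ 2 = c := by rw [hτ]; field_simp
  set q : ℝ := m.size₁ / ((n : ℝ) - m.size₁ + 1) with hq
  set qm : ℝ := m.size / ((n : ℝ) - m.size + 1) with hqm
  have hq0 : 0 ≤ q := div_nonneg hk10 (by linarith)
  have hqqm : q ≤ qm := by
    rw [hq, hqm, div_le_div_iff₀ (by linarith) (by linarith)]; nlinarith
  have hqη : 1 + qm ≤ 1 / η := by
    rw [h1η, hqm, ← sub_nonneg]
    have : (n : ℝ) / (n - m.size) - (1 + m.size / (n - m.size + 1))
        = m.size / ((n - m.size) * (n - m.size + 1)) := by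
      have h1 : (n : ℝ) - m.size ≠ 0 := by linarith
      have h2 : (n : ℝ) - m.size + 1 ≠ 0 := by linarith
      field_simp
      ring
    rw [this]
    exact div_nonneg (by linarith) (mul_nonneg (by linarith) (by linarith))
  have hKq : 1 + q ≤ K * q ∨ b ⬝ᵥ b ≤ K * σ ^ 2 := by
    refine hK.imp_left fun hK => ?_
    have h1 : (0 : ℝ) < n - m.size₁ + 1 := by linarith
    have h2 : 1 + q = ((n : ℝ) + 1) / (n - m.size₁ + 1) := by rw [hq]; field_simp; ring
    rw [h2, hq, ← mul_div_assoc]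
    exact div_le_div_of_nonneg_right hK h1.le
  have hs : 0 < σ ^ 2 := by positivity
  have ht₁ := dotProduct_self_nonneg' a
  have ht₂ := dotProduct_self_nonneg' b
  have hx₁ := m.a₁_nonneg (X := X) (Y := Y) hk hc₁
  have hx₂ := m.a₂_nonneg (X := X) (Y := Y) hk hc₂
  have hx₁' : m.a₁ c₁ X Y ≤ 1 := min_le_left _ _
  have hx₂' : m.a₂ c₂ X Y ≤ 1 := min_le_left _ _
  have hKR := sq_mul_le_mul_target (x₂ := m.a₂ c₂ X Y) hs.le ht₁ ht₂ hq0 hqqm hx₁ hx₁'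
    (by linarith) hKq
  have hbw : blockWeights σ b ⬝ᵥ blockWeights σ b = σ ^ 2 + b ⬝ᵥ b := by
    rw [blockWeights, sumElim_dotProduct, const_dotProduct_unit]; ring
  have hrw : respWeights σ a b ⬝ᵥ respWeights σ a b = σ ^ 2 + b ⬝ᵥ b + a ⬝ᵥ a := by
    rw [respWeights, sumElim_dotProduct, sumElim_dotProduct, const_dotProduct_unit]; ring
  have hR0 : 0 < target (σ ^ 2) (a ⬝ᵥ a) (b ⬝ᵥ b) q qm (m.a₁ c₁ X Y) (m.a₂ c₂ X Y) := by
    have := le_target (t₁ := a ⬝ᵥ a) (x₁ := m.a₁ c₁ X Y) (x₂ := m.a₂ c₂ X Y) hs.le ht₂ hq0 hqqm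
    have h2 : 0 ≤ (a ⬝ᵥ a) * m.a₁ c₁ X Y ^ 2 := by positivity
    have h3 : 0 ≤ (b ⬝ᵥ b) * m.a₂ c₂ X Y ^ 2 := by positivity
    linarith
  refine absLog_lt_of_close hR0 hε hc ?_ ?_
  · rw [← hτK, m.rhoHatSq_eq hk]
    refine rhoHat_close hs ht₁ ht₂ hq0 hqqm hη0 hη1 hqη hK1 hτ0 hx₁ hx₁' hx₂ hx₂' hKR ?_ ?_ ?_
    · rw [h.sigmaHatSq_eq hC]
      refine abs_div_sub_le (by linarith) ?_
      rw [← mul_sub, abs_mul, abs_of_pos hs]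
      have := mul_le_mul_of_nonneg_left good.rss hs.le
      linarith
    · refine abs_div_sub_le (by linarith) ?_
      have := good.rss₁
      rwa [hbw, ← h.dotProduct_M₁ hC] at this
    · refine abs_div_sub_le hn ?_
      have := good.tss
      rwa [hrw, ← h.Y_eq] at this
  · set u := coef (Matrix.of (firstRest G).1) *ᵥ
        (fullWeights σ (firstRest G) ᵥ* Matrix.of (firstRest G).2) with hu
    set v := coef (Matrix.of (firstRest G).1) *ᵥ
        (blockWeights σ b ᵥ* Matrix.of (firstRest G).2) with hv
    set d := secondErr σ (firstRest G) with hd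
    have hnoise := Factorized.coef_smul_noise (σ := σ) hC
    set w := coef (Matrix.of (designNoise G).1) *ᵥ (designNoise G).2 with hw
    have hD : σ ^ 2 * (w ⬝ᵥ w) = u ⬝ᵥ u + d ⬝ᵥ d := by
      rw [← sumElim_dotProduct, ← hnoise, smul_dotProduct, dotProduct_smul, smul_eq_mul,
        smul_eq_mul]
      ring
    have hl : σ * (Sum.elim a b ⬝ᵥ w) = a ⬝ᵥ u + b ⬝ᵥ d := by
      rw [← sumElim_dotProduct, ← hnoise, dotProduct_smul, smul_eq_mul]
    have hl₂ : σ * (Sum.elim 0 b ⬝ᵥ w) = b ⬝ᵥ d := by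
      have := sumElim_dotProduct (0 : m.block₁ → ℝ) u b d
      rw [zero_dotProduct, zero_add] at this
      rw [← this, ← hnoise, dotProduct_smul, smul_eq_mul]
    have hfb : fullWeights σ (firstRest G) ⬝ᵥ blockWeights σ b = σ ^ 2 - b ⬝ᵥ d := by
      rw [fullWeights, blockWeights, sumElim_dotProduct, const_dotProduct_unit, neg_dotProduct,
        dotProduct_comm d b]
      ring
    have hff : fullWeights σ (firstRest G) ⬝ᵥ fullWeights σ (firstRest G) = σ ^ 2 + d ⬝ᵥ d := by
      rw [fullWeights, sumElim_dotProduct, const_dotProduct_unit, neg_dotProduct, dotProduct_neg]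
      ring
    have hσs : √(σ ^ 2) = σ := Real.sqrt_sq hσ.le
    rw [hρ, h.pred₁ hC, h.pred₂ hC, smul_add_dotProduct_expand, ← hτK]
    have key := rho_close (l₁ := a ⬝ᵥ v) (l := a ⬝ᵥ u + b ⬝ᵥ d) (l₂ := b ⬝ᵥ d) (p := u ⬝ᵥ v)
      (D := u ⬝ᵥ u + d ⬝ᵥ d) (D₁ := v ⬝ᵥ v) hs ht₁ ht₂ hq0 hqqm hη0 hη1 hqη hK1 hτ0 hτ50
      hx₁ hx₁' hx₂ hx₂' hKR (add_nonneg (dotProduct_self_nonneg' _) (dotProduct_self_nonneg' _))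
      ?_ ?_ ?_ ?_ ?_ ?_
    · convert! key using 2
      ring
    · rw [← hD, ← mul_sub, abs_mul, abs_of_pos hs, mul_comm]
      refine mul_le_mul_of_nonneg_right (good.coef_normSq.trans ?_) hs.le
      exact mul_le_mul_of_nonneg_left hnk (by positivity)
    · have := good.coef_normSq₁
      rw [hbw] at this
      refine this.trans ?_
      rw [mul_comm]
      exact mul_le_mul_of_nonneg_right (mul_le_mul_of_nonneg_left hnk₁ (by positivity))
        (by positivity)
    · have := good.cross
      rw [hbw, hfb, hff] at this
      refine this.trans ?_
      refine mul_le_mul (mul_le_mul_of_nonneg_left hnk₁ (by positivity)) ?_ (by positivity)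
        (by positivity)
      refine mul_le_mul_of_nonneg_right (Real.sqrt_le_sqrt ?_) (Real.sqrt_nonneg _)
      linarith [dotProduct_self_nonneg' u]
    · rw [← hl₂, abs_mul, abs_of_pos hσ, hσs]
      have := good.linear₂
      rw [sumElim_dotProduct, zero_dotProduct, zero_add] at this
      calc _ ≤ σ * (τ * √(b ⬝ᵥ b)) := mul_le_mul_of_nonneg_left this hσ.le
        _ = _ := by ring
    · rw [← hl, abs_mul, abs_of_pos hσ, hσs]
      have := good.linear
      rw [sumElim_dotProduct] at this
      calc _ ≤ σ * (τ * √(a ⬝ᵥ a + b ⬝ᵥ b)) := mul_le_mul_of_nonneg_left this hσ.le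
        _ = _ := by ring
    · have := good.linear₁
      rw [hbw] at this
      refine this.trans (le_of_eq ?_)
      ring


/-! ### Block triangular factorization -/

section Cholesky

variable {α β : Type*} [Fintype α] [Fintype β] [DecidableEq α] [DecidableEq β]

-- Positive semidefiniteness of the root is retained because in the one-by-one case it fixes the
-- sign of `σ`.
open scoped MatrixOrder in
theorem exists_posSemidef_sqrt {A : Matrix α α ℝ} (hA : A.PosDef) :
    ∃ Q : Matrix α α ℝ, Q.PosSemidef ∧ IsUnit Q.det ∧ Qᵀ * Q = A := by
  have h : (CFC.sqrt A).PosSemidef := Matrix.nonneg_iff_posSemidef.1 (CFC.sqrt_nonneg A)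
  have hQ : CFC.sqrt A * CFC.sqrt A = A := CFC.sqrt_mul_sqrt_self A hA.posSemidef.nonneg
  refine ⟨CFC.sqrt A, h, ?_, ?_⟩
  · have hd := hA.det_pos.ne'
    rw [← hQ, Matrix.det_mul] at hd
    exact (left_ne_zero_of_mul hd).isUnit
  · rw [← Matrix.conjTranspose_eq_transpose_of_trivial, h.isHermitian.eq, hQ]

/-- A factorization of the upper left block extends to a block triangular factorization. -/
theorem exists_block_cholesky {S : Matrix (α ⊕ β) (α ⊕ β) ℝ} (hS : S.PosDef) {L₁ : Matrix α α ℝ}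
    (hL₁ : IsUnit L₁.det) (h₁ : S.toBlocks₁₁ = L₁ᵀ * L₁) :
    ∃ (B : Matrix α β ℝ) (L₂ : Matrix β β ℝ), L₂.PosSemidef ∧ IsUnit L₂.det ∧
      S = (Matrix.fromBlocks L₁ B 0 L₂)ᵀ * Matrix.fromBlocks L₁ B 0 L₂ := by
  -- `B` is forced by the off-diagonal block; what remains is the Schur complement `D`, positive
  -- definite because `S` is congruent to the block diagonal matrix of the identity and `D`.
  set B := (L₁ᵀ)⁻¹ * S.toBlocks₁₂ with hB
  set D := S.toBlocks₂₂ - Bᵀ * B with hD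
  set U := Matrix.fromBlocks L₁ B 0 (1 : Matrix β β ℝ) with hU
  have hLt : IsUnit L₁ᵀ.det := by rwa [Matrix.det_transpose]
  have hSt : Sᵀ = S := by
    have := hS.isHermitian
    rwa [Matrix.IsHermitian, Matrix.conjTranspose_eq_transpose_of_trivial] at this
  have h₂ : L₁ᵀ * B = S.toBlocks₁₂ := by
    rw [hB, ← Matrix.mul_assoc, Matrix.mul_nonsing_inv _ hLt, Matrix.one_mul]
  have h₃ : Bᵀ * L₁ = S.toBlocks₂₁ := by
    have := congrArg Matrix.transpose h₂
    rw [Matrix.transpose_mul, Matrix.transpose_transpose] at this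
    rw [this]
    ext i j
    exact congrFun (congrFun hSt (Sum.inr i)) (Sum.inl j)
  have hblock : ∀ L₂ : Matrix β β ℝ, L₂ᵀ * L₂ = D →
      S = (Matrix.fromBlocks L₁ B 0 L₂)ᵀ * Matrix.fromBlocks L₁ B 0 L₂ := by
    intro L₂ hL₂
    rw [Matrix.fromBlocks_transpose, Matrix.fromBlocks_multiply, hL₂, ← h₁, h₂, h₃, hD]
    simp [Matrix.fromBlocks_toBlocks]
  have hUS : S = star U * Matrix.fromBlocks 1 0 0 D * U := by
    rw [Matrix.star_eq_conjTranspose, Matrix.conjTranspose_eq_transpose_of_trivial, hU,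
      Matrix.fromBlocks_transpose, Matrix.fromBlocks_multiply, Matrix.fromBlocks_multiply]
    simp [h₁.symm, h₂, h₃, hD, Matrix.fromBlocks_toBlocks]
  have hUu : IsUnit U := by
    rw [Matrix.isUnit_iff_isUnit_det, hU, Matrix.det_fromBlocks_zero₂₁]
    simpa using hL₁
  have hDp : D.PosDef := by
    rw [hUS, Matrix.IsUnit.posDef_star_left_conjugate_iff hUu] at hS
    have := hS.submatrix (e := (Sum.inr : β → α ⊕ β)) Sum.inr_injective
    convert! this using 1
  obtain ⟨L₂, hp, hu, hL₂⟩ := exists_posSemidef_sqrt hDp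
  exact ⟨B, L₂, hp, hu, hblock L₂ hL₂⟩

end Cholesky

/-! ### Second moments and whitening -/

section Moments

variable {Ω : Type*} [MeasurableSpace Ω] {P : Measure Ω}
variable {ι : Type*} [Fintype ι]

/-- Matrix of second moments. -/
noncomputable def secondMoment (P : Measure Ω) (v : ι → Ω → ℝ) : Matrix ι ι ℝ :=
  Matrix.of fun i j => ∫ ω, v i ω * v j ω ∂P

theorem integral_sq_dotProduct {v : ι → Ω → ℝ} (hv : ∀ i, MemLp (v i) 2 P) (c : ι → ℝ) :
    ∫ ω, (c ⬝ᵥ fun i => v i ω) ^ 2 ∂P = c ⬝ᵥ (secondMoment P v *ᵥ c) := by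
  have hint : ∀ i j, Integrable (fun ω => v i ω * v j ω) P := fun i j =>
    (hv i).integrable_mul (hv j)
  have h1 : ∀ ω, (c ⬝ᵥ fun i => v i ω) ^ 2 = ∑ i, ∑ j, c i * c j * (v i ω * v j ω) := by
    intro ω
    rw [sq, dotProduct, Finset.sum_mul_sum]
    exact Finset.sum_congr rfl fun i _ => Finset.sum_congr rfl fun j _ => by ring
  simp_rw [h1]
  rw [integral_finsetSum _ fun i _ => integrable_finsetSum _ fun j _ => (hint i j).const_mul _]
  simp only [dotProduct, Matrix.mulVec, secondMoment, Matrix.of_apply, Finset.mul_sum]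
  refine Finset.sum_congr rfl fun i _ => ?_
  rw [integral_finsetSum _ fun j _ => (hint i j).const_mul _]
  refine Finset.sum_congr rfl fun j _ => ?_
  rw [integral_const_mul]
  ring

omit [Fintype ι] in
theorem covariance_eq_secondMoment [IsProbabilityMeasure P] {v : ι → Ω → ℝ}
    (hv : ∀ i, MemLp (v i) 2 P) (hmean : ∀ i, ∫ ω, v i ω ∂P = 0) (i j : ι) :
    cov[v i, v j; P] = secondMoment P v i j := by
  rw [covariance_eq_sub (hv i) (hv j), hmean, hmean]
  simp [secondMoment]

theorem secondMoment_stdG [DecidableEq ι] : secondMoment (stdG ι) (fun i w => w i) = 1 := by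
  ext i j
  rw [← covariance_eq_secondMoment memLp_stdG_eval integral_stdG_eval, covariance_stdG_eval,
    Matrix.one_apply]

theorem integral_sq_dotProduct_stdG (c : ι → ℝ) : ∫ w, (c ⬝ᵥ w) ^ 2 ∂(stdG ι) = c ⬝ᵥ c := by
  classical
  have := integral_sq_dotProduct (P := stdG ι) (v := fun i w => w i) memLp_stdG_eval c
  rwa [secondMoment_stdG, Matrix.one_mulVec] at this

theorem hasLaw_vecMul_inv [IsProbabilityMeasure P] [DecidableEq ι] {v : ι → Ω → ℝ}
    (hg : HasGaussianLaw (fun ω i => v i ω) P) (hmean : ∀ i, ∫ ω, v i ω ∂P = 0)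
    {L : Matrix ι ι ℝ} (hL : IsUnit L.det) (hv : secondMoment P v = Lᵀ * L) :
    HasLaw (fun ω => (fun i => v i ω) ᵥ* L⁻¹) (stdG ι) P := by
  have hm : ∀ i, MemLp (v i) 2 P := fun i => (hg.eval i).memLp_two
  refine hasLaw_stdG (g := fun k ω => ((fun i => v i ω) ᵥ* L⁻¹) k) ?_ ?_ ?_
  · have := hg.map_fun (LinearMap.toContinuousLinearMap (Matrix.vecMulLinear L⁻¹))
    exact this
  · intro k
    simp only [Matrix.vecMul, dotProduct]
    rw [integral_finsetSum _ fun i _ => ((hm i).integrable (by norm_num)).mul_const _]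
    simp [integral_mul_const, hmean]
  · intro k l
    simp only [Matrix.vecMul, dotProduct]
    rw [covariance_fun_sum_fun_sum (fun i => (hm i).mul_const _) (fun i => (hm i).mul_const _)]
    simp only [covariance_mul_const_left, covariance_mul_const_right,
      covariance_eq_secondMoment hm hmean, hv]
    have h1 : (L⁻¹)ᵀ * (Lᵀ * L) * L⁻¹ = 1 := by
      rw [Matrix.mul_assoc, Matrix.mul_assoc, Matrix.mul_nonsing_inv _ hL, Matrix.mul_one,
        ← Matrix.transpose_mul, Matrix.mul_nonsing_inv _ hL, Matrix.transpose_one]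
    have h2 := congrFun (congrFun h1 k) l
    rw [Matrix.mul_apply, Matrix.one_apply] at h2
    rw [← h2]
    simp only [Matrix.mul_apply (M := (L⁻¹)ᵀ), Matrix.transpose_apply L⁻¹, Finset.sum_mul]
    rw [Finset.sum_comm]
    exact Finset.sum_congr rfl fun i _ => Finset.sum_congr rfl fun j _ => by ring

/-- Cauchy–Schwarz: testing against a fixed square-integrable function is continuous in mean square.
-/
theorem tendsto_integral_mul_of_eLpNorm {f : ℕ → Ω → ℝ} {w : Ω → ℝ}
    (hf : ∀ N, MemLp (f N) 2 P) (hw : MemLp w 2 P)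
    (h : Tendsto (fun N => eLpNorm (f N) 2 P) atTop (𝓝 0)) :
    Tendsto (fun N => ∫ ω, f N ω * w ω ∂P) atTop (𝓝 0) := by
  have h1 : Tendsto (fun N => eLpNorm (f N) 2 P * eLpNorm w 2 P) atTop (𝓝 0) := by
    have := ENNReal.Tendsto.mul_const h (Or.inr hw.eLpNorm_ne_top)
    rwa [zero_mul] at this
  have h2 := (ENNReal.tendsto_toReal ENNReal.zero_ne_top).comp h1
  refine squeeze_zero_norm (fun N => ?_) h2
  have h3 : eLpNorm (f N • w) 1 P ≤ eLpNorm (f N) 2 P * eLpNorm w 2 P :=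
    eLpNorm_smul_le_mul_eLpNorm hw.1 (hf N).1
  have h4 : ‖∫ ω, f N ω * w ω ∂P‖ₑ ≤ eLpNorm (f N • w) 1 P := by
    rw [eLpNorm_one_eq_lintegral_enorm]
    exact enorm_integral_le_lintegral_enorm _
  rw [← toReal_enorm]
  exact ENNReal.toReal_mono (ENNReal.mul_ne_top (hf N).eLpNorm_ne_top hw.eLpNorm_ne_top)
    (h4.trans h3)

end Moments

/-! ### Consequences of the data-generating process -/

namespace IsDGP

variable {Ω : Type*} [MeasurableSpace Ω] {P : Measure Ω}
  {y u : Ω → ℝ} {x : ℕ → Ω → ℝ} {β : ℕ → ℝ} {σsq : ℝ} (h : IsDGP P y u x β σsq)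

include h

theorem memLp_response : MemLp y 2 P := (h.gaussian.hasGaussianLaw_eval none).memLp_two

theorem memLp_regressor (i : ℕ) : MemLp (x i) 2 P :=
  (h.gaussian.hasGaussianLaw_eval (some i)).memLp_two

theorem memLp_remainder (N : ℕ) :
    MemLp (fun ω => y ω - u ω - ∑ i ∈ Finset.range N, x i ω * β i) 2 P :=
  (h.memLp_response.sub h.error_memLp).sub
    (memLp_finsetSum _ fun i _ => (h.memLp_regressor i).mul_const _)

/-- The signal is a mean-square limit of linear combinations of regressors, so whatever is
orthogonal to every regressor is orthogonal to it. -/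
theorem integral_mul_signal {w : Ω → ℝ} (hw : MemLp w 2 P) (hx : ∀ i, ∫ ω, x i ω * w ω ∂P = 0) :
    ∫ ω, (y ω - u ω) * w ω ∂P = 0 := by
  have h1 := tendsto_integral_mul_of_eLpNorm h.memLp_remainder hw h.series
  have h2 : ∀ N, ∫ ω, (y ω - u ω - ∑ i ∈ Finset.range N, x i ω * β i) * w ω ∂P
      = ∫ ω, (y ω - u ω) * w ω ∂P := by
    intro N
    have hi : ∀ i, Integrable (fun ω => x i ω * w ω) P := fun i =>
      (h.memLp_regressor i).integrable_mul hw
    have e : ∀ ω, (y ω - u ω - ∑ i ∈ Finset.range N, x i ω * β i) * w ω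
        = (y ω - u ω) * w ω - ∑ i ∈ Finset.range N, β i * (x i ω * w ω) := by
      intro ω
      rw [sub_mul, Finset.sum_mul]
      congr 1
      exact Finset.sum_congr rfl fun i _ => by ring
    have hs : Integrable (fun ω => (y ω - u ω) * w ω) P :=
      (h.memLp_response.sub h.error_memLp).integrable_mul hw
    simp_rw [e]
    rw [integral_sub hs (integrable_finsetSum _ fun i _ => (hi i).const_mul _),
      integral_finsetSum _ fun i _ => (hi i).const_mul _]
    simp [integral_const_mul, hx]
  simp_rw [h2] at h1
  exact tendsto_nhds_unique tendsto_const_nhds h1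

theorem integral_response [IsProbabilityMeasure P] : ∫ ω, y ω ∂P = 0 := by
  have h1 := h.integral_mul_signal (w := fun _ => 1) (memLp_const 1)
    (fun i => by simpa using h.regressor_centered i)
  simp only [mul_one] at h1
  rwa [integral_sub (h.memLp_response.integrable (by norm_num))
    (h.error_memLp.integrable (by norm_num)), h.error_centered, sub_zero] at h1

theorem integral_regressor_mul_error [IsProbabilityMeasure P] (i : ℕ) : ∫ ω, x i ω * u ω ∂P = 0 := by
  have h1 : IndepFun u (x i) P := h.indep.comp measurable_id (measurable_pi_apply i)
  have h2 := h1.covariance_eq_zero h.error_memLp (h.memLp_regressor i)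
  rw [covariance_eq_sub h.error_memLp (h.memLp_regressor i), h.error_centered, zero_mul,
    sub_zero] at h2
  simpa [mul_comm] using h2

theorem integral_error_sq [IsProbabilityMeasure P] : ∫ ω, u ω ^ 2 ∂P = σsq := by
  rw [← h.error_variance, variance_eq_sub h.error_memLp, h.error_centered]
  simp

variable {κ : Type*} [Fintype κ] (φ : κ → ℕ)

omit [Fintype κ] in
theorem memLp_joint (c : κ ⊕ Unit) :
    MemLp ((Sum.elim (fun k => x (φ k)) (fun _ => y) : κ ⊕ Unit → Ω → ℝ) c) 2 P := by
  rcases c with c | c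
  · exact h.memLp_regressor _
  · exact h.memLp_response

theorem hasGaussianLaw_joint : HasGaussianLaw (fun ω c =>
    (Sum.elim (fun k => x (φ k)) (fun _ => y) : κ ⊕ Unit → Ω → ℝ) c ω) P := by
  have h1 := h.gaussian.comp_right (Sum.elim (fun k => some (φ k)) (fun _ => none) : κ ⊕ Unit → _)
  have h2 := (h1.hasGaussianLaw Finset.univ).map_fun (LinearMap.toContinuousLinearMap
    (LinearMap.funLeft ℝ ℝ (fun c : κ ⊕ Unit => (⟨c, Finset.mem_univ c⟩ : Finset.univ))))
  convert! h2 using 1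
  ext ω c
  rcases c with c | c <;> rfl

variable [IsProbabilityMeasure P]

omit [Fintype κ] in
theorem integral_joint (c : κ ⊕ Unit) :
    ∫ ω, (Sum.elim (fun k => x (φ k)) (fun _ => y) : κ ⊕ Unit → Ω → ℝ) c ω ∂P = 0 := by
  rcases c with c | c
  · exact h.regressor_centered _
  · exact h.integral_response

/-- The error contributes its full variance to every linear combination involving the
response. -/
theorem le_secondMoment (c : κ ⊕ Unit → ℝ) : σsq * c (Sum.inr ()) ^ 2
    ≤ c ⬝ᵥ (secondMoment P (Sum.elim (fun k => x (φ k)) (fun _ => y)) *ᵥ c) := by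
  rw [← integral_sq_dotProduct (h.memLp_joint φ)]
  set t := c (Sum.inr ()) with ht
  set A : Ω → ℝ := fun ω => ∑ k, c (Sum.inl k) * x (φ k) ω + t * (y ω - u ω) with hA
  have hAm : MemLp A 2 P := (memLp_finsetSum _ fun k _ =>
    (h.memLp_regressor (φ k)).const_mul (c (Sum.inl k))).add
      ((h.memLp_response.sub h.error_memLp).const_mul t)
  have hAu : ∫ ω, A ω * u ω ∂P = 0 := by
    have e : ∀ ω, A ω * u ω = ∑ k, c (Sum.inl k) * (x (φ k) ω * u ω)
        + t * ((y ω - u ω) * u ω) := by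
      intro ω
      rw [hA]
      simp only [add_mul, Finset.sum_mul, mul_assoc]
    have hi : ∀ k, Integrable (fun ω => x (φ k) ω * u ω) P := fun k =>
      (h.memLp_regressor _).integrable_mul h.error_memLp
    have hs : Integrable (fun ω => (y ω - u ω) * u ω) P :=
      (h.memLp_response.sub h.error_memLp).integrable_mul h.error_memLp
    simp_rw [e]
    rw [integral_add (integrable_finsetSum _ fun k _ => (hi k).const_mul _) (hs.const_mul t),
      integral_finsetSum _ fun k _ => (hi k).const_mul _]
    simp [integral_const_mul, h.integral_regressor_mul_error,
      h.integral_mul_signal h.error_memLp h.integral_regressor_mul_error]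
  have e : ∀ ω, (c ⬝ᵥ fun i => (Sum.elim (fun k => x (φ k)) (fun _ => y) : κ ⊕ Unit → Ω → ℝ) i ω) ^ 2
      = A ω ^ 2 + 2 * t * (A ω * u ω) + t ^ 2 * u ω ^ 2 := by
    intro ω
    rw [hA, dotProduct, Fintype.sum_sum_type]
    simp only [Sum.elim_inl, Sum.elim_inr, Fintype.univ_punit, Finset.sum_singleton]
    rw [show c (Sum.inr PUnit.unit) = t from rfl]
    ring
  simp_rw [e]
  have i1 : Integrable (fun ω => A ω ^ 2) P := hAm.integrable_sq
  have i2 : Integrable (fun ω => 2 * t * (A ω * u ω)) P :=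
    (hAm.integrable_mul h.error_memLp).const_mul _
  have i3 : Integrable (fun ω => t ^ 2 * u ω ^ 2) P := h.error_memLp.integrable_sq.const_mul _
  have i12 : Integrable (fun ω => A ω ^ 2 + 2 * t * (A ω * u ω)) P := i1.add i2
  rw [integral_add i12 i3, integral_add i1 i2, integral_const_mul, integral_const_mul, hAu,
    h.integral_error_sq]
  have : 0 ≤ ∫ ω, A ω ^ 2 ∂P := integral_nonneg fun ω => sq_nonneg _
  linarith

/-- If the response has a nonzero coefficient, the error alone makes the form positive; otherwise
only regressors are involved, and injectivity of `φ` reduces to the assumed covariance matrices. -/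
theorem posDef_secondMoment (hφ : Function.Injective φ) :
    (secondMoment P (Sum.elim (fun k => x (φ k)) (fun _ => y) : κ ⊕ Unit → Ω → ℝ)).PosDef := by
  classical
  refine Matrix.PosDef.of_dotProduct_mulVec_pos ?_ fun c hc => ?_
  · ext i j
    simp [secondMoment, mul_comm]
  · rw [star_trivial]
    by_cases ht : c (Sum.inr ()) = 0
    · set I := Finset.univ.image φ with hI
      have hS := (h.cov_posDef I).submatrix
        (e := fun k => ⟨φ k, Finset.mem_image_of_mem φ (Finset.mem_univ k)⟩)
        (fun k l hkl => hφ (congrArg Subtype.val hkl))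
      have hc' : (fun k => c (Sum.inl k)) ≠ 0 := by
        intro h0
        apply hc
        ext k
        rcases k with k | k
        · exact congrFun h0 k
        · exact ht
      have hpos := hS.dotProduct_mulVec_pos hc'
      rw [star_trivial] at hpos
      convert! hpos using 1
      simp [dotProduct, Matrix.mulVec, Fintype.sum_sum_type, ht, secondMoment]
    · have h1 := h.le_secondMoment φ c
      have h2 : 0 < σsq * c (Sum.inr ()) ^ 2 :=
        mul_pos h.variance_pos (by positivity)
      linarith

end IsDGP


/-! ### The triangular factor of regressors and response -/

section Factor

variable {α β : Type*} [Fintype α] [Fintype β] [DecidableEq α] [DecidableEq β]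

/-- The block triangular factor of the joint distribution of regressors and response. -/
def jointFactor (L₁ : Matrix α α ℝ) (B : Matrix α β ℝ) (L₂ : Matrix β β ℝ) (a : α → ℝ) (b : β → ℝ)
    (σ : ℝ) : Matrix ((α ⊕ β) ⊕ Unit) ((α ⊕ β) ⊕ Unit) ℝ :=
  Matrix.fromBlocks (Matrix.fromBlocks L₁ B 0 L₂) (Matrix.of fun i _ => Sum.elim a b i) 0
    (Matrix.of fun _ _ => σ)

variable {L₁ : Matrix α α ℝ} {B : Matrix α β ℝ} {L₂ : Matrix β β ℝ} {a : α → ℝ} {b : β → ℝ} {σ : ℝ}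

theorem isUnit_det_jointFactor (h₁ : IsUnit L₁.det) (h₂ : IsUnit L₂.det) (hσ : 0 < σ) :
    IsUnit (jointFactor L₁ B L₂ a b σ).det := by
  rw [jointFactor, Matrix.det_fromBlocks_zero₂₁, Matrix.det_fromBlocks_zero₂₁,
    Matrix.det_unique (n := Unit)]
  exact (h₁.mul h₂).mul hσ.ne'.isUnit

omit [DecidableEq α] [DecidableEq β] in
theorem vecMul_jointFactor_inl_inl (z : (α ⊕ β) ⊕ Unit → ℝ) (i : α) :
    (z ᵥ* jointFactor L₁ B L₂ a b σ) (Sum.inl (Sum.inl i))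
      = ∑ c, z (Sum.inl (Sum.inl c)) * L₁ c i := by
  simp [Matrix.vecMul, dotProduct, jointFactor, Fintype.sum_sum_type]

omit [DecidableEq α] [DecidableEq β] in
theorem vecMul_jointFactor_inl_inr (z : (α ⊕ β) ⊕ Unit → ℝ) (i : β) :
    (z ᵥ* jointFactor L₁ B L₂ a b σ) (Sum.inl (Sum.inr i))
      = ∑ c, z (Sum.inl (Sum.inl c)) * B c i + ∑ c, z (Sum.inl (Sum.inr c)) * L₂ c i := by
  simp [Matrix.vecMul, dotProduct, jointFactor, Fintype.sum_sum_type]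

omit [DecidableEq α] [DecidableEq β] in
theorem vecMul_jointFactor_inr (z : (α ⊕ β) ⊕ Unit → ℝ) :
    (z ᵥ* jointFactor L₁ B L₂ a b σ) (Sum.inr ()) = respWeights σ a b ⬝ᵥ z := by
  simp [Matrix.vecMul, dotProduct, jointFactor, respWeights, Fintype.sum_sum_type, mul_comm]

omit [DecidableEq α] [DecidableEq β] in
theorem jointFactor_mulVec (j₁ : α → ℝ) (j₂ : β → ℝ) (t : ℝ) :
    jointFactor L₁ B L₂ a b σ *ᵥ Sum.elim (Sum.elim j₁ j₂) (fun _ => t)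
      = Sum.elim (Sum.elim (L₁ *ᵥ j₁ + B *ᵥ j₂ + t • a) (L₂ *ᵥ j₂ + t • b)) (fun _ => t * σ) := by
  ext c
  rcases c with (c | c) | c <;>
  simp [Matrix.mulVec, dotProduct, jointFactor, Fintype.sum_sum_type, mul_comm]

/-- Positive definite matrices have a block triangular factorization. -/
theorem exists_jointFactor {S : Matrix ((α ⊕ β) ⊕ Unit) ((α ⊕ β) ⊕ Unit) ℝ} (hS : S.PosDef) :
    ∃ (L₁ : Matrix α α ℝ) (B : Matrix α β ℝ) (L₂ : Matrix β β ℝ) (a : α → ℝ) (b : β → ℝ) (σ : ℝ),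
      IsUnit L₁.det ∧ IsUnit L₂.det ∧ 0 < σ ∧
      S = (jointFactor L₁ B L₂ a b σ)ᵀ * jointFactor L₁ B L₂ a b σ := by
  have hSκ : S.toBlocks₁₁.PosDef := hS.submatrix (e := Sum.inl) Sum.inl_injective
  have hS₁ : S.toBlocks₁₁.toBlocks₁₁.PosDef := hSκ.submatrix (e := Sum.inl) Sum.inl_injective
  obtain ⟨L₁, -, hL₁, h₁⟩ := exists_posSemidef_sqrt hS₁
  obtain ⟨B, L₂, -, hL₂, h₂⟩ := exists_block_cholesky hSκ hL₁ h₁.symm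
  obtain ⟨A, Q, hQ, hQu, h₃⟩ := exists_block_cholesky hS
    (L₁ := Matrix.fromBlocks L₁ B 0 L₂)
    (by rw [Matrix.det_fromBlocks_zero₂₁]; exact hL₁.mul hL₂) h₂
  refine ⟨L₁, B, L₂, fun i => A (Sum.inl i) (), fun i => A (Sum.inr i) (), Q () (), hL₁, hL₂, ?_, ?_⟩
  · rw [Matrix.det_unique] at hQu
    exact lt_of_le_of_ne (hQ.diag_nonneg) hQu.ne_zero.symm
  · have hA : (Matrix.of fun i (_ : Unit) =>
        Sum.elim (fun i => A (Sum.inl i) ()) (fun i => A (Sum.inr i) ()) i) = A := by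
      ext i j
      rcases i with i | i <;> rfl
    rw [jointFactor, hA]
    exact h₃

end Factor

/-! ### Observations and predictions within a model -/

namespace Model

variable (m : Model)

/-- The regressors of the model. -/
def index : m.block₁ ⊕ m.block₂ → ℕ := Sum.elim Subtype.val Subtype.val

theorem index_injective : Function.Injective m.index :=
  Function.Injective.sumElim Subtype.val_injective Subtype.val_injective fun i j hij =>
    Finset.disjoint_left.1 m.disj i.2 (by rw [hij]; exact j.2)

/-- Regressors of the model and response of an observation. -/
def obs (p : ℝ × (ℕ → ℝ)) : (m.block₁ ⊕ m.block₂) ⊕ Unit → ℝ :=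
  Sum.elim (fun k => p.2 (m.index k)) (fun _ => p.1)

theorem measurable_obs : Measurable m.obs := by
  refine measurable_pi_iff.2 fun c => ?_
  rcases c with c | c
  · exact (measurable_pi_apply (m.index c)).comp measurable_snd
  · exact measurable_fst

variable {n : ℕ} (c₁ c₂ : ℝ) (X : Fin n → ℕ → ℝ) (Y : Fin n → ℝ)

theorem tsum_betaHat (z : ℕ → ℝ) : ∑' i, z i * m.betaHat c₁ c₂ X Y i
    = ∑ i : m.block₁, z i * m.js₁ c₁ c₂ X Y i + ∑ i : m.block₂, z i * m.js₂ c₂ X Y i := by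
  classical
  rw [tsum_eq_sum (s := m.block₁ ∪ m.block₂), Finset.sum_union m.disj, ← Finset.sum_coe_sort m.block₁,
    ← Finset.sum_coe_sort m.block₂]
  · congr 1
    · refine Finset.sum_congr rfl fun i _ => ?_
      rw [betaHat, dif_pos i.2]
    · refine Finset.sum_congr rfl fun i _ => ?_
      rw [betaHat, dif_neg (Finset.disjoint_right.1 m.disj i.2), dif_pos i.2]
  · intro i hi
    rw [Finset.mem_union, not_or] at hi
    rw [betaHat, dif_neg hi.1, dif_neg hi.2, mul_zero]

end Model

/-! ### Law of the standardized sample and the exact prediction error -/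

section Sampling

variable {Ω : Type*} [MeasurableSpace Ω] {P : Measure Ω} [IsProbabilityMeasure P]
  {y u : Ω → ℝ} {x : ℕ → Ω → ℝ} {β : ℕ → ℝ} {σsq : ℝ} {n : ℕ}
  {ys : Fin (n + 1) → Ω → ℝ} {xs : Fin (n + 1) → ℕ → Ω → ℝ} {m : Model}
  {L₁ : Matrix m.block₁ m.block₁ ℝ} {B : Matrix m.block₁ m.block₂ ℝ}
  {L₂ : Matrix m.block₂ m.block₂ ℝ} {a : m.block₁ → ℝ} {b : m.block₂ → ℝ} {σ : ℝ}

/-- The joint second moments of the regressors in `m` and the response have the given factor. -/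
structure HasFactor (P : Measure Ω) (y : Ω → ℝ) (x : ℕ → Ω → ℝ) (m : Model)
    (L₁ : Matrix m.block₁ m.block₁ ℝ) (B : Matrix m.block₁ m.block₂ ℝ)
    (L₂ : Matrix m.block₂ m.block₂ ℝ) (a : m.block₁ → ℝ) (b : m.block₂ → ℝ) (σ : ℝ) : Prop where
  det₁ : IsUnit L₁.det
  det₂ : IsUnit L₂.det
  pos : 0 < σ
  moment_eq : secondMoment P (Sum.elim (fun k => x (m.index k)) (fun _ => y))
    = (jointFactor L₁ B L₂ a b σ)ᵀ * jointFactor L₁ B L₂ a b σ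

theorem IsDGP.exists_hasFactor (h : IsDGP P y u x β σsq) (m : Model) :
    ∃ L₁ B L₂ a b σ, HasFactor P y x m L₁ B L₂ a b σ := by
  obtain ⟨L₁, B, L₂, a, b, σ, h₁, h₂, h₃, h₄⟩ :=
    exists_jointFactor (h.posDef_secondMoment m.index m.index_injective)
  exact ⟨L₁, B, L₂, a, b, σ, h₁, h₂, h₃, h₄⟩

theorem dotProduct_transpose_mul_self {ι : Type*} [Fintype ι] (A : Matrix ι ι ℝ) (c : ι → ℝ) :
    c ⬝ᵥ ((Aᵀ * A) *ᵥ c) = (A *ᵥ c) ⬝ᵥ (A *ᵥ c) := by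
  rw [← Matrix.mulVec_mulVec, Matrix.dotProduct_mulVec, Matrix.vecMul_transpose]

omit [IsProbabilityMeasure P] in
theorem hasLaw_stdM_of_iIndepFun {ι κ : Type*} [Fintype ι] [Fintype κ] {Z : ι → Ω → κ → ℝ}
    (hind : iIndepFun Z P) (hlaw : ∀ j, HasLaw (Z j) (stdG κ) P) :
    HasLaw (fun ω c j => Z j ω c) (stdM κ ι) P := by
  have htr := measurePreserving_transpose (κ := ι) (ι := κ)
  have hl : HasLaw (fun ω j => Z j ω) (stdM ι κ) P := hind.hasLaw_pi hlaw
  exact HasLaw.comp ⟨htr.measurable.aemeasurable, htr.map_eq⟩ hl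

namespace HasFactor

variable (hf : HasFactor P y x m L₁ B L₂ a b σ) (h : IsDGP P y u x β σsq)

include hf h

/-- The combination with whitened coordinates equal to the last unit vector has second moment 1 and
response coefficient 1/σ, and `le_secondMoment` bounds it below by σsq/σ². Thus the error variance
is at most the unexplained variance in the model. -/
theorem le_sq : σsq ≤ σ ^ 2 := by
  set Λ := jointFactor L₁ B L₂ a b σ with hΛ
  have hu : IsUnit Λ.det := isUnit_det_jointFactor hf.det₁ hf.det₂ hf.pos
  set e : (m.block₁ ⊕ m.block₂) ⊕ Unit → ℝ := Sum.elim 0 (fun _ => 1) with he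
  set c := Λ⁻¹ *ᵥ e with hc
  have hΛc : Λ *ᵥ c = e := by
    rw [hc, Matrix.mulVec_mulVec, Matrix.mul_nonsing_inv _ hu, Matrix.one_mulVec]
  have hlast : σ * c (Sum.inr ()) = 1 := by
    have := congrFun hΛc (Sum.inr ())
    simpa [hΛ, jointFactor, Matrix.mulVec, dotProduct, Fintype.sum_sum_type, he] using this
  have h1 := h.le_secondMoment m.index c
  rw [hf.moment_eq, dotProduct_transpose_mul_self, hΛc] at h1
  have h2 : e ⬝ᵥ e = 1 := by rw [he, sumElim_dotProduct]; simp [dotProduct]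
  rw [h2] at h1
  calc σsq = σsq * (σ * c (Sum.inr ())) ^ 2 := by rw [hlast]; ring
    _ = σ ^ 2 * (σsq * c (Sum.inr ()) ^ 2) := by ring
    _ ≤ σ ^ 2 * 1 := mul_le_mul_of_nonneg_left h1 (sq_nonneg _)
    _ = σ ^ 2 := mul_one _

theorem variance_eq : Var[y; P] = a ⬝ᵥ a + b ⬝ᵥ b + σ ^ 2 := by
  have h1 : ∫ ω, y ω * y ω ∂P = a ⬝ᵥ a + b ⬝ᵥ b + σ ^ 2 := by
    have := congrFun (congrFun hf.moment_eq (Sum.inr ())) (Sum.inr ())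
    rw [secondMoment, Matrix.of_apply] at this
    refine this.trans ?_
    simp [Matrix.mul_apply, jointFactor, Fintype.sum_sum_type, dotProduct, sq]
  rw [variance_eq_sub h.memLp_response, h.integral_response, ← h1]
  simp [sq]

theorem hasLaw_obs : HasLaw (fun ω => m.obs (y ω, fun i => x i ω) ᵥ* (jointFactor L₁ B L₂ a b σ)⁻¹)
    (stdG ((m.block₁ ⊕ m.block₂) ⊕ Unit)) P := by
  have hl := hasLaw_vecMul_inv (h.hasGaussianLaw_joint m.index) (h.integral_joint m.index)
    (isUnit_det_jointFactor hf.det₁ hf.det₂ hf.pos) hf.moment_eq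
  convert! hl using 2
  congr 1
  ext c
  rcases c with c | c <;> rfl

variable (hiid : IsIIDCopies P y x ys xs)

include hiid

theorem hasLaw_obs_copy (j : Fin (n + 1)) :
    HasLaw (fun ω => m.obs (ys j ω, fun i => xs j i ω) ᵥ* (jointFactor L₁ B L₂ a b σ)⁻¹)
      (stdG ((m.block₁ ⊕ m.block₂) ⊕ Unit)) P := by
  have hm : Measurable fun p : ℝ × (ℕ → ℝ) => m.obs p ᵥ* (jointFactor L₁ B L₂ a b σ)⁻¹ :=
    measurable_vecMul measurable_const m.measurable_obs
  have hid := (hiid.ident j).comp hm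
  exact ⟨hid.aemeasurable_fst, hid.map_eq.trans (hf.hasLaw_obs h).map_eq⟩

/-- The standardized training sample has independent standard normal entries. -/
theorem hasLaw_sample : HasLaw (fun ω c (j : Fin n) => (m.obs (ys j.succ ω, fun i => xs j.succ i ω)
      ᵥ* (jointFactor L₁ B L₂ a b σ)⁻¹) c)
    (stdM ((m.block₁ ⊕ m.block₂) ⊕ Unit) (Fin n)) P := by
  have hm : Measurable fun p : ℝ × (ℕ → ℝ) => m.obs p ᵥ* (jointFactor L₁ B L₂ a b σ)⁻¹ :=
    measurable_vecMul measurable_const m.measurable_obs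
  have hind := (hiid.indep.precomp (Fin.succ_injective n)).comp
    (fun _ p => m.obs p ᵥ* (jointFactor L₁ B L₂ a b σ)⁻¹) fun _ => hm
  exact hasLaw_stdM_of_iIndepFun hind fun j => hf.hasLaw_obs_copy h hiid j.succ

omit h hiid [IsProbabilityMeasure P] in
theorem vecMul_inv_vecMul (v : (m.block₁ ⊕ m.block₂) ⊕ Unit → ℝ) :
    (v ᵥ* (jointFactor L₁ B L₂ a b σ)⁻¹) ᵥ* jointFactor L₁ B L₂ a b σ = v := by
  rw [Matrix.vecMul_vecMul, Matrix.nonsing_inv_mul _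
    (isUnit_det_jointFactor hf.det₁ hf.det₂ hf.pos), Matrix.vecMul_one]

omit h hiid [IsProbabilityMeasure P] in
theorem factorized (ω : Ω) : Factorized m (fun j i => xs (Fin.succ j) i ω) (fun j => ys j.succ ω)
    L₁ B L₂ a b σ (fun c (j : Fin n) => (m.obs (ys j.succ ω, fun i => xs j.succ i ω)
      ᵥ* (jointFactor L₁ B L₂ a b σ)⁻¹) c) where
  det₁ := hf.det₁
  det₂ := hf.det₂
  X₁_eq := by
    ext j i
    rw [Matrix.mul_apply]
    simp only [Matrix.transpose_apply, Matrix.of_apply]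
    rw [← vecMul_jointFactor_inl_inl (B := B) (L₂ := L₂) (a := a) (b := b) (σ := σ),
      hf.vecMul_inv_vecMul]
    rfl
  X₂_eq := by
    ext j i
    rw [Matrix.add_apply, Matrix.mul_apply, Matrix.mul_apply]
    simp only [Matrix.transpose_apply, Matrix.of_apply]
    rw [← vecMul_jointFactor_inl_inr (L₁ := L₁) (a := a) (b := b) (σ := σ),
      hf.vecMul_inv_vecMul]
    rfl
  Y_eq := by
    ext j
    have h1 := vecMul_jointFactor_inr (L₁ := L₁) (B := B) (L₂ := L₂) (a := a) (b := b) (σ := σ)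
      (m.obs (ys j.succ ω, fun i => xs j.succ i ω) ᵥ* (jointFactor L₁ B L₂ a b σ)⁻¹)
    rw [hf.vecMul_inv_vecMul] at h1
    exact h1

/-- The new prediction error is a fixed linear functional of a whitened observation, so its mean
square is the squared length of Λ(θ, -1), read off block by block. -/
theorem rhoSq_eq (c₁ c₂ : ℝ) (X : Fin n → ℕ → ℝ) (Y : Fin n → ℝ) :
    m.rhoSq c₁ c₂ X Y P (ys 0) (xs 0)
      = σ ^ 2 + ((L₁ *ᵥ m.js₁ c₁ c₂ X Y + B *ᵥ m.js₂ c₂ X Y - a) ⬝ᵥ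
        (L₁ *ᵥ m.js₁ c₁ c₂ X Y + B *ᵥ m.js₂ c₂ X Y - a)
      + (L₂ *ᵥ m.js₂ c₂ X Y - b) ⬝ᵥ (L₂ *ᵥ m.js₂ c₂ X Y - b)) := by
  set Λ := jointFactor L₁ B L₂ a b σ with hΛ
  set θ : (m.block₁ ⊕ m.block₂) ⊕ Unit → ℝ :=
    Sum.elim (Sum.elim (m.js₁ c₁ c₂ X Y) (m.js₂ c₂ X Y)) (fun _ => -1) with hθ
  have e : ∀ ω, (∑' i, xs 0 i ω * m.betaHat c₁ c₂ X Y i) - ys 0 ω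
      = (Λ *ᵥ θ) ⬝ᵥ (m.obs (ys 0 ω, fun i => xs 0 i ω) ᵥ* Λ⁻¹) := by
    intro ω
    rw [dotProduct_comm, Matrix.dotProduct_mulVec, hf.vecMul_inv_vecMul,
      m.tsum_betaHat c₁ c₂ X Y (fun i => xs 0 i ω)]
    simp [Model.obs, hθ, dotProduct, Fintype.sum_sum_type, Model.index, sub_eq_add_neg]
  have hlaw := hf.hasLaw_obs_copy h hiid 0
  rw [Model.rhoSq]
  simp_rw [e]
  have h1 := hlaw.integral_comp (f := fun w => ((Λ *ᵥ θ) ⬝ᵥ w) ^ 2)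
    (by
      have : Measurable fun w : (m.block₁ ⊕ m.block₂) ⊕ Unit → ℝ => ((Λ *ᵥ θ) ⬝ᵥ w) ^ 2 :=
        (measurable_dotProduct measurable_const measurable_id).pow_const 2
      exact this.aestronglyMeasurable)
  refine (h1.trans (integral_sq_dotProduct_stdG _)).trans ?_
  rw [hθ, hΛ, jointFactor_mulVec, sumElim_dotProduct, sumElim_dotProduct, const_dotProduct_unit]
  simp only [neg_smul, one_smul, ← sub_eq_add_neg]
  ring

end HasFactor

end Sampling


/-! ### Probability bounds for one model and for the collection -/

section Bound

variable {Ω : Type*} [MeasurableSpace Ω] {P : Measure Ω} [IsProbabilityMeasure P]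
  {y u : Ω → ℝ} {x : ℕ → Ω → ℝ} {β : ℕ → ℝ} {σsq : ℝ} {n : ℕ}
  {ys : Fin (n + 1) → Ω → ℝ} {xs : Fin (n + 1) → ℕ → Ω → ℝ} {c₁ c₂ ε K : ℝ}

/-- Inserting `τ` in the exponent (n-k)τ²/(21/5), with n-k = nη, gives nη⁵ε²/((1+ε)²K²) over
50²·21/5 = 10500. -/
theorem model_bound (h : IsDGP P y u x β σsq) (hiid : IsIIDCopies P y x ys xs) {m : Model}
    (hm : 0 < m.size₁) (hk : m.size < n) (hc₁ : 0 ≤ c₁) (hc₂ : 0 ≤ c₂) (hε : 0 < ε) (hK1 : 1 ≤ K)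
    (hK : (n : ℝ) + 1 ≤ K * m.size₁ ∨ Var[y; P] / σsq ≤ K) :
    P {ω | ENNReal.ofReal ε ≤ absLog
        (m.rhoHatSq c₁ c₂ (fun (j : Fin n) i => xs j.succ i ω) (fun j => ys j.succ ω) /
          m.rhoSq c₁ c₂ (fun (j : Fin n) i => xs j.succ i ω) (fun j => ys j.succ ω) P
            (ys 0) (xs 0))}
      ≤ ENNReal.ofReal (34 * Real.exp (-((n : ℝ) * (1 - (m.size : ℝ) / n) ^ 5 *
        (ε ^ 2 / (10500 * (1 + ε) ^ 2)) / K ^ 2))) := by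
  obtain ⟨L₁, B, L₂, a, b, σ, hf⟩ := h.exists_hasFactor m
  have hkR : (m.size : ℝ) < n := by exact_mod_cast hk
  have hn : (0 : ℝ) < n := lt_of_le_of_lt (Nat.cast_nonneg _) hkR
  obtain ⟨η, hη⟩ : ∃ η : ℝ, η = 1 - m.size / (n : ℝ) := ⟨_, rfl⟩
  obtain ⟨τ, hτ⟩ : ∃ τ : ℝ, τ = η ^ 2 * (ε / (50 * (1 + ε))) / K := ⟨_, rfl⟩
  have hηn : (n : ℝ) - m.size = n * η := by rw [hη]; field_simp
  have hη0 : 0 < η := by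
    have : 0 < (n : ℝ) * η := by rw [← hηn]; linarith
    exact (mul_pos_iff_of_pos_left hn).1 this
  have hη1 : η ≤ 1 := by
    rw [hη]; linarith [div_nonneg (Nat.cast_nonneg m.size : (0 : ℝ) ≤ m.size) hn.le]
  have hc50 : ε / (50 * (1 + ε)) ≤ 1 / 50 := by
    rw [div_le_div_iff₀ (by positivity) (by norm_num)]; linarith
  have hτ0 : 0 ≤ τ := by rw [hτ]; positivity
  have hτη : τ ≤ η ^ 2 * (1 / 50) := by
    rw [hτ]
    exact (div_le_self (by positivity) hK1).trans (mul_le_mul_of_nonneg_left hc50 (sq_nonneg _))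
  have hη2 : η ^ 2 ≤ η := pow_le_of_le_one hη0.le hη1 two_ne_zero
  have hKb : (n : ℝ) + 1 ≤ K * m.size₁ ∨ b ⬝ᵥ b ≤ K * σ ^ 2 := by
    refine hK.imp_right fun hK => ?_
    rw [div_le_iff₀ h.variance_pos, hf.variance_eq h] at hK
    have h1 : K * σsq ≤ K * σ ^ 2 := mul_le_mul_of_nonneg_left (hf.le_sq h) (by linarith)
    have h2 := dotProduct_self_nonneg' a
    have h3 := sq_nonneg σ
    linarith
  have hne : Nonempty m.block₁ := (Finset.card_pos.1 hm).to_subtype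
  have hbound := good_compl_le (ι := Fin n) (τ := τ) (n := (n : ℝ)) (k := (m.size : ℝ))
    (k₁ := (m.size₁ : ℝ)) hf.pos a b (by simp) (by simp [Model.size, Model.size₁, Model.size₂])
    (by simp [Model.size₁]) hkR hτ0 (by linarith) (by
      have : τ * n ≤ η * n := mul_le_mul_of_nonneg_right (by linarith) hn.le
      linarith)
  have hlaw := hf.hasLaw_sample h hiid
  have hexp : ((n : ℝ) - m.size) * τ ^ 2 / (21 / 5)
      = (n : ℝ) * η ^ 5 * (ε ^ 2 / (10500 * (1 + ε) ^ 2)) / K ^ 2 := by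
    rw [hηn, hτ]
    have : (1 + ε) ≠ 0 := by linarith
    have : K ≠ 0 := by linarith
    field_simp
    norm_num
  rw [hexp] at hbound
  rw [← hη]
  -- The push-forward inequality for arbitrary sets is used, so measurability of the good event and
  -- of the error ratio is not required.
  refine (measure_mono ?_).trans ((Measure.le_map_apply hlaw.aemeasurable _).trans
    (hlaw.map_eq ▸ hbound))
  intro ω hω hgood
  exact absurd hω (not_le.2 (absLog_lt_of_good (hf.factorized ω) hf.pos hk hc₁ hc₂ hη hK1 hKb hε
    hτ hgood (hf.rhoSq_eq h hiid _ _ _ _)))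

/-- The rate decreases with the model size, so each model obeys the bound at the largest size `s`;
the prefactor 34 is absorbed into 31s because s ≥ 2. -/
theorem union_bound (h : IsDGP P y u x β σsq) (hiid : IsIIDCopies P y x ys xs)
    {M : Finset Model} (hM₁ : ∀ m ∈ M, 3 ≤ m.size₁) (hMn : ∀ m ∈ M, m.size < n)
    {s : ℕ} (hs : ∀ m ∈ M, m.size ≤ s) (hs2 : 2 ≤ s) (hsn : s < n)
    (hc₁ : 0 ≤ c₁) (hc₂ : 0 ≤ c₂) (hε : 0 < ε) (hK1 : 1 ≤ K)
    (hK : (∀ m ∈ M, (n : ℝ) + 1 ≤ K * m.size₁) ∨ Var[y; P] / σsq ≤ K) :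
    P.real {ω | ENNReal.ofReal ε ≤ ⨆ m ∈ M, absLog
        (m.rhoHatSq c₁ c₂ (fun (j : Fin n) i => xs j.succ i ω) (fun j => ys j.succ ω) /
          m.rhoSq c₁ c₂ (fun (j : Fin n) i => xs j.succ i ω) (fun j => ys j.succ ω) P
            (ys 0) (xs 0))}
      ≤ 31 * (M.card : ℝ) * (s : ℝ) * Real.exp (-((n : ℝ) * (1 - (s : ℝ) / n) ^ 5 *
        (ε ^ 2 / (10500 * (1 + ε) ^ 2)) / K ^ 2)) := by
  have hsR : (s : ℝ) < n := by exact_mod_cast hsn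
  have hs2R : (2 : ℝ) ≤ s := by exact_mod_cast hs2
  have hn : (0 : ℝ) < n := by linarith
  set E := (n : ℝ) * (1 - (s : ℝ) / n) ^ 5 * (ε ^ 2 / (10500 * (1 + ε) ^ 2)) / K ^ 2 with hE
  set F : Model → Ω → ℝ≥0∞ := fun m ω => absLog
    (m.rhoHatSq c₁ c₂ (fun (j : Fin n) i => xs j.succ i ω) (fun j => ys j.succ ω) /
      m.rhoSq c₁ c₂ (fun (j : Fin n) i => xs j.succ i ω) (fun j => ys j.succ ω) P
        (ys 0) (xs 0)) with hF
  have hmodel : ∀ m ∈ M, P {ω | ENNReal.ofReal ε ≤ F m ω}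
      ≤ ENNReal.ofReal (34 * Real.exp (-E)) := by
    intro m hm
    refine (model_bound h hiid (by have := hM₁ m hm; omega) (hMn m hm) hc₁ hc₂ hε hK1
      (hK.imp_left fun hK => hK m hm)).trans (ENNReal.ofReal_le_ofReal ?_)
    have h1 : (m.size : ℝ) / n ≤ s / n :=
      div_le_div_of_nonneg_right (by exact_mod_cast hs m hm) hn.le
    have h2 : (s : ℝ) / n ≤ 1 := (div_le_one hn).2 hsR.le
    have h3 : (1 - (s : ℝ) / n) ^ 5 ≤ (1 - (m.size : ℝ) / n) ^ 5 :=
      pow_le_pow_left₀ (by linarith) (by linarith) 5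
    rw [hE]
    gcongr
  have hsub : {ω | ENNReal.ofReal ε ≤ ⨆ m ∈ M, F m ω}
      ⊆ ⋃ m ∈ M, {ω | ENNReal.ofReal ε ≤ F m ω} := by
    intro ω hω
    by_contra hcon
    simp only [Set.mem_iUnion, Set.mem_ofPred_eq, exists_prop, not_exists, not_and, not_le] at hcon
    have hlt : M.sup (fun m => F m ω) < ENNReal.ofReal ε :=
      (Finset.sup_lt_iff (by simpa using hε)).2 hcon
    rw [Finset.sup_eq_iSup] at hlt
    exact absurd hω (not_le.2 hlt)
  have htot : P {ω | ENNReal.ofReal ε ≤ ⨆ m ∈ M, F m ω}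
      ≤ ENNReal.ofReal (M.card * (34 * Real.exp (-E))) := by
    refine (measure_mono hsub).trans ((measure_biUnion_finset_le M _).trans
      ((Finset.sum_le_sum hmodel).trans (le_of_eq ?_)))
    rw [Finset.sum_const, nsmul_eq_mul, ENNReal.ofReal_mul (Nat.cast_nonneg M.card), ENNReal.ofReal_natCast]
  refine (ENNReal.toReal_le_of_le_ofReal (by positivity) htot).trans ?_
  have h4 : (34 : ℝ) ≤ 31 * s := by linarith
  calc (M.card : ℝ) * (34 * Real.exp (-E)) ≤ M.card * (31 * s * Real.exp (-E)) := by gcongr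
    _ = _ := by ring

end Bound

end BlockJS

/-! ### Constants of the two bounds -/

theorem lemma1 {Ω : Type*} [MeasurableSpace Ω] (P : Measure Ω) [IsProbabilityMeasure P]
    (n : ℕ)
    -- tuning parameters
    (c₁ c₂ : ℝ) (hc₁ : 0 ≤ c₁) (hc₂ : 0 ≤ c₂)
    -- the collection of candidate models
    (M : Finset BlockJS.Model) (hM : M.Nonempty)
    (hM₁ : ∀ m ∈ M, 3 ≤ m.size₁) (hM₂ : ∀ m ∈ M, 3 ≤ m.size₂) (hMn : ∀ m ∈ M, m.size < n)
    (r s : ℕ) (hr : r = M.inf' hM BlockJS.Model.size₁) (hs : s = M.sup' hM BlockJS.Model.size)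
    -- the data-generating process
    (y u : Ω → ℝ) (x : ℕ → Ω → ℝ) (β : ℕ → ℝ) (σsq : ℝ)
    (hdgp : BlockJS.IsDGP P y u x β σsq)
    -- the new observation (index 0) and the training sample (indices 1, ..., n)
    (ys : Fin (n + 1) → Ω → ℝ) (xs : Fin (n + 1) → ℕ → Ω → ℝ)
    (hiid : BlockJS.IsIIDCopies P y x ys xs)
    (X : Ω → Fin n → ℕ → ℝ) (hX : X = fun ω j i => xs j.succ i ω)
    (Y : Ω → Fin n → ℝ) (hY : Y = fun ω j => ys j.succ ω)
    (ε : ℝ) (hε : 0 < ε) :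
    P.real {ω | ENNReal.ofReal ε ≤ ⨆ m ∈ M, BlockJS.absLog
        (m.rhoHatSq c₁ c₂ (X ω) (Y ω) / m.rhoSq c₁ c₂ (X ω) (Y ω) P (ys 0) (xs 0))}
      ≤ 31 * (M.card : ℝ) * (s : ℝ) *
        Real.exp (-((n : ℝ) * ((r : ℝ) / n) ^ 2 * (1 - (s : ℝ) / n) ^ 5 *
          (ε ^ 2 / (14397 * (1 + ε) ^ 2)))) ∧
    ∀ d : ℝ, 0 < d → Var[y; P] / σsq ≤ d →
      P.real {ω | ENNReal.ofReal ε ≤ ⨆ m ∈ M, BlockJS.absLog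
          (m.rhoHatSq c₁ c₂ (X ω) (Y ω) / m.rhoSq c₁ c₂ (X ω) (Y ω) P (ys 0) (xs 0))}
        ≤ 31 * (M.card : ℝ) * (s : ℝ) *
          Real.exp (-((n : ℝ) * (1 - (s : ℝ) / n) ^ 5 *
            (ε ^ 2 / (28279 * (1 + ε) ^ 2 * d ^ 2)))) := by
  subst hX hY
  obtain ⟨m₀, hm₀⟩ := hM
  have hsm : ∀ m ∈ M, m.size ≤ s := fun m hm => hs ▸ Finset.le_sup' BlockJS.Model.size hm
  have hrm : ∀ m ∈ M, r ≤ m.size₁ := fun m hm => hr ▸ Finset.inf'_le BlockJS.Model.size₁ hm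
  have hsn : s < n := hs ▸ (Finset.sup'_lt_iff _).2 hMn
  have hr3 : 3 ≤ r := hr ▸ (Finset.le_inf'_iff _ _).2 hM₁
  have hs6 : 6 ≤ s := by
    have h1 := hsm m₀ hm₀
    have h2 := hM₁ m₀ hm₀
    have h3 := hM₂ m₀ hm₀
    rw [BlockJS.Model.size] at h1
    omega
  have hrn : r ≤ n := by
    have h1 := hrm m₀ hm₀
    have h2 := hMn m₀ hm₀
    rw [BlockJS.Model.size] at h2
    omega
  have hr3R : (3 : ℝ) ≤ r := by exact_mod_cast hr3
  have hrnR : (r : ℝ) ≤ n := by exact_mod_cast hrn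
  have hsnR : (s : ℝ) < n := by exact_mod_cast hsn
  have hn7 : (7 : ℝ) ≤ n := by exact_mod_cast (by omega : 7 ≤ n)
  have hn : (0 : ℝ) < n := by linarith
  have hη : 0 ≤ 1 - (s : ℝ) / n := by
    rw [sub_nonneg, div_le_one hn]; exact hsnR.le
  have hε1 : 0 < 1 + ε := by linarith
  refine ⟨?_, fun d hd hdle => ?_⟩
  -- K = (n+1)/r rather than n/r, because 1 + q = (n+1)/(n-k₁+1).
  · have hK1 : 1 ≤ ((n : ℝ) + 1) / r := by rw [le_div_iff₀ (by linarith)]; linarith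
    refine (BlockJS.union_bound hdgp hiid hM₁ hMn hsm (by omega) hsn hc₁ hc₂ hε hK1
      (Or.inl fun m hm => ?_)).trans ?_
    · rw [div_mul_eq_mul_div, le_div_iff₀ (by linarith)]
      exact mul_le_mul_of_nonneg_left (by exact_mod_cast hrm m hm) (by linarith)
    · refine mul_le_mul_of_nonneg_left (Real.exp_le_exp.2 (neg_le_neg ?_)) (by positivity)
      have hcmp : ((r : ℝ) / n) ^ 2 * (1 / 14397) ≤ 1 / 10500 / (((n : ℝ) + 1) / r) ^ 2 := by
        rw [div_pow, div_pow, div_div_eq_mul_div, div_mul_div_comm,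
          div_le_div_iff₀ (by positivity) (by positivity)]
        -- The excess of 14397 over 10500 pays for replacing n+1 by n: two blocks of at least three
        -- regressors force n ≥ 7, and 10500·(8/7)² < 14397.
        have h1 : 10500 * ((n : ℝ) + 1) ^ 2 ≤ 14397 * (n : ℝ) ^ 2 := by nlinarith
        have h2 := mul_le_mul_of_nonneg_left h1 (sq_nonneg (r : ℝ))
        linarith
      calc (n : ℝ) * ((r : ℝ) / n) ^ 2 * (1 - (s : ℝ) / n) ^ 5 * (ε ^ 2 / (14397 * (1 + ε) ^ 2))
          = (n : ℝ) * (1 - (s : ℝ) / n) ^ 5 * (ε ^ 2 / (1 + ε) ^ 2)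
            * (((r : ℝ) / n) ^ 2 * (1 / 14397)) := by field_simp
        _ ≤ (n : ℝ) * (1 - (s : ℝ) / n) ^ 5 * (ε ^ 2 / (1 + ε) ^ 2)
            * (1 / 10500 / (((n : ℝ) + 1) / r) ^ 2) :=
          mul_le_mul_of_nonneg_left hcmp (by positivity)
        _ = _ := by field_simp
  -- Automatic, since the variance of the response is at least σ², which is at least the error
  -- variance; so `d` itself can serve as K.
  · have hd1 : 1 ≤ d := by
      obtain ⟨L₁, B, L₂, a, b, σ, hf⟩ := hdgp.exists_hasFactor m₀
      refine le_trans ?_ hdle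
      rw [le_div_iff₀ hdgp.variance_pos, hf.variance_eq hdgp]
      have h1 := hf.le_sq hdgp
      have h2 := BlockJS.dotProduct_self_nonneg' a
      have h3 := BlockJS.dotProduct_self_nonneg' b
      linarith
    refine (BlockJS.union_bound hdgp hiid hM₁ hMn hsm (by omega) hsn hc₁ hc₂ hε hd1
      (Or.inr hdle)).trans ?_
    refine mul_le_mul_of_nonneg_left (Real.exp_le_exp.2 (neg_le_neg ?_)) (by positivity)
    rw [mul_div_assoc, div_div]
    refine mul_le_mul_of_nonneg_left ?_ (by positivity)
    gcongr
    norm_num
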